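/- Let $R\in(0,\infty]$, let $a(dy)$ be a non-negative, locally finite Borel measure on $[0,R)$, and let $b:[0,R)\to\mathbb R$ be a Borel function such that $b^2$ is locally integrable on $[0,R)$ and the measure $a(dy)-b(y)^2\,dy$ is non-negative on $[0,R)$. Formally, let $L=a(dy)\,\partial_{xx}+2b(y)\,\partial_{xy}+\partial_{yy}$ (an operator of class $\mathbb L$), and set $B(y)=\int_0^y b(t)\,dt$. A Borel function $u:\mathbb R\times[0,R)\to\mathbb C$ is called *harmonic with respect to $L$* if: (a) $u(\cdot,y)\in L^2(\mathbb R)$ for every $y\in[0,R)$, and $y\mapsto u(\cdot,y)$ is continuous from $[0,R)$ to $L^2(\mathbb R)$; if $R=\infty$, then $\|u(\cdot,y)\|_{L^2(\mathbb R)}$ is bounded in $y\in[0,\infty)$, and if $R<\infty$, then $u(\cdot,y)\to0$ in $L^2(\mathbb R)$ as $y\to R^-$; (b) the function $\tilde u(x,y)=u(x+B(y),y)$ has a weak derivative $\partial_y\tilde u$ with respect to $y$ on $\mathbb R\times(0,R)$ (a locally integrable Borel function with $\int_0^R\int_{\mathbb R}\partial_y\tilde u\,v\,dx\,dy=-\int_0^R\int_{\mathbb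 R}\tilde u\,\partial_y v\,dx\,dy$ for all $v\in C_c^\infty(\mathbb R\times(0,R))$), and $|\partial_y\tilde u|^2$ is integrable over $\mathbb R\times(y_1,y_2)$ whenever $0<y_1<y_2<R$; (c) $Lu=0$ in the weak sense in $\mathbb R\times(0,R)$: for every $v\in C_c^\infty(\mathbb R\times(0,R))$, $$\int_{(0,R)}\Bigl(\int_{\mathbb R}u\,\partial_{xx}v\,dx\Bigr)a(dy)-2\int_0^R\Bigl(\int_{\mathbb R}\bigl(\partial_y\tilde u(x-B(y),y)\,\partial_xv(x,y)+b(y)\,u(x,y)\,\partial_{xx}v(x,y)\bigr)dx\Bigr)b(y)\,dy+\int_0^R\Bigl(\int_{\mathbb R}u\,\partial_{yy}v\,dx\Bigr)dy=0 .$$ For $\xi\in\mathbb R$, a solution on $[0,R)$ of the equation $$\varphi''(dt)=\xi^2\varphi(t)\,a(dt)-2i\xi\,b(t)\,\varphi'(t)\,dt$$ is a locally absolutely continuous function $\varphi:[0,R)\to\mathbb C$ whose derivative has a (left-continuous) version $\varphi'$ on $[0,R)$, with $\varphi'$ and $b\varphi'$ locally integrable on $[0,R)$, such that $\varphi'(t)=\varphi'(0)+\xi^2\int_{[0,t)}\varphi(s)\,a(ds)-2i\xi\int_0^t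 b(s)\varphi'(s)\,ds$ for all $t\in[0,R)$. **Proposition.** (i) For every $\xi\in\mathbb R\setminus\{0\}$ there is a unique solution $\varphi_\xi$ of this equation on $[0,R)$ such that $\varphi_\xi(0)=1$ and such that $\varphi_\xi$ is bounded if $R=\infty$, and $\varphi_\xi(R^-)=0$ if $R<\infty$. Put $\varphi_0\equiv1$. (ii) For every $f\in L^2(\mathbb R)$ there is a function $u$ harmonic with respect to $L$ such that $u(x,0)=f(x)$ for almost all $x\in\mathbb R$. It is unique: if $w$ is another such function, then for every $y\in[0,R)$ we have $w(x,y)=u(x,y)$ for almost all $x\in\mathbb R$. (iii) The function $u$ in (ii) satisfies, for every $y\in[0,R)$, $$\hat u(\xi,y)=\hat f(\xi)\,\varphi_\xi(y)\qquad\text{for almost all }\xi\in\mathbb R,$$ where $\hat{\ }$ denotes the Fourier transform on $L^2(\mathbb R)$ in the variable $x$, normalised by $\hat f(\xi)=\int_{\mathbb R}e^{-i\xi x}f(x)\,dx$ for $f\in L^1(\mathbb R)\cap L^2(\mathbb R)$. -/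

import Mathlib

open MeasureTheory Filter Topology Set
open scoped ContDiff FourierTransform

noncomputable section

namespace HarmExt

/-- The half-open interval `[0, R)`, where `R ∈ (0, ∞]`. -/
def dom (R : EReal) : Set ℝ := {y | 0 ≤ y ∧ (y : EReal) < R}

/-- The open interval `(0, R)`, where `R ∈ (0, ∞]`. -/
def openDom (R : EReal) : Set ℝ := {y | 0 < y ∧ (y : EReal) < R}

/-- The operators `L = a(dy) ∂ₓₓ + 2 b(y) ∂ₓᵧ + ∂ᵧᵧ` of class `𝕃` on `ℝ × [0, R)`, given by their
coefficients. Only the values of `a` and `b` on `[0, R)` matter. -/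
structure OpL where
  R : EReal
  R_pos : 0 < R
  a : Measure ℝ
  /-- `a` is locally finite on `[0, R)`. -/
  a_finite : ∀ r ∈ dom R, a (Icc 0 r) < ⊤
  b : ℝ → ℝ
  b_measurable : Measurable b
  /-- `b²` is locally integrable on `[0, R)`. -/
  b_sq_integrable : ∀ r ∈ dom R, IntegrableOn (fun y => b y ^ 2) (Icc 0 r) volume
  /-- `a(dy) - b(y)² dy` is non-negative on `[0, R)`. -/
  b_sq_le_a : (volume.restrict (dom R)).withDensity (fun y => ENNReal.ofReal (b y ^ 2)) ≤
    a.restrict (dom R)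

/-- `B(y) = ∫₀ʸ b(t) dt`. -/
def OpL.B (L : OpL) (y : ℝ) : ℝ := ∫ t in (0 : ℝ)..y, L.b t

/-- The shear `ũ(x, y) = u(x + B(y), y)`. -/
def OpL.shear (L : OpL) (u : ℝ → ℝ → ℂ) (x y : ℝ) : ℂ := u (x + L.B y) y

/-- The pointwise derivative with respect to the first variable. -/
def dx (v : ℝ → ℝ → ℂ) (x y : ℝ) : ℂ := deriv (fun s => v s y) x

/-- The pointwise derivative with respect to the second variable. -/
def dy (v : ℝ → ℝ → ℂ) (x y : ℝ) : ℂ := deriv (fun t => v x t) y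

/-- Smooth functions whose support is a compact subset of `ℝ × (0, R)`. -/
structure IsTest (R : EReal) (v : ℝ → ℝ → ℂ) : Prop where
  smooth : ContDiff ℝ ∞ (Function.uncurry v)
  compact : HasCompactSupport (Function.uncurry v)
  support : tsupport (Function.uncurry v) ⊆ univ ×ˢ openDom R

/-- `g` is a weak derivative of `w` with respect to `y` on `ℝ × (0, R)`. -/
structure IsWeakDy (R : EReal) (w g : ℝ → ℝ → ℂ) : Prop where
  borel : Measurable ((univ ×ˢ openDom R).domRestrict (Function.uncurry g))
  locallyIntegrable : LocallyIntegrableOn (Function.uncurry g) (univ ×ˢ openDom R) volume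
  byParts : ∀ v, IsTest R v →
    ∫ y in openDom R, ∫ x, g x y * v x y = -∫ y in openDom R, ∫ x, w x y * dy v x y

/-- The weak form of `L u = 0` on `ℝ × (0, R)`, where `g` stands for `∂ᵧ ũ`. Formally
`∂ᵧ u(x, y) = g(x - B(y), y) - b(y) ∂ₓ u(x, y)`, and the term
`-2 ∫ (∫ ∂ᵧ u ∂ₓ v dx) b(y) dy` is written accordingly, with the derivative `∂ₓ` of
`b(y) ∂ₓ u(x, y)` moved to the test function. -/
def OpL.WeakEq (L : OpL) (u g : ℝ → ℝ → ℂ) : Prop :=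
  ∀ v, IsTest L.R v →
    (∫ y in openDom L.R, (∫ x, u x y * dx (dx v) x y) ∂L.a)
      - 2 * (∫ y in openDom L.R,
          (∫ x, (g (x - L.B y) y * dx v x y + (L.b y : ℂ) * u x y * dx (dx v) x y)) * (L.b y : ℂ))
      + (∫ y in openDom L.R, ∫ x, u x y * dy (dy v) x y) = 0

/-- Functions on `ℝ × [0, R)` harmonic with respect to `L`; the values of `u` outside
`ℝ × [0, R)` play no role. -/
structure OpL.IsHarmonic (L : OpL) (u : ℝ → ℝ → ℂ) : Prop where
  borel : Measurable ((univ ×ˢ dom L.R).domRestrict (Function.uncurry u))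
  memLp : ∀ y ∈ dom L.R, MemLp (fun x => u x y) 2 volume
  continuous : ∀ y₀ ∈ dom L.R,
    Tendsto (fun y => eLpNorm (fun x => u x y - u x y₀) 2 volume) (𝓝[dom L.R] y₀) (𝓝 0)
  bounded : L.R = ⊤ → ∃ C : ℝ, ∀ y ∈ dom L.R, eLpNorm (fun x => u x y) 2 volume ≤ ENNReal.ofReal C
  vanishing : ∀ r : ℝ, L.R = (r : EReal) →
    Tendsto (fun y => eLpNorm (fun x => u x y) 2 volume) (𝓝[<] r) (𝓝 0)
  equation : ∃ g : ℝ → ℝ → ℂ, IsWeakDy L.R (L.shear u) g ∧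
    (∀ y₁ y₂ : ℝ, 0 < y₁ → y₁ < y₂ → (y₂ : EReal) < L.R →
      MemLp (Function.uncurry g) 2 (volume.restrict (univ ×ˢ Ioo y₁ y₂))) ∧
    L.WeakEq u g

/-- Solutions on `[0, R)` of `φ''(dt) = ξ² φ(t) a(dt) - 2 i ξ b(t) φ'(t) dt`: `φ` is locally
absolutely continuous, with derivative (almost everywhere) the left-continuous function `ψ`, and
the measure `φ''`, which assigns mass `ψ(t) - ψ(0)` to `[0, t)`, is the right-hand side.
In particular an atom of `a` at `0` contributes to `φ''`. -/
def OpL.IsODESolution (L : OpL) (ξ : ℝ) (φ : ℝ → ℂ) : Prop :=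
  ∃ ψ : ℝ → ℂ, ∀ t ∈ dom L.R,
    IntegrableOn ψ (Icc 0 t) volume ∧
    IntegrableOn (fun s => (L.b s : ℂ) * ψ s) (Icc 0 t) volume ∧
    φ t = φ 0 + ∫ s in (0 : ℝ)..t, ψ s ∧
    ψ t = ψ 0 + (ξ : ℂ) ^ 2 * (∫ s in Ico 0 t, φ s ∂L.a)
      - 2 * Complex.I * (ξ : ℂ) * ∫ s in (0 : ℝ)..t, (L.b s : ℂ) * ψ s

/-- `φ` is the distinguished solution `φ_ξ` on `[0, R)`: the one with `φ(0) = 1` that is bounded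
if `R = ∞` and that vanishes at `R⁻` if `R < ∞`; for `ξ = 0` it is the constant solution `1`. -/
def OpL.IsPhi (L : OpL) (ξ : ℝ) (φ : ℝ → ℂ) : Prop :=
  (ξ = 0 → ∀ y ∈ dom L.R, φ y = 1) ∧
  (ξ ≠ 0 → L.IsODESolution ξ φ ∧ φ 0 = 1 ∧
    (L.R = ⊤ → ∃ C : ℝ, ∀ y ∈ dom L.R, ‖φ y‖ ≤ C) ∧
    (∀ r : ℝ, L.R = (r : EReal) → Tendsto φ (𝓝[<] r) (𝓝 0)))

/-- The Fourier transform on `L²(ℝ)`, normalised by `f̂(ξ) = ∫ exp(-i ξ x) f(x) dx` for integrable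
`f`; Mathlib's `𝓕` has the kernel `exp(-2 π i ξ x)`. -/
def fourierL2 (f : Lp ℂ 2 (volume : Measure ℝ)) (ξ : ℝ) : ℂ :=
  (𝓕 f : Lp ℂ 2 (volume : Measure ℝ)) (ξ / (2 * Real.pi))

end HarmExt

end

/-! The Fourier transform in x turns L u = 0 into the ordinary differential equation of the
statement, one frequency at a time, and one estimate for that equation carries everything. For a
solution φ with derivative ψ, the product rule for conj φ · ψ, the inequality b² dy ≤ a and a
completion of the square give ∫_s^t |ψ + iξbφ|² ≤ Re(conj φ · ψ)(t) - Re(conj φ · ψ)(s)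
(`IsSol.integral_sq_le`). As 2 Re(conj φ · ψ) is the derivative of |φ|², the function |φ|² is convex
(`IsSol.norm_sq_mul_le`).

Uniqueness of φ_ξ: the squared modulus of the difference of two candidates is convex, vanishes at 0,
and is bounded or tends to 0 at R, so it is zero (`eq_zero_of_norm_sq_mul_le`). Existence: the
integrating factor exp(2iξB) removes the first-order term, and a Volterra series gives solutions
with arbitrary initial data, jointly measurable in (ξ, t). By convexity the solution with data (0,
1) has no zero in (0, R), so for each r some solution equals 1 at 0 and 0 at r. Convexity bounds its
squared modulus by 1 - y/r and makes the initial slopes Cauchy as r increases to R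
(`OpL.norm_sq_slope_sub_le`). The limit satisfies |φ_ξ| ≤ 1, and |φ_ξ|² ≤ 1 - y/R if R < ∞
(`OpL.exists_family`).

Existence of u: take the inverse Fourier transform of f̂(ξ) φ_ξ(y) (`IsFamily.exists_harmonic`).
Continuity and the behaviour at R follow from the bounds on φ_ξ. The shear becomes multiplication by
exp(iξB), and exp(iξB)φ has derivative exp(iξB)(ψ + iξbφ), which is the quantity in the energy
inequality. Convexity bounds Re(conj φ · ψ) at interior points independently of ξ, so ∂_y ũ is
square integrable on strips. Parseval in x and Fubini reduce both weak identities to the tested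
equation at each frequency.

Uniqueness of u: the argument is run backwards. For an arbitrary harmonic w, products α(x)β(y) as
test functions show that, for almost every frequency, the transform of w has an absolutely
continuous version that solves the equation on [s, T] ⊂ (0, R) (`IsSpec.ae_exists_isSol`); a
countable family of β keeps the exceptional set null. Integrating the convexity over the frequencies
makes the squared L² norm of a difference convex on (0, R). Continuity extends this to 0, and
`eq_zero_of_norm_sq_mul_le` applies once more (`OpL.IsHarmonic.ae_eq`). -/

noncomputable section
namespace HarmExt

/-! ### Integration by parts against measures with atoms -/

section IntegrationByParts

variable {μ : Measure ℝ} {s t T : ℝ} {φ φ' f k F : ℝ → ℂ}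

/-- The function `r ↦ ∫_{[s, r)} f dμ` is measurable. -/
theorem measurable_integral_Ico [SFinite μ] (hf : StronglyMeasurable f) :
    StronglyMeasurable fun r : ℝ => ∫ u in Ico s r, f u ∂μ := by
  have h : (fun r : ℝ => ∫ u in Ico s r, f u ∂μ) =
      fun r => ∫ u, ({q : ℝ × ℝ | s ≤ q.2 ∧ q.2 < q.1}.indicator (fun q => f q.2) (r, u)) ∂μ := by
    ext r
    rw [← integral_indicator measurableSet_Ico]
    rfl
  rw [h]
  refine StronglyMeasurable.integral_prod_right (f := fun r u =>
    ({q : ℝ × ℝ | s ≤ q.2 ∧ q.2 < q.1}.indicator (fun q => f q.2) (r, u))) ?_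
  exact (hf.comp_measurable measurable_snd).indicator
    ((measurableSet_le measurable_const measurable_snd).inter
      (measurableSet_lt measurable_snd measurable_fst))

theorem integrableOn_mul_integral_Ico (hμ : μ (Ico s t) < ⊤)
    (hφ' : IntegrableOn φ' (Icc s t)) (hf : IntegrableOn f (Ico s t) μ) :
    IntegrableOn (fun r => φ' r * ∫ u in Ico s r, f u ∂μ) (Icc s t) := by
  have : IsFiniteMeasure (μ.restrict (Ico s t)) := ⟨by simpa using hμ⟩
  obtain ⟨f₀, hf₀, hff₀⟩ := hf.aestronglyMeasurable
  have h : ∀ r ∈ Icc s t, ∫ u in Ico s r, f u ∂μ = ∫ u in Ico s r, f₀ u ∂(μ.restrict (Ico s t)) := by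
    intro r hr
    rw [Measure.restrict_restrict measurableSet_Ico,
      inter_eq_left.2 (Ico_subset_Ico_right hr.2)]
    refine integral_congr_ae ?_
    exact ae_restrict_of_ae_restrict_of_subset (Ico_subset_Ico_right hr.2) hff₀
  have hm : StronglyMeasurable fun r : ℝ => ∫ u in Ico s r, f₀ u ∂(μ.restrict (Ico s t)) :=
    measurable_integral_Ico hf₀
  have : IntegrableOn (fun r => (∫ u in Ico s r, f₀ u ∂(μ.restrict (Ico s t))) * φ' r) (Icc s t) := by
    refine Integrable.bdd_mul (c := ∫ u in Ico s t, ‖f₀ u‖ ∂μ) hφ' hm.aestronglyMeasurable ?_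
    refine Eventually.of_forall fun r => ?_
    refine (norm_integral_le_integral_norm _).trans ?_
    refine integral_mono_measure Measure.restrict_le_self (Eventually.of_forall fun _ => norm_nonneg _) ?_
    exact (hf.congr hff₀).norm
  refine this.congr_fun (fun r hr => ?_) measurableSet_Icc
  simp only [h r hr, mul_comm]

/-- Integration by parts for an absolutely continuous function and a distribution function. -/
theorem mul_integral_Ico_eq (hst : s ≤ t) (hμ : μ (Ico s t) < ⊤)
    (hφ' : IntegrableOn φ' (Icc s t)) (hφ : ∀ u ∈ Icc s t, φ u = φ s + ∫ r in s..u, φ' r)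
    (hf : IntegrableOn f (Ico s t) μ) :
    φ t * ∫ u in Ico s t, f u ∂μ =
      (∫ r in s..t, φ' r * ∫ u in Ico s r, f u ∂μ) + ∫ u in Ico s t, φ u * f u ∂μ := by
  have : IsFiniteMeasure (μ.restrict (Ico s t)) := ⟨by simpa using hμ⟩
  have hφ'' : IntegrableOn φ' (Ioc s t) := hφ'.mono_set Ioc_subset_Icc_self
  -- Fubini on the triangle u < r. The strict inequality produces the half-open sets [s, r), so
  -- atoms are counted as left-continuity demands.
  have hint : Integrable (fun q : ℝ × ℝ => {q : ℝ × ℝ | q.2 < q.1}.indicator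
      (fun q => φ' q.1 * f q.2) q)
      ((volume.restrict (Ioc s t)).prod (μ.restrict (Ico s t))) :=
    (hφ''.mul_prod hf).indicator (measurableSet_lt measurable_snd measurable_fst)
  have hswap := integral_integral_swap (f := fun r u => {q : ℝ × ℝ | q.2 < q.1}.indicator
      (fun q => φ' q.1 * f q.2) (r, u)) hint
  have h1 : (∫ r in Ioc s t, ∫ u in Ico s t, {q : ℝ × ℝ | q.2 < q.1}.indicator
      (fun q => φ' q.1 * f q.2) (r, u) ∂μ) = ∫ r in s..t, φ' r * ∫ u in Ico s r, f u ∂μ := by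
    rw [intervalIntegral.integral_of_le hst]
    refine setIntegral_congr_fun measurableSet_Ioc fun r hr => ?_
    have : (fun u => {q : ℝ × ℝ | q.2 < q.1}.indicator (fun q => φ' q.1 * f q.2) (r, u)) =
        (Iio r).indicator fun u => φ' r * f u := rfl
    simp only [this]
    rw [integral_indicator measurableSet_Iio, Measure.restrict_restrict measurableSet_Iio,
      integral_const_mul]
    congr 3
    ext u
    simp only [mem_inter_iff, mem_Iio, mem_Ico, mem_Ioc] at hr ⊢
    constructor
    · rintro ⟨h, h', _⟩; exact ⟨h', h⟩
    · rintro ⟨h, h'⟩; exact ⟨h', h, h'.trans_le hr.2⟩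
  have h2 : (∫ u in Ico s t, ∫ r in Ioc s t, {q : ℝ × ℝ | q.2 < q.1}.indicator
      (fun q => φ' q.1 * f q.2) (r, u) ∂volume ∂μ) = ∫ u in Ico s t, (φ t - φ u) * f u ∂μ := by
    refine setIntegral_congr_fun measurableSet_Ico fun u hu => ?_
    have : (fun r => {q : ℝ × ℝ | q.2 < q.1}.indicator (fun q => φ' q.1 * f q.2) (r, u)) =
        (Ioi u).indicator fun r => φ' r * f u := rfl
    simp only [this]
    rw [integral_indicator measurableSet_Ioi, Measure.restrict_restrict measurableSet_Ioi,
      integral_mul_const]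
    have h3 : Ioi u ∩ Ioc s t = Ioc u t := by
      ext r
      simp only [mem_inter_iff, mem_Ioi, mem_Ico, mem_Ioc] at hu ⊢
      constructor
      · rintro ⟨h, h', h''⟩; exact ⟨h, h''⟩
      · rintro ⟨h, h'⟩; exact ⟨h, hu.1.trans_lt h, h'⟩
    have hii : IntervalIntegrable φ' volume s t :=
      (intervalIntegrable_iff_integrableOn_Ioc_of_le hst).2 hφ''
    have hsu : IntervalIntegrable φ' volume s u := hii.mono_set (by
      rw [uIcc_of_le hst, uIcc_of_le hu.1]; exact Icc_subset_Icc_right hu.2.le)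
    rw [h3, ← intervalIntegral.integral_of_le hu.2.le, hφ t ⟨hst, le_rfl⟩, hφ u ⟨hu.1, hu.2.le⟩,
      ← intervalIntegral.integral_interval_sub_left hii hsu]
    ring
  rw [h1, h2] at hswap
  have hcont : ContinuousOn φ (Icc s t) := by
    have : ContinuousOn (fun u => φ s + ∫ r in s..u, φ' r) (Icc s t) := by
      have := intervalIntegral.continuousOn_primitive_interval' (f := φ') (μ := volume) (a := s)
        (b₁ := s) (b₂ := t)
        ((intervalIntegrable_iff_integrableOn_Ioc_of_le hst).2 hφ'') left_mem_uIcc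
      rw [uIcc_of_le hst] at this
      exact continuousOn_const.add this
    exact this.congr hφ
  obtain ⟨C, hC⟩ := isCompact_Icc.exists_bound_of_continuousOn hcont
  have hφf : IntegrableOn (fun u => φ u * f u) (Ico s t) μ := by
    refine Integrable.bdd_mul (c := C) hf
      ((hcont.mono Ico_subset_Icc_self).aestronglyMeasurable measurableSet_Ico) ?_
    exact (ae_restrict_mem measurableSet_Ico).mono fun u hu => hC u (Ico_subset_Icc_self hu)
  rw [hswap, ← integral_const_mul]
  simp only [sub_mul]
  rw [integral_sub (hf.const_mul _) hφf]
  ring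

/-- Product rule for an absolutely continuous function `φ` and a function `F` whose derivative is
the measure `f dμ + k dt`. -/
theorem mul_sub_mul_eq (hst : s ≤ t) (hμ : μ (Ico s t) < ⊤)
    (hφ' : IntegrableOn φ' (Icc s t)) (hφ : ∀ u ∈ Icc s t, φ u = φ s + ∫ r in s..u, φ' r)
    (hf : IntegrableOn f (Ico s t) μ) (hk : IntegrableOn k (Icc s t))
    (hF : ∀ u ∈ Icc s t, F u = F s + ∫ r in Ico s u, f r ∂μ + ∫ r in s..u, k r) :
    φ t * F t - φ s * F s = (∫ r in s..t, φ' r * F r) + (∫ u in Ico s t, φ u * f u ∂μ) +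
      ∫ r in s..t, φ r * k r := by
  have hk' : IntegrableOn k (Ico s t) := hk.mono_set Ico_subset_Icc_self
  have e1 := mul_integral_Ico_eq hst hμ hφ' hφ hf
  have e2 := mul_integral_Ico_eq hst (μ := volume) (by simp) hφ' hφ hk'
  have i1 := integrableOn_mul_integral_Ico hμ hφ' hf
  have i2 := integrableOn_mul_integral_Ico (μ := volume) (by simp) hφ' hk'
  have hI : ∀ u, s ≤ u → ∀ q : ℝ → ℂ, ∫ r in Ico s u, q r = ∫ r in s..u, q r := by
    intro u hu q
    rw [intervalIntegral.integral_of_le hu, integral_Ico_eq_integral_Ioc]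
  have hii : ∀ {q : ℝ → ℂ}, IntegrableOn q (Icc s t) → IntervalIntegrable q volume s t := fun h =>
    (intervalIntegrable_iff_integrableOn_Icc_of_le hst).2 h
  have e3 : (∫ r in s..t, φ' r * F r) = F s * (∫ r in s..t, φ' r) +
      (∫ r in s..t, φ' r * ∫ u in Ico s r, f u ∂μ) + ∫ r in s..t, φ' r * ∫ u in Ico s r, k u := by
    rw [← intervalIntegral.integral_const_mul, ← intervalIntegral.integral_add
      ((hii hφ').const_mul _) (hii i1), ← intervalIntegral.integral_add
      (((hii hφ').const_mul _).add (hii i1)) (hii i2)]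
    refine intervalIntegral.integral_congr fun r hr => ?_
    rw [uIcc_of_le hst] at hr
    simp only [hF r hr, hI r hr.1]
    ring
  rw [hI t hst, hI t hst] at e2
  rw [e3, hF t ⟨hst, le_rfl⟩]
  have e4 := hφ t ⟨hst, le_rfl⟩
  linear_combination e1 + e2 + F s * e4

end IntegrationByParts
end HarmExt
end

/-! ### The equation on a compact interval: energy inequality and convexity -/

noncomputable section
namespace HarmExt

/-- The conditions on the coefficients, on the interval `[s, T]`. -/
structure Coeff (a : Measure ℝ) (b : ℝ → ℝ) (s T : ℝ) : Prop where
  finite : a (Icc s T) < ⊤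
  measurable : Measurable b
  sq_integrable : IntegrableOn (fun y => b y ^ 2) (Icc s T)
  sq_le : (volume.restrict (Ico s T)).withDensity (fun y => ENNReal.ofReal (b y ^ 2)) ≤
    a.restrict (Ico s T)

/-- Solutions of `φ'' = ξ² φ a - 2 i ξ b φ'` on `[s, T]`, with `ψ` the derivative of `φ`. -/
structure IsSol (a : Measure ℝ) (b : ℝ → ℝ) (ξ s T : ℝ) (φ ψ : ℝ → ℂ) : Prop where
  int_deriv : IntegrableOn ψ (Icc s T)
  int_mul_deriv : IntegrableOn (fun r => (b r : ℂ) * ψ r) (Icc s T)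
  eq : ∀ t ∈ Icc s T, φ t = φ s + ∫ r in s..t, ψ r
  deriv_eq : ∀ t ∈ Icc s T, ψ t = ψ s + (ξ : ℂ) ^ 2 * (∫ r in Ico s t, φ r ∂a)
    - 2 * Complex.I * (ξ : ℂ) * ∫ r in s..t, (b r : ℂ) * ψ r

variable {a : Measure ℝ} {b : ℝ → ℝ} {ξ s t T s' T' : ℝ} {φ ψ φ₁ ψ₁ φ₂ ψ₂ : ℝ → ℂ}

theorem Coeff.mono (h : Coeff a b s T) (hs : s ≤ s') (hT : T' ≤ T) : Coeff a b s' T' where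
  finite := (measure_mono (Icc_subset_Icc hs hT)).trans_lt h.finite
  measurable := h.measurable
  sq_integrable := h.sq_integrable.mono_set (Icc_subset_Icc hs hT)
  sq_le := by
    have := Measure.restrict_mono_measure h.sq_le (Ico s' T')
    rwa [restrict_withDensity measurableSet_Ico, Measure.restrict_restrict measurableSet_Ico,
      Measure.restrict_restrict measurableSet_Ico,
      inter_eq_left.2 (Ico_subset_Ico hs hT)] at this

/-- The measure inequality b² dy ≤ a in integrated form; this is how the non-negativity of a - b² dy
enters the energy inequality. -/
theorem Coeff.integral_sq_mul_le (h : Coeff a b s T) {f : ℝ → ℝ} (hf : ContinuousOn f (Icc s T))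
    (hf0 : ∀ x, 0 ≤ f x) : ∫ r in Ico s T, b r ^ 2 * f r ≤ ∫ r in Ico s T, f r ∂a := by
  have hfin : a (Ico s T) < ⊤ := (measure_mono Ico_subset_Icc_self).trans_lt h.finite
  obtain ⟨C, hC⟩ := isCompact_Icc.exists_bound_of_continuousOn hf
  have hfa : IntegrableOn f (Ico s T) a := by
    have : IsFiniteMeasure (a.restrict (Ico s T)) := ⟨by simpa using hfin⟩
    refine Integrable.of_bound
      ((hf.mono Ico_subset_Icc_self).aestronglyMeasurable measurableSet_Ico) C ?_
    exact (ae_restrict_mem measurableSet_Ico).mono fun u hu => hC u (Ico_subset_Icc_self hu)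
  have := integral_mono_measure h.sq_le (Eventually.of_forall hf0) hfa
  rw [integral_withDensity_eq_integral_toReal_smul
    (h.measurable.pow_const 2).ennreal_ofReal (Eventually.of_forall fun _ => by simp)] at this
  simpa [ENNReal.toReal_ofReal (sq_nonneg _)] using this

theorem Coeff.integrableOn (h : Coeff a b s T) : IntegrableOn b (Icc s T) := by
  have h2 : MemLp b 2 (volume.restrict (Icc s T)) :=
    (memLp_two_iff_integrable_sq h.measurable.aestronglyMeasurable).2 h.sq_integrable
  exact h2.integrable (by norm_num)

theorem integrableOn_of_continuousOn (ha : a (Icc s T) < ⊤) {f : ℝ → ℂ}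
    (hf : ContinuousOn f (Icc s T)) : IntegrableOn f (Ico s T) a := by
  obtain ⟨C, hC⟩ := isCompact_Icc.exists_bound_of_continuousOn hf
  have : IsFiniteMeasure (a.restrict (Ico s T)) :=
    ⟨by simpa using (measure_mono Ico_subset_Icc_self).trans_lt ha⟩
  refine Integrable.of_bound
    ((hf.mono Ico_subset_Icc_self).aestronglyMeasurable measurableSet_Ico) C ?_
  exact (ae_restrict_mem measurableSet_Ico).mono fun u hu => hC u (Ico_subset_Icc_self hu)

theorem continuousOn_of_eq_integral {f f' : ℝ → ℂ} (hf' : IntegrableOn f' (Icc s T))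
    (h : ∀ t ∈ Icc s T, f t = f s + ∫ r in s..t, f' r) : ContinuousOn f (Icc s T) := by
  rcases lt_or_ge T s with hst | hst
  · simp [Icc_eq_empty_of_lt hst]
  have : ContinuousOn (fun u => f s + ∫ r in s..u, f' r) (Icc s T) := by
    have := intervalIntegral.continuousOn_primitive_interval' (f := f') (μ := volume) (a := s)
      (b₁ := s) (b₂ := T) ((intervalIntegrable_iff_integrableOn_Icc_of_le hst).2 hf') left_mem_uIcc
    rw [uIcc_of_le hst] at this
    exact continuousOn_const.add this
  exact this.congr h

theorem IsSol.continuousOn (h : IsSol a b ξ s T φ ψ) : ContinuousOn φ (Icc s T) :=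
  continuousOn_of_eq_integral h.int_deriv h.eq

theorem intervalIntegrable_of_Icc {f : ℝ → ℂ} (hf : IntegrableOn f (Icc s T)) {x y : ℝ}
    (hx : x ∈ Icc s T) (hy : y ∈ Icc s T) : IntervalIntegrable f volume x y :=
  ((intervalIntegrable_iff_integrableOn_Icc_of_le (hx.1.trans hx.2)).2 hf).mono_set
    (by rw [uIcc_of_le (hx.1.trans hx.2)]; exact uIcc_subset_Icc hx hy)

theorem IsSol.mono (ha : a (Icc s T) < ⊤) (h : IsSol a b ξ s T φ ψ) (hs : s ≤ s') (hsT : s' ≤ T')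
    (hT : T' ≤ T) : IsSol a b ξ s' T' φ ψ where
  int_deriv := h.int_deriv.mono_set (Icc_subset_Icc hs hT)
  int_mul_deriv := h.int_mul_deriv.mono_set (Icc_subset_Icc hs hT)
  eq t ht := by
    have hs' : s' ∈ Icc s T := ⟨hs, hsT.trans hT⟩
    have ht' : t ∈ Icc s T := ⟨hs.trans ht.1, ht.2.trans hT⟩
    have hss : s ∈ Icc s T := ⟨le_rfl, hs.trans hs'.2⟩
    rw [h.eq t ht', h.eq s' hs', ← intervalIntegral.integral_add_adjacent_intervals
      (intervalIntegrable_of_Icc h.int_deriv hss hs') (intervalIntegrable_of_Icc h.int_deriv hs' ht')]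
    ring
  deriv_eq t ht := by
    have hs' : s' ∈ Icc s T := ⟨hs, hsT.trans hT⟩
    have ht' : t ∈ Icc s T := ⟨hs.trans ht.1, ht.2.trans hT⟩
    have hss : s ∈ Icc s T := ⟨le_rfl, hs.trans hs'.2⟩
    have hi := integrableOn_of_continuousOn ha h.continuousOn
    have h2 : ∫ r in Ico s t, φ r ∂a = (∫ r in Ico s s', φ r ∂a) + ∫ r in Ico s' t, φ r ∂a := by
      rw [← Ico_union_Ico_eq_Ico hs ht.1]
      exact setIntegral_union (by
        rw [Set.disjoint_left]; intro x hx hx'; exact absurd hx.2 (not_lt.2 hx'.1)) measurableSet_Ico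
        (hi.mono_set (Ico_subset_Ico_right hs'.2))
        (hi.mono_set (Ico_subset_Ico hs ht'.2))
    rw [h.deriv_eq t ht', h.deriv_eq s' hs', h2, ← intervalIntegral.integral_add_adjacent_intervals
      (intervalIntegrable_of_Icc h.int_mul_deriv hss hs')
      (intervalIntegrable_of_Icc h.int_mul_deriv hs' ht')]
    ring

/-- Linear combinations of solutions. -/
theorem IsSol.add_const_mul (ha : a (Icc s T) < ⊤) (h₁ : IsSol a b ξ s T φ₁ ψ₁)
    (h₂ : IsSol a b ξ s T φ₂ ψ₂) (c : ℂ) :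
    IsSol a b ξ s T (fun t => φ₁ t + c * φ₂ t) (fun t => ψ₁ t + c * ψ₂ t) where
  int_deriv := h₁.int_deriv.add (h₂.int_deriv.const_mul c)
  int_mul_deriv := by
    refine (h₁.int_mul_deriv.add (h₂.int_mul_deriv.const_mul c)).congr
      (Eventually.of_forall fun x => ?_)
    simp only [Pi.add_apply]; ring
  eq t ht := by
    have hss : s ∈ Icc s T := ⟨le_rfl, ht.1.trans ht.2⟩
    rw [h₁.eq t ht, h₂.eq t ht, intervalIntegral.integral_add
      (intervalIntegrable_of_Icc h₁.int_deriv hss ht)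
      ((intervalIntegrable_of_Icc h₂.int_deriv hss ht).const_mul c),
      intervalIntegral.integral_const_mul]
    ring
  deriv_eq t ht := by
    have hss : s ∈ Icc s T := ⟨le_rfl, ht.1.trans ht.2⟩
    have i1 := (integrableOn_of_continuousOn ha h₁.continuousOn).mono_set
      (Ico_subset_Ico_right ht.2)
    have i2 := (integrableOn_of_continuousOn ha h₂.continuousOn).mono_set
      (Ico_subset_Ico_right ht.2)
    have e : ∀ r, (b r : ℂ) * (ψ₁ r + c * ψ₂ r) = b r * ψ₁ r + c * (b r * ψ₂ r) := fun r => by ring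
    simp only [e]
    rw [h₁.deriv_eq t ht, h₂.deriv_eq t ht, intervalIntegral.integral_add
      (intervalIntegrable_of_Icc h₁.int_mul_deriv hss ht)
      ((intervalIntegrable_of_Icc h₂.int_mul_deriv hss ht).const_mul c),
      intervalIntegral.integral_const_mul, integral_add i1 (i2.const_mul c), integral_const_mul]
    ring

/-- Only integrability of ψ and bψ is assumed, but the integrated equation then bounds ψ at every
point. -/
theorem IsSol.exists_bound_deriv (ha : a (Icc s T) < ⊤) (h : IsSol a b ξ s T φ ψ) :
    ∃ C, ∀ t ∈ Icc s T, ‖ψ t‖ ≤ C := by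
  have i1 := integrableOn_of_continuousOn ha h.continuousOn
  refine ⟨‖ψ s‖ + ξ ^ 2 * (∫ r in Ico s T, ‖φ r‖ ∂a) +
    2 * |ξ| * ∫ r in Icc s T, ‖(b r : ℂ) * ψ r‖, fun t ht => ?_⟩
  rw [h.deriv_eq t ht]
  refine (norm_sub_le _ _).trans (add_le_add ((norm_add_le _ _).trans (add_le_add le_rfl ?_)) ?_)
  · rw [norm_mul, norm_pow, Complex.norm_real, Real.norm_eq_abs, sq_abs]
    refine mul_le_mul_of_nonneg_left ?_ (sq_nonneg _)
    refine (norm_integral_le_integral_norm _).trans ?_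
    exact setIntegral_mono_set i1.norm (Eventually.of_forall fun _ => norm_nonneg _)
      (Ico_subset_Ico_right ht.2).eventuallyLE
  · rw [norm_mul, norm_mul, norm_mul, Complex.norm_real, Real.norm_eq_abs, Complex.norm_I, mul_one,
      Complex.norm_ofNat]
    refine mul_le_mul_of_nonneg_left ?_ (by positivity)
    rw [intervalIntegral.integral_of_le ht.1]
    refine (norm_integral_le_integral_norm _).trans ?_
    exact setIntegral_mono_set h.int_mul_deriv.norm (Eventually.of_forall fun _ => norm_nonneg _)
      (Ioc_subset_Icc_self.trans (Icc_subset_Icc_right ht.2)).eventuallyLE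

/-- The quantity `Re (conj φ φ')`, half of the derivative of `|φ|²`. -/
def energyFlux (φ ψ : ℝ → ℂ) (t : ℝ) : ℝ := (starRingEnd ℂ (φ t) * ψ t).re

theorem IsSol.integrableOn_sq (hc : Coeff a b s T) (h : IsSol a b ξ s T φ ψ) :
    IntegrableOn (fun r => ‖ψ r + Complex.I * ξ * b r * φ r‖ ^ 2) (Icc s T) := by
  obtain ⟨C, hC⟩ := h.exists_bound_deriv hc.finite
  obtain ⟨D, hD⟩ := isCompact_Icc.exists_bound_of_continuousOn h.continuousOn
  have hm : AEStronglyMeasurable φ (volume.restrict (Icc s T)) :=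
    h.continuousOn.aestronglyMeasurable measurableSet_Icc
  have hb : AEStronglyMeasurable (fun r => (b r : ℂ)) (volume.restrict (Icc s T)) :=
    (Complex.measurable_ofReal.comp hc.measurable).aestronglyMeasurable
  refine Integrable.mono' (g := fun r => 2 * C ^ 2 + (2 * ξ ^ 2 * D ^ 2) * b r ^ 2)
    ((integrable_const _).add (hc.sq_integrable.const_mul _)) ?_ ?_
  · exact ((h.int_deriv.aestronglyMeasurable.add ((aestronglyMeasurable_const.mul hb).mul hm)).norm).pow 2
  · filter_upwards [ae_restrict_mem measurableSet_Icc] with r hr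
    rw [Real.norm_eq_abs, abs_of_nonneg (by positivity)]
    have h1 : ‖ψ r + Complex.I * ξ * b r * φ r‖ ≤ C + |ξ| * |b r| * D := by
      refine (norm_add_le _ _).trans (add_le_add (hC r hr) ?_)
      rw [norm_mul, norm_mul, norm_mul, Complex.norm_I, one_mul, Complex.norm_real,
        Complex.norm_real, Real.norm_eq_abs, Real.norm_eq_abs]
      exact mul_le_mul_of_nonneg_left (hD r hr) (by positivity)
    calc ‖ψ r + Complex.I * ξ * b r * φ r‖ ^ 2 ≤ (C + |ξ| * |b r| * D) ^ 2 := by gcongr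
      _ ≤ 2 * C ^ 2 + 2 * (|ξ| * |b r| * D) ^ 2 := by nlinarith [sq_nonneg (C - |ξ| * |b r| * D)]
      _ = _ := by rw [mul_pow, mul_pow, sq_abs, sq_abs]; ring

/-- The energy inequality. -/
theorem IsSol.integral_sq_le (hsT : s ≤ T) (hc : Coeff a b s T) (h : IsSol a b ξ s T φ ψ) :
    ∫ r in s..T, ‖ψ r + Complex.I * ξ * b r * φ r‖ ^ 2 ≤ energyFlux φ ψ T - energyFlux φ ψ s := by
  have hcont := h.continuousOn
  obtain ⟨C, hC⟩ := h.exists_bound_deriv hc.finite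
  obtain ⟨D, hD⟩ := isCompact_Icc.exists_bound_of_continuousOn h.continuousOn
  have hm : AEStronglyMeasurable φ (volume.restrict (Icc s T)) :=
    h.continuousOn.aestronglyMeasurable measurableSet_Icc
  have hφc : ∀ u ∈ Icc s T, starRingEnd ℂ (φ u) = starRingEnd ℂ (φ s) +
      ∫ r in s..u, starRingEnd ℂ (ψ r) := by
    intro u hu
    rw [intervalIntegral.integral_of_le hu.1, integral_conj, ← intervalIntegral.integral_of_le hu.1,
      ← map_add, ← h.eq u hu]
  have iφ := integrableOn_of_continuousOn hc.finite hcont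
  have hψc : IntegrableOn (fun r => starRingEnd ℂ (ψ r)) (Icc s T) :=
    Complex.conjCLE.toContinuousLinearMap.integrable_comp h.int_deriv
  -- The product rule for conj φ · ψ, with ψ as the distribution function of ξ²φ a - 2iξbψ dt. Its
  -- real part is the energy identity.
  have key := mul_sub_mul_eq (μ := a) (φ := fun r => starRingEnd ℂ (φ r))
    (φ' := fun r => starRingEnd ℂ (ψ r)) (F := ψ) (f := fun r => (ξ : ℂ) ^ 2 * φ r)
    (k := fun r => - (2 * Complex.I * ξ) * (b r * ψ r)) hsT
    ((measure_mono Ico_subset_Icc_self).trans_lt hc.finite)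
    hψc hφc (iφ.const_mul _) (h.int_mul_deriv.const_mul _) (by
      intro u hu
      rw [h.deriv_eq u hu, integral_const_mul, intervalIntegral.integral_const_mul]
      ring)
  have i1 : IntegrableOn (fun r => starRingEnd ℂ (ψ r) * ψ r) (Icc s T) := by
    refine Integrable.bdd_mul (c := C) h.int_deriv hψc.aestronglyMeasurable ?_
    filter_upwards [ae_restrict_mem measurableSet_Icc] with r hr
    simpa using hC r hr
  have i2 : IntegrableOn (fun r => starRingEnd ℂ (φ r) * (-(2 * Complex.I * ξ) * (b r * ψ r)))
      (Icc s T) := by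
    refine Integrable.bdd_mul (c := D) (h.int_mul_deriv.const_mul _)
      (Complex.continuous_conj.comp_aestronglyMeasurable hm) ?_
    filter_upwards [ae_restrict_mem measurableSet_Icc] with r hr
    simpa using hD r hr
  have i3 : IntegrableOn (fun r => b r ^ 2 * ‖φ r‖ ^ 2) (Icc s T) := by
    refine Integrable.mul_bdd (c := D ^ 2) hc.sq_integrable (hm.norm.pow 2) ?_
    filter_upwards [ae_restrict_mem measurableSet_Icc] with r hr
    simpa using pow_le_pow_left₀ (norm_nonneg _) (hD r hr) 2
  have i4 : IntegrableOn (fun r => starRingEnd ℂ (φ r) * ((ξ : ℂ) ^ 2 * φ r)) (Ico s T) a :=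
    integrableOn_of_continuousOn hc.finite
      ((Complex.continuous_conj.comp_continuousOn hcont).mul (continuousOn_const.mul hcont))
  have e1 : (∫ r in Ico s T, starRingEnd ℂ (φ r) * ((ξ : ℂ) ^ 2 * φ r) ∂a).re =
      ξ ^ 2 * ∫ r in Ico s T, ‖φ r‖ ^ 2 ∂a := by
    rw [← integral_const_mul]
    refine (Complex.reCLM.integral_comp_comm i4).symm.trans (integral_congr_ae
      (Eventually.of_forall fun r => ?_))
    have : starRingEnd ℂ (φ r) * ((ξ : ℂ) ^ 2 * φ r) = ((ξ ^ 2 * ‖φ r‖ ^ 2 : ℝ) : ℂ) := by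
      push_cast; rw [← Complex.conj_mul']; ring
    simp only [this, Complex.reCLM_apply, Complex.ofReal_re]
  have e2 : ∀ q : ℝ → ℂ, IntegrableOn q (Icc s T) →
      (∫ r in s..T, q r).re = ∫ r in s..T, (q r).re := by
    intro q hq
    rw [intervalIntegral.integral_of_le hsT, intervalIntegral.integral_of_le hsT]
    exact (Complex.reCLM.integral_comp_comm (hq.mono_set Ioc_subset_Icc_self)).symm
  -- The one inequality of the argument: ξ² ∫ |φ|² da is bounded below by ξ² ∫ b²|φ|².
  have hle := mul_le_mul_of_nonneg_left (hc.integral_sq_mul_le (f := fun r => ‖φ r‖ ^ 2)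
    (hcont.norm.pow 2) (fun _ => by positivity)) (sq_nonneg ξ)
  rw [integral_Ico_eq_integral_Ioc, ← intervalIntegral.integral_of_le hsT] at hle
  have hre := congrArg Complex.re key
  rw [Complex.sub_re, Complex.add_re, Complex.add_re, e1, e2 _ i1, e2 _ i2] at hre
  have hii : ∀ {q : ℝ → ℝ}, IntegrableOn q (Icc s T) → IntervalIntegrable q volume s T := fun h =>
    (intervalIntegrable_iff_integrableOn_Icc_of_le hsT).2 h
  have i1r : IntegrableOn (fun r => (starRingEnd ℂ (ψ r) * ψ r).re) (Icc s T) := i1.re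
  have i2r : IntegrableOn (fun r => (starRingEnd ℂ (φ r) *
    (-(2 * Complex.I * ξ) * (b r * ψ r))).re) (Icc s T) := i2.re
  -- Completing the square: the cross term of |ψ + iξbφ|² is exactly Re(conj φ · (-2iξbψ)).
  have hsum : ∫ r in s..T, ‖ψ r + Complex.I * ξ * b r * φ r‖ ^ 2 =
      (∫ r in s..T, (starRingEnd ℂ (ψ r) * ψ r).re) +
      (∫ r in s..T, (starRingEnd ℂ (φ r) * (-(2 * Complex.I * ξ) * (b r * ψ r))).re) +
      ξ ^ 2 * ∫ r in s..T, b r ^ 2 * ‖φ r‖ ^ 2 := by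
    rw [← intervalIntegral.integral_const_mul, ← intervalIntegral.integral_add (hii i1r) (hii i2r),
      ← intervalIntegral.integral_add ((hii i1r).add (hii i2r)) ((hii i3).const_mul _)]
    refine intervalIntegral.integral_congr fun r _ => ?_
    simp only [← Complex.normSq_eq_norm_sq, Complex.normSq_apply]
    simp
    ring
  rw [hsum]
  simp only [energyFlux]
  linarith [hre]

/-- The energy inequality on a subinterval has a non-negative left-hand side. -/
theorem IsSol.monotoneOn_energyFlux (hc : Coeff a b s T) (h : IsSol a b ξ s T φ ψ) :
    MonotoneOn (energyFlux φ ψ) (Icc s T) := by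
  intro x hx y hy hxy
  have := (h.mono hc.finite hx.1 hxy hy.2).integral_sq_le hxy (hc.mono hx.1 hy.2)
  have h0 : 0 ≤ ∫ r in x..y, ‖ψ r + Complex.I * ξ * b r * φ r‖ ^ 2 :=
    intervalIntegral.integral_nonneg hxy fun _ _ => by positivity
  linarith

/-- The product rule for conj φ · φ, with zero measure part. -/
theorem IsSol.norm_sq_sub (hsT : s ≤ T) (h : IsSol a b ξ s T φ ψ) :
    ‖φ T‖ ^ 2 - ‖φ s‖ ^ 2 = 2 * ∫ r in s..T, energyFlux φ ψ r := by
  obtain ⟨D, hD⟩ := isCompact_Icc.exists_bound_of_continuousOn h.continuousOn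
  have hm : AEStronglyMeasurable φ (volume.restrict (Icc s T)) :=
    h.continuousOn.aestronglyMeasurable measurableSet_Icc
  have hψc : IntegrableOn (fun r => starRingEnd ℂ (ψ r)) (Icc s T) :=
    Complex.conjCLE.toContinuousLinearMap.integrable_comp h.int_deriv
  have hφc : ∀ u ∈ Icc s T, starRingEnd ℂ (φ u) = starRingEnd ℂ (φ s) +
      ∫ r in s..u, starRingEnd ℂ (ψ r) := by
    intro u hu
    rw [intervalIntegral.integral_of_le hu.1, integral_conj, ← intervalIntegral.integral_of_le hu.1,
      ← map_add, ← h.eq u hu]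
  have key := mul_sub_mul_eq (μ := 0) (φ := fun r => starRingEnd ℂ (φ r))
    (φ' := fun r => starRingEnd ℂ (ψ r)) (F := φ) (f := fun _ => 0) (k := ψ) hsT (by simp)
    hψc hφc (by simp) h.int_deriv (by
      intro u hu
      rw [h.eq u hu]
      simp)
  have i1 : IntegrableOn (fun r => starRingEnd ℂ (φ r) * ψ r) (Icc s T) := by
    refine Integrable.bdd_mul (c := D) h.int_deriv
      (Complex.continuous_conj.comp_aestronglyMeasurable hm) ?_
    filter_upwards [ae_restrict_mem measurableSet_Icc] with r hr
    simpa using hD r hr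
  have e1 : (∫ r in s..T, starRingEnd ℂ (ψ r) * φ r) =
      starRingEnd ℂ (∫ r in s..T, starRingEnd ℂ (φ r) * ψ r) := by
    rw [intervalIntegral.integral_of_le hsT, intervalIntegral.integral_of_le hsT, ← integral_conj]
    simp [mul_comm]
  have e2 : (∫ r in s..T, starRingEnd ℂ (φ r) * ψ r).re = ∫ r in s..T, energyFlux φ ψ r := by
    rw [intervalIntegral.integral_of_le hsT, intervalIntegral.integral_of_le hsT]
    exact (Complex.reCLM.integral_comp_comm (i1.mono_set Ioc_subset_Icc_self)).symm
  have hre := congrArg Complex.re key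
  rw [e1, Complex.conj_mul', Complex.conj_mul'] at hre
  simp only [← Complex.ofReal_pow, Complex.sub_re, Complex.add_re, Complex.ofReal_re,
    Complex.conj_re, e2] at hre
  simp only [mul_zero, integral_zero, Complex.zero_re, add_zero] at hre
  linarith

/-- The derivative of |φ|² is twice a monotone function, so the graph lies above its tangent at the
left endpoint. `IsSol.norm_sq_sub_le` is the same with the right endpoint. -/
theorem IsSol.le_norm_sq_sub (hsT : s ≤ T) (hc : Coeff a b s T) (h : IsSol a b ξ s T φ ψ) :
    2 * energyFlux φ ψ s * (T - s) ≤ ‖φ T‖ ^ 2 - ‖φ s‖ ^ 2 := by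
  rw [h.norm_sq_sub hsT]
  have hmono := h.monotoneOn_energyFlux hc
  have hint : IntervalIntegrable (energyFlux φ ψ) volume s T :=
    MonotoneOn.intervalIntegrable (by rwa [uIcc_of_le hsT])
  have := intervalIntegral.integral_mono_on hsT (f := fun _ => energyFlux φ ψ s)
    intervalIntegrable_const hint
    fun x hx => hmono ⟨le_rfl, hsT⟩ hx hx.1
  rw [intervalIntegral.integral_const, smul_eq_mul] at this
  linarith

theorem IsSol.norm_sq_sub_le (hsT : s ≤ T) (hc : Coeff a b s T) (h : IsSol a b ξ s T φ ψ) :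
    ‖φ T‖ ^ 2 - ‖φ s‖ ^ 2 ≤ 2 * energyFlux φ ψ T * (T - s) := by
  rw [h.norm_sq_sub hsT]
  have hmono := h.monotoneOn_energyFlux hc
  have hint : IntervalIntegrable (energyFlux φ ψ) volume s T :=
    MonotoneOn.intervalIntegrable (by rwa [uIcc_of_le hsT])
  have := intervalIntegral.integral_mono_on hsT (g := fun _ => energyFlux φ ψ T) hint
    intervalIntegrable_const
    fun x hx => hmono hx ⟨hsT, le_rfl⟩ hx.2
  rw [intervalIntegral.integral_const, smul_eq_mul] at this
  linarith

/-- The square of the modulus of a solution is convex. -/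
theorem IsSol.norm_sq_mul_le (hc : Coeff a b s T) (h : IsSol a b ξ s T φ ψ) {x y z : ℝ}
    (hx : s ≤ x) (hxy : x ≤ y) (hyz : y ≤ z) (hz : z ≤ T) :
    (z - x) * ‖φ y‖ ^ 2 ≤ (z - y) * ‖φ x‖ ^ 2 + (y - x) * ‖φ z‖ ^ 2 := by
  have hyT := hyz.trans hz
  have hsy := hx.trans hxy
  have h1 := (h.mono hc.finite hx hxy hyT).norm_sq_sub_le hxy (hc.mono hx hyT)
  have h2 := (h.mono hc.finite hsy hyz hz).le_norm_sq_sub hyz (hc.mono hsy hz)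
  -- With weights z - y and y - x, the two bounds contain the flux at y with opposite signs, and it
  -- cancels.
  nlinarith [mul_le_mul_of_nonneg_right h1 (sub_nonneg.2 hyz),
    mul_le_mul_of_nonneg_right h2 (sub_nonneg.2 hxy)]

end HarmExt
end

/-! ### Exponentials of absolutely continuous functions, and the Volterra series -/

noncomputable section
namespace HarmExt

section Exponential

variable {s T : ℝ} {β β' : ℝ → ℂ}

/-- Induction on the exponent, with the product rule for β · βⁿ⁺¹; it supplies the terms of the
exponential series. -/
theorem pow_succ_eq_integral (hβ' : IntegrableOn β' (Icc s T))
    (hβ : ∀ t ∈ Icc s T, β t = ∫ r in s..t, β' r) (n : ℕ) :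
    ∀ t ∈ Icc s T, β t ^ (n + 1) = (n + 1) * ∫ r in s..t, β' r * β r ^ n := by
  induction n with
  | zero => intro t ht; simp [hβ t ht]
  | succ n ih =>
    intro t ht
    have hsT := ht.1.trans ht.2
    have hs0 : β s = 0 := by rw [hβ s ⟨le_rfl, hsT⟩]; simp
    have hcont : ContinuousOn β (Icc s T) := continuousOn_of_eq_integral hβ' fun u hu => by
      rw [hs0, zero_add, hβ u hu]
    obtain ⟨D, hD⟩ := isCompact_Icc.exists_bound_of_continuousOn (hcont.pow n)
    have hi : IntegrableOn (fun r => β' r * β r ^ n) (Icc s T) := by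
      refine Integrable.mul_bdd (c := D) hβ' ((hcont.pow n).aestronglyMeasurable measurableSet_Icc) ?_
      filter_upwards [ae_restrict_mem measurableSet_Icc] with r hr using hD r hr
    have hsub : Icc s t ⊆ Icc s T := Icc_subset_Icc_right ht.2
    have key := mul_sub_mul_eq (μ := 0) (φ := β) (φ' := β') (F := fun r => β r ^ (n + 1))
      (f := fun _ => 0) (k := fun r => (n + 1) * (β' r * β r ^ n)) ht.1 (by simp)
      (hβ'.mono_set hsub) (fun u hu => by rw [hs0, zero_add, hβ u (hsub hu)]) (by simp)
      ((hi.mono_set hsub).const_mul _) (by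
        intro u hu
        rw [ih u (hsub hu), intervalIntegral.integral_const_mul, hs0]
        simp)
    rw [hs0] at key
    simp only [mul_zero, integral_zero, add_zero, zero_mul, sub_zero] at key
    have e : ∀ r, β r * ((n + 1 : ℂ) * (β' r * β r ^ n)) = (n + 1) * (β' r * β r ^ (n + 1)) := by
      intro r; ring
    simp only [e, intervalIntegral.integral_const_mul] at key
    rw [pow_succ', key]
    push_cast
    ring

/-- The exponential of an absolutely continuous function is absolutely continuous. -/
theorem exp_eq_integral (hβ' : IntegrableOn β' (Icc s T))
    (hβ : ∀ t ∈ Icc s T, β t = ∫ r in s..t, β' r) :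
    ∀ t ∈ Icc s T, Complex.exp (β t) = 1 + ∫ r in s..t, β' r * Complex.exp (β r) := by
  intro t ht
  have hsT := ht.1.trans ht.2
  have hs0 : β s = 0 := by rw [hβ s ⟨le_rfl, hsT⟩]; simp
  have hcont : ContinuousOn β (Icc s T) := continuousOn_of_eq_integral hβ' fun u hu => by
    rw [hs0, zero_add, hβ u hu]
  obtain ⟨D, hD⟩ := isCompact_Icc.exists_bound_of_continuousOn hcont
  have hsub : Ioc s t ⊆ Icc s T := Ioc_subset_Icc_self.trans (Icc_subset_Icc_right ht.2)
  have hexp : ∀ z : ℂ, HasSum (fun n : ℕ => z ^ n / (n.factorial : ℂ)) (Complex.exp z) := by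
    intro z
    rw [Complex.exp_eq_exp_ℂ]
    exact NormedSpace.expSeries_div_hasSum_exp z
  have h1 : HasSum (fun n : ℕ => ∫ r in Ioc s t, β' r * (β r ^ n / (n.factorial : ℂ)))
      (∫ r in Ioc s t, β' r * Complex.exp (β r)) := by
    have hD0 : 0 ≤ D := (norm_nonneg _).trans (hD t ht)
    refine hasSum_integral_of_dominated_convergence
      (fun n r => ‖β' r‖ * (D ^ n / (n.factorial : ℝ))) (fun n => ?_) (fun n => ?_)
      (Eventually.of_forall fun r => (Real.summable_pow_div_factorial D).mul_left _) ?_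
      (Eventually.of_forall fun r => (hexp _).mul_left _)
    · exact (hβ'.mono_set hsub).aestronglyMeasurable.mul
        ((((hcont.mono hsub).pow n).div_const _).aestronglyMeasurable measurableSet_Ioc)
    · filter_upwards [ae_restrict_mem measurableSet_Ioc] with r hr
      rw [norm_mul, norm_div, norm_pow, Complex.norm_natCast]
      have := hD r (hsub hr)
      gcongr
    · simp only [tsum_mul_left]
      exact (hβ'.mono_set hsub).norm.mul_const _
  have h2 := (hasSum_nat_add_iff' 1).2 (hexp (β t))
  -- The exponential series without its constant term is the termwise integral of β' times the full
  -- series, whence the shift by one.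
  have h3 : (fun n : ℕ => β t ^ (n + 1) / ((n + 1).factorial : ℂ)) =
      fun n : ℕ => ∫ r in Ioc s t, β' r * (β r ^ n / (n.factorial : ℂ)) := by
    ext n
    rw [pow_succ_eq_integral hβ' hβ n t ht, ← intervalIntegral.integral_of_le ht.1,
      Nat.factorial_succ]
    simp only [← mul_div_assoc, intervalIntegral.integral_div]
    have h4 : (n.factorial : ℂ) ≠ 0 := by exact_mod_cast n.factorial_ne_zero
    have h5 : (n : ℂ) + 1 ≠ 0 := by exact_mod_cast n.succ_ne_zero
    push_cast
    field_simp
  rw [h3] at h2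
  have h6 := h2.unique h1
  rw [intervalIntegral.integral_of_le ht.1, ← h6]
  simp

end Exponential

section Volterra

variable {μ : Measure ℝ} {p : ℝ → ℝ → ℂ} {H : ℝ → ℝ → ℂ} {ξ T C A : ℝ}

/-- Measurability is tracked jointly in (ξ, t) because solutions are later integrated over all
frequencies. -/
theorem stronglyMeasurable_integral_Ico [SFinite μ] {G : ℝ → ℝ → ℂ} {s : ℝ}
    (hG : StronglyMeasurable (Function.uncurry G)) :
    StronglyMeasurable (Function.uncurry fun ξ t : ℝ => ∫ u in Ico s t, G ξ u ∂μ) := by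
  have h : (Function.uncurry fun ξ t : ℝ => ∫ u in Ico s t, G ξ u ∂μ) =
      fun q : ℝ × ℝ => ∫ u, ({q : (ℝ × ℝ) × ℝ | s ≤ q.2 ∧ q.2 < q.1.2}.indicator
        (fun q => G q.1.1 q.2) (q, u)) ∂μ := by
    ext q
    simp only [Function.uncurry]
    rw [← integral_indicator measurableSet_Ico]
    rfl
  rw [h]
  refine StronglyMeasurable.integral_prod_right (f := fun q u =>
    ({q : (ℝ × ℝ) × ℝ | s ≤ q.2 ∧ q.2 < q.1.2}.indicator (fun q => G q.1.1 q.2) (q, u))) ?_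
  refine StronglyMeasurable.indicator ?_
    ((measurableSet_le measurable_const measurable_snd).inter
      (measurableSet_lt measurable_snd (measurable_snd.comp measurable_fst)))
  exact hG.comp_measurable (g := fun q : (ℝ × ℝ) × ℝ => (q.1.1, q.2)) (by fun_prop)

/-- The Volterra operator of the system `φ' = conj p χ`, `χ' = ξ² p φ μ`. -/
def volterra (μ : Measure ℝ) (p H : ℝ → ℝ → ℂ) (ξ t : ℝ) : ℂ :=
  (ξ : ℂ) ^ 2 * ∫ r in Ico 0 t, starRingEnd ℂ (p ξ r) * ∫ u in Ico 0 r, p ξ u * H ξ u ∂μ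

theorem stronglyMeasurable_volterra [SFinite μ] (hp : StronglyMeasurable (Function.uncurry p))
    (hH : StronglyMeasurable (Function.uncurry H)) :
    StronglyMeasurable (Function.uncurry (volterra μ p H)) := by
  have h1 : StronglyMeasurable (Function.uncurry fun ξ t : ℝ => ∫ u in Ico 0 t, p ξ u * H ξ u ∂μ) :=
    stronglyMeasurable_integral_Ico (hp.mul hH)
  have h2 : StronglyMeasurable (Function.uncurry fun ξ t : ℝ => ∫ r in Ico 0 t,
      starRingEnd ℂ (p ξ r) * ∫ u in Ico 0 r, p ξ u * H ξ u ∂μ) :=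
    stronglyMeasurable_integral_Ico (μ := volume)
      ((Complex.continuous_conj.comp_stronglyMeasurable hp).mul h1)
  have h3 : StronglyMeasurable fun q : ℝ × ℝ => (q.1 : ℂ) ^ 2 :=
    ((Complex.continuous_ofReal.comp continuous_fst).pow 2).stronglyMeasurable
  exact h3.mul h2

theorem norm_integral_Ico_le (hT : μ (Ico 0 T) < ⊤) (hA : μ.real (Ico 0 T) ≤ A)
    {G : ℝ → ℂ} {r c : ℝ} (hc : 0 ≤ c) (hr : r ≤ T) (hG : ∀ u ∈ Ico 0 r, ‖G u‖ ≤ c) :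
    ‖∫ u in Ico 0 r, G u ∂μ‖ ≤ A * c := by
  have h1 : μ (Ico 0 r) < ⊤ := (measure_mono (Ico_subset_Ico_right hr)).trans_lt hT
  refine (norm_setIntegral_le_of_norm_le_const h1 hG).trans ?_
  rw [mul_comm]
  exact mul_le_mul_of_nonneg_right
    ((measureReal_mono (Ico_subset_Ico_right hr) hT.ne).trans hA) hc

/-- The inner integral, against a measure that may have atoms, only contributes the total mass A.
The outer Lebesgue integral gains t/(n + 1), which makes the iterates summable. -/
theorem norm_volterra_le (hT : μ (Ico 0 T) < ⊤) (hA : μ.real (Ico 0 T) ≤ A) (hp : ∀ u, ‖p ξ u‖ = 1)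
    (hC : 0 ≤ C) {n : ℕ} (hH : ∀ u ∈ Icc 0 T, ‖H ξ u‖ ≤ C * (u ^ n / (n.factorial : ℝ))) :
    ∀ t ∈ Icc 0 T, ‖volterra μ p H ξ t‖ ≤
      C * (ξ ^ 2 * A) * (t ^ (n + 1) / ((n + 1).factorial : ℝ)) := by
  intro t ht
  have hA0 : 0 ≤ A := measureReal_nonneg.trans hA
  have h1 : ∀ r ∈ Icc 0 T, ‖starRingEnd ℂ (p ξ r) * ∫ u in Ico 0 r, p ξ u * H ξ u ∂μ‖ ≤
      A * C / (n.factorial : ℝ) * r ^ n := by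
    intro r hr
    rw [norm_mul, RCLike.norm_conj, hp, one_mul]
    have hr0 := hr.1
    refine (norm_integral_Ico_le hT hA (c := C * (r ^ n / (n.factorial : ℝ))) (by positivity) hr.2
      fun u hu => ?_).trans (le_of_eq (by ring))
    rw [norm_mul, hp, one_mul]
    refine (hH u ⟨hu.1, hu.2.le.trans hr.2⟩).trans ?_
    have := hu.1
    have := hu.2.le
    gcongr
  have h2 : ‖∫ r in Ico 0 t, starRingEnd ℂ (p ξ r) * ∫ u in Ico 0 r, p ξ u * H ξ u ∂μ‖ ≤
      ∫ r in Ico 0 t, A * C / (n.factorial : ℝ) * r ^ n := by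
    refine norm_integral_le_of_norm_le ?_ ?_
    · exact ((continuous_const.mul (continuous_id.pow n)).integrableOn_Icc).mono_set
        Ico_subset_Icc_self
    · filter_upwards [ae_restrict_mem measurableSet_Ico] with r hr
      exact h1 r ⟨hr.1, hr.2.le.trans ht.2⟩
  rw [volterra, norm_mul, norm_pow, Complex.norm_real, Real.norm_eq_abs, sq_abs]
  refine (mul_le_mul_of_nonneg_left h2 (sq_nonneg ξ)).trans (le_of_eq ?_)
  rw [integral_Ico_eq_integral_Ioc, ← intervalIntegral.integral_of_le ht.1,
    intervalIntegral.integral_const_mul, integral_pow, Nat.factorial_succ]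
  have h4 : (n.factorial : ℝ) ≠ 0 := by exact_mod_cast n.factorial_ne_zero
  have h5 : (n : ℝ) + 1 ≠ 0 := by exact_mod_cast n.succ_ne_zero
  push_cast
  field_simp
  simp

/-- The iterates of the Volterra operator. -/
def volterraIter (μ : Measure ℝ) (p H : ℝ → ℝ → ℂ) : ℕ → ℝ → ℝ → ℂ
  | 0 => H
  | n + 1 => volterra μ p (volterraIter μ p H n)

theorem stronglyMeasurable_volterraIter [SFinite μ] (hp : StronglyMeasurable (Function.uncurry p))
    (hH : StronglyMeasurable (Function.uncurry H)) (n : ℕ) :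
    StronglyMeasurable (Function.uncurry (volterraIter μ p H n)) := by
  induction n with
  | zero => exact hH
  | succ n ih => exact stronglyMeasurable_volterra hp ih

theorem norm_volterraIter_le (hT : μ (Ico 0 T) < ⊤) (hA : μ.real (Ico 0 T) ≤ A)
    (hp : ∀ u, ‖p ξ u‖ = 1) (hC : 0 ≤ C) (hH : ∀ u ∈ Icc 0 T, ‖H ξ u‖ ≤ C) (n : ℕ) :
    ∀ t ∈ Icc 0 T, ‖volterraIter μ p H n ξ t‖ ≤
      C * (ξ ^ 2 * A) ^ n * (t ^ n / (n.factorial : ℝ)) := by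
  have hA0 : 0 ≤ A := measureReal_nonneg.trans hA
  induction n with
  | zero => simpa [volterraIter] using hH
  | succ n ih =>
    intro t ht
    refine (norm_volterra_le hT hA hp (by positivity) ih t ht).trans (le_of_eq ?_)
    ring

theorem norm_volterraIter_le' (hT : μ (Ico 0 T) < ⊤) (hA : μ.real (Ico 0 T) ≤ A)
    (hp : ∀ u, ‖p ξ u‖ = 1) (hC : 0 ≤ C) (hH : ∀ u ∈ Icc 0 T, ‖H ξ u‖ ≤ C) (n : ℕ) :
    ∀ t ∈ Icc 0 T, ‖volterraIter μ p H n ξ t‖ ≤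
      C * ((ξ ^ 2 * A * T) ^ n / (n.factorial : ℝ)) := by
  intro t ht
  have hA0 : 0 ≤ A := measureReal_nonneg.trans hA
  refine (norm_volterraIter_le hT hA hp hC hH n t ht).trans ?_
  have h0 := ht.1
  have hT := ht.2
  rw [mul_pow (ξ ^ 2 * A) T, mul_div_assoc, mul_assoc]
  gcongr

/-- The sum of the iterates of the Volterra operator. -/
def volterraSum (μ : Measure ℝ) (p H : ℝ → ℝ → ℂ) (ξ t : ℝ) : ℂ := ∑' n, volterraIter μ p H n ξ t

theorem hasSum_volterraSum (hT : μ (Ico 0 T) < ⊤) (hp : ∀ u, ‖p ξ u‖ = 1)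
    (hC : 0 ≤ C) (hH : ∀ u ∈ Icc 0 T, ‖H ξ u‖ ≤ C) {t : ℝ} (ht : t ∈ Icc 0 T) :
    HasSum (fun n => volterraIter μ p H n ξ t) (volterraSum μ p H ξ t) := by
  refine Summable.hasSum (Summable.of_norm_bounded
    ((Real.summable_pow_div_factorial (ξ ^ 2 * μ.real (Ico 0 T) * T)).mul_left C) fun n =>
      norm_volterraIter_le' hT le_rfl hp hC hH n t ht)

/-- Dominated convergence, in the inner and then in the outer integral, moves the operator past the
sum; what remains is the term of index 0. -/
theorem volterraSum_eq [SFinite μ] (hT : μ (Ico 0 T) < ⊤)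
    (hp : ∀ u, ‖p ξ u‖ = 1) (hpm : StronglyMeasurable (Function.uncurry p))
    (hHm : StronglyMeasurable (Function.uncurry H))
    (hC : 0 ≤ C) (hH : ∀ u ∈ Icc 0 T, ‖H ξ u‖ ≤ C) {t : ℝ} (ht : t ∈ Icc 0 T) :
    volterraSum μ p H ξ t = H ξ t + volterra μ p (volterraSum μ p H) ξ t := by
  set A := μ.real (Ico 0 T) with hA
  have hA0 : 0 ≤ A := measureReal_nonneg
  have hsum := (Real.summable_pow_div_factorial (ξ ^ 2 * A * T)).mul_left C
  have hb := fun n => norm_volterraIter_le' (H := H) hT le_rfl hp hC hH n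
  rw [← hA] at hb
  have hmn : ∀ n, StronglyMeasurable (volterraIter μ p H n ξ) := fun n =>
    (stronglyMeasurable_volterraIter hpm hHm n).comp_measurable (g := fun t => (ξ, t)) (by fun_prop)
  have hmp : StronglyMeasurable (p ξ) := hpm.comp_measurable (g := fun t => (ξ, t)) (by fun_prop)
  have inner : ∀ r ∈ Icc 0 T, HasSum (fun n => ∫ u in Ico 0 r, p ξ u * volterraIter μ p H n ξ u ∂μ)
      (∫ u in Ico 0 r, p ξ u * volterraSum μ p H ξ u ∂μ) := by
    intro r hr
    have hfin : μ (Ico 0 r) < ⊤ := (measure_mono (Ico_subset_Ico_right hr.2)).trans_lt hT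
    have : IsFiniteMeasure (μ.restrict (Ico 0 r)) := ⟨by simpa using hfin⟩
    refine hasSum_integral_of_dominated_convergence
      (fun n _ => C * ((ξ ^ 2 * A * T) ^ n / (n.factorial : ℝ)))
      (fun n => (hmp.mul (hmn n)).aestronglyMeasurable) (fun n => ?_)
      (Eventually.of_forall fun _ => hsum) (integrable_const _) ?_
    · filter_upwards [ae_restrict_mem measurableSet_Ico] with u hu
      rw [norm_mul, hp, one_mul]
      exact hb n u ⟨hu.1, hu.2.le.trans hr.2⟩
    · filter_upwards [ae_restrict_mem measurableSet_Ico] with u hu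
      exact (hasSum_volterraSum hT hp hC hH ⟨hu.1, hu.2.le.trans hr.2⟩).mul_left _
  have outer : HasSum (fun n => volterraIter μ p H (n + 1) ξ t)
      (volterra μ p (volterraSum μ p H) ξ t) := by
    refine HasSum.mul_left _ ?_
    refine hasSum_integral_of_dominated_convergence
      (fun n _ => A * (C * ((ξ ^ 2 * A * T) ^ n / (n.factorial : ℝ)))) (fun n => ?_) (fun n => ?_)
      (Eventually.of_forall fun _ => hsum.mul_left A) (integrable_const _) ?_
    · exact ((Complex.continuous_conj.comp_stronglyMeasurable hmp).mul
        (measurable_integral_Ico (hmp.mul (hmn n)))).aestronglyMeasurable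
    · filter_upwards [ae_restrict_mem measurableSet_Ico] with r hr
      rw [norm_mul, RCLike.norm_conj, hp, one_mul]
      have hT0 : 0 ≤ T := ht.1.trans ht.2
      refine norm_integral_Ico_le hT le_rfl (by positivity) (hr.2.le.trans ht.2) fun u hu => ?_
      rw [norm_mul, hp, one_mul]
      exact hb n u ⟨hu.1, hu.2.le.trans (hr.2.le.trans ht.2)⟩
    · filter_upwards [ae_restrict_mem measurableSet_Ico] with r hr
      exact (inner r ⟨hr.1, hr.2.le.trans ht.2⟩).mul_left _
  have h0 := (hasSum_nat_add_iff' 1).2 (hasSum_volterraSum (H := H) hT hp hC hH ht)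
  have := h0.unique outer
  rw [← this]
  simp [volterraIter]

end Volterra
end HarmExt
end

/-! ### Solutions on [0, R) with prescribed initial data -/

noncomputable section
namespace HarmExt

theorem measurableSet_dom (R : EReal) : MeasurableSet (dom R) :=
  (measurableSet_le measurable_const measurable_id).inter
    (measurableSet_lt measurable_coe_real_ereal measurable_const)

theorem measurableSet_openDom (R : EReal) : MeasurableSet (openDom R) :=
  (measurableSet_lt measurable_const measurable_id).inter
    (measurableSet_lt measurable_coe_real_ereal measurable_const)

theorem openDom_subset_dom (R : EReal) : openDom R ⊆ dom R := fun _ h => ⟨h.1.le, h.2⟩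

theorem Icc_subset_dom {R : EReal} {T : ℝ} (hT : T ∈ dom R) : Icc 0 T ⊆ dom R := fun _ h =>
  ⟨h.1, (EReal.coe_le_coe_iff.2 h.2).trans_lt hT.2⟩

theorem Icc_subset_openDom {R : EReal} {s T : ℝ} (hs : 0 < s) (hT : T ∈ dom R) :
    Icc s T ⊆ openDom R := fun _ h =>
  ⟨hs.trans_le h.1, (EReal.coe_le_coe_iff.2 h.2).trans_lt hT.2⟩

theorem exists_between_dom {R : EReal} {T : ℝ} (hT : T ∈ dom R) : ∃ T' ∈ openDom R, T < T' := by
  obtain ⟨q, h1, h2⟩ := EReal.exists_rat_btwn_of_lt hT.2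
  have h3 : T < (q : ℝ) := EReal.coe_lt_coe_iff.1 h1
  exact ⟨q, ⟨hT.1.trans_lt h3, h2⟩, h3⟩

/-- An increasing sequence exhausting `[0, R)`. -/
theorem exists_seq_openDom {R : EReal} (hR : 0 < R) :
    ∃ r : ℕ → ℝ, StrictMono r ∧ (∀ n, r n ∈ openDom R) ∧ ∀ y ∈ dom R, ∃ n, y < r n := by
  induction R using EReal.rec with
  | bot => simp at hR
  | top =>
    refine ⟨fun n => n + 1, fun m n h => by simpa using h, fun n => ⟨by positivity, EReal.coe_lt_top _⟩,
      fun y _ => ?_⟩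
    obtain ⟨n, hn⟩ := exists_nat_gt y
    exact ⟨n, by linarith⟩
  | coe R =>
    have hR' : 0 < R := by exact_mod_cast hR
    have h0 : (0 : ℝ) < R := hR'
    obtain ⟨u, hu, hu2, hu3⟩ := exists_seq_strictMono_tendsto' h0
    refine ⟨u, hu, fun n => ⟨(hu2 n).1, EReal.coe_lt_coe_iff.2 (hu2 n).2⟩, fun y hy => ?_⟩
    have hy2 : y < R := EReal.coe_lt_coe_iff.1 hy.2
    exact (hu3.eventually (lt_mem_nhds hy2)).exists

variable (L : OpL)

/-- The measure `a` on `[0, R)`. -/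
def OpL.aDom : Measure ℝ := L.a.restrict (dom L.R)

/-- The measure is cut into countably many finite pieces along an exhaustion of [0, R). The product
measure arguments need this; nothing is known about `L.a` outside [0, R). -/
instance : SFinite L.aDom := by
  obtain ⟨r, hr, hr2, hr3⟩ := exists_seq_openDom L.R_pos
  have h : dom L.R = ⋃ n, disjointed (fun n => Icc 0 (r n)) n := by
    rw [iUnion_disjointed]
    refine Subset.antisymm (fun y hy => ?_) (iUnion_subset fun n =>
      Icc_subset_dom (openDom_subset_dom _ (hr2 n)))
    obtain ⟨n, hn⟩ := hr3 y hy
    exact mem_iUnion.2 ⟨n, hy.1, hn.le⟩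
  have hm : ∀ n, MeasurableSet (disjointed (fun n => Icc 0 (r n)) n) := fun n =>
    MeasurableSet.disjointed (fun _ => measurableSet_Icc) n
  rw [OpL.aDom, h, Measure.restrict_iUnion (disjoint_disjointed _) hm]
  have : ∀ n, IsFiniteMeasure (L.a.restrict (disjointed (fun n => Icc 0 (r n)) n)) := fun n => by
    refine ⟨?_⟩
    rw [Measure.restrict_apply_univ]
    exact (measure_mono (disjointed_subset _ n)).trans_lt (L.a_finite _ (openDom_subset_dom _ (hr2 n)))
  infer_instance

variable {L}

theorem OpL.coeff {T : ℝ} (hT : T ∈ dom L.R) : Coeff L.a L.b 0 T where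
  finite := L.a_finite T hT
  measurable := L.b_measurable
  sq_integrable := L.b_sq_integrable T hT
  sq_le := by
    have := Measure.restrict_mono_measure L.b_sq_le_a (Ico 0 T)
    rwa [restrict_withDensity measurableSet_Ico, Measure.restrict_restrict measurableSet_Ico,
      Measure.restrict_restrict measurableSet_Ico,
      inter_eq_left.2 (Ico_subset_Icc_self.trans (Icc_subset_dom hT))] at this

theorem OpL.restrict_aDom {S : Set ℝ} (hS : MeasurableSet S) (h : S ⊆ dom L.R) :
    L.aDom.restrict S = L.a.restrict S := by
  rw [OpL.aDom, Measure.restrict_restrict hS, inter_eq_left.2 h]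

theorem OpL.restrict_Ico {t : ℝ} (ht : t ∈ dom L.R) :
    L.aDom.restrict (Ico 0 t) = L.a.restrict (Ico 0 t) :=
  L.restrict_aDom measurableSet_Ico (Ico_subset_Icc_self.trans (Icc_subset_dom ht))

theorem OpL.aDom_Ico_lt_top {T : ℝ} (hT : T ∈ dom L.R) : L.aDom (Ico 0 T) < ⊤ := by
  rw [← Measure.restrict_apply_univ, L.restrict_Ico hT, Measure.restrict_apply_univ]
  exact (measure_mono Ico_subset_Icc_self).trans_lt (L.a_finite T hT)

theorem OpL.continuousOn_B : ContinuousOn L.B (dom L.R) := by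
  intro y hy
  obtain ⟨T, hT, hyT⟩ := exists_between_dom hy
  have hT' := openDom_subset_dom _ hT
  have h1 : ContinuousOn L.B (Icc 0 T) := by
    have := intervalIntegral.continuousOn_primitive_interval' (f := L.b) (μ := volume) (a := 0)
      (b₁ := 0) (b₂ := T) ((intervalIntegrable_iff_integrableOn_Icc_of_le hT'.1).2
      (L.coeff hT').integrableOn) left_mem_uIcc
    rwa [uIcc_of_le hT'.1] at this
  refine (h1 y ⟨hy.1, hyT.le⟩).mono_of_mem_nhdsWithin ?_
  filter_upwards [self_mem_nhdsWithin, mem_nhdsWithin_of_mem_nhds (Iio_mem_nhds hyT)] with z hz hz'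
  exact ⟨hz.1, le_of_lt hz'⟩

variable (L)

/-- The function `B` extended by zero. -/
def OpL.Bdom : ℝ → ℝ := (dom L.R).indicator L.B

theorem OpL.measurable_Bdom : Measurable L.Bdom := by
  classical
  have := L.continuousOn_B.measurable_piecewise (g := (0 : ℝ → ℝ)) continuousOn_const
    (measurableSet_dom L.R)
  rwa [piecewise_eq_indicator] at this

/-- The integrating factor `exp (2 i ξ B(t))`. -/
def OpL.phase (ξ t : ℝ) : ℂ := Complex.exp (2 * Complex.I * ξ * L.Bdom t)

theorem OpL.norm_phase (ξ t : ℝ) : ‖L.phase ξ t‖ = 1 := by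
  have : 2 * Complex.I * ξ * L.Bdom t = ((2 * ξ * L.Bdom t : ℝ) : ℂ) * Complex.I := by
    push_cast; ring
  rw [OpL.phase, this, Complex.norm_exp_ofReal_mul_I]

theorem OpL.stronglyMeasurable_phase : StronglyMeasurable (Function.uncurry L.phase) := by
  refine Measurable.stronglyMeasurable ?_
  have := L.measurable_Bdom
  simp only [OpL.phase, Function.uncurry_def]
  fun_prop

theorem exp_mul_B_eq {T : ℝ} (hT : T ∈ dom L.R) (c : ℂ) : ∀ t ∈ Icc 0 T,
    Complex.exp (c * L.Bdom t) = 1 + ∫ r in (0 : ℝ)..t, c * L.b r * Complex.exp (c * L.Bdom r) := by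
  refine exp_eq_integral ((L.coeff hT).integrableOn.ofReal.const_mul c) fun t ht => ?_
  rw [OpL.Bdom, indicator_of_mem (Icc_subset_dom hT ht), OpL.B, intervalIntegral.integral_const_mul,
    intervalIntegral.integral_ofReal]

/-- The data of the Volterra equation. -/
def OpL.volterraData (c d : ℂ) (ξ t : ℝ) : ℂ :=
  c + d * ∫ r in Ico 0 t, starRingEnd ℂ (L.phase ξ r)

/-- The solution with `φ(0) = c` and `φ'(0) = d`. -/
def OpL.fund (c d : ℂ) : ℝ → ℝ → ℂ := volterraSum L.aDom L.phase (L.volterraData c d)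

/-- The derivative of `OpL.fund`. -/
def OpL.fundDeriv (c d : ℂ) (ξ t : ℝ) : ℂ := starRingEnd ℂ (L.phase ξ t) *
  (d + (ξ : ℂ) ^ 2 * ∫ r in Ico 0 t, L.phase ξ r * L.fund c d ξ r ∂L.aDom)

variable {L}

theorem OpL.stronglyMeasurable_volterraData (c d : ℂ) :
    StronglyMeasurable (Function.uncurry (L.volterraData c d)) := by
  have : StronglyMeasurable (Function.uncurry fun ξ t : ℝ => ∫ r in Ico 0 t,
      starRingEnd ℂ (L.phase ξ r)) :=
    stronglyMeasurable_integral_Ico (μ := volume)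
      (Complex.continuous_conj.comp_stronglyMeasurable L.stronglyMeasurable_phase)
  exact (stronglyMeasurable_const (b := c)).add ((stronglyMeasurable_const (b := d)).mul this)

theorem OpL.norm_volterraData_le (c d : ℂ) (ξ : ℝ) {T : ℝ} :
    ∀ t ∈ Icc 0 T, ‖L.volterraData c d ξ t‖ ≤ ‖c‖ + ‖d‖ * T := by
  intro t ht
  refine (norm_add_le _ _).trans (add_le_add le_rfl ?_)
  rw [norm_mul]
  refine mul_le_mul_of_nonneg_left ?_ (norm_nonneg _)
  have := norm_integral_Ico_le (μ := volume) (T := t) (A := t) (by simp) (by simp [ht.1])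
    (G := fun r => starRingEnd ℂ (L.phase ξ r)) zero_le_one le_rfl
    (fun u _ => by rw [RCLike.norm_conj, L.norm_phase])
  linarith [ht.2]

theorem OpL.hasSum_fund (c d : ℂ) (ξ : ℝ) {t : ℝ} (ht : t ∈ dom L.R) :
    HasSum (fun n => volterraIter L.aDom L.phase (L.volterraData c d) n ξ t) (L.fund c d ξ t) := by
  have h0 : 0 ≤ t := ht.1
  exact hasSum_volterraSum (T := t) (L.aDom_Ico_lt_top ht) (L.norm_phase ξ) (by positivity)
    (L.norm_volterraData_le c d ξ) ⟨h0, le_rfl⟩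

theorem OpL.fund_eq (c d : ℂ) (ξ : ℝ) {t : ℝ} (ht : t ∈ dom L.R) :
    L.fund c d ξ t = L.volterraData c d ξ t + volterra L.aDom L.phase (L.fund c d) ξ t := by
  have h0 : 0 ≤ t := ht.1
  exact volterraSum_eq (T := t) (L.aDom_Ico_lt_top ht) (L.norm_phase ξ) L.stronglyMeasurable_phase
    (L.stronglyMeasurable_volterraData c d)
    (by positivity) (L.norm_volterraData_le c d ξ) ⟨h0, le_rfl⟩

/-- A pointwise limit of partial sums of the Volterra series. The cutoff is there because
convergence is established only on [0, R). -/
theorem OpL.stronglyMeasurable_fund (c d : ℂ) : StronglyMeasurable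
    (Function.uncurry fun ξ t => (dom L.R).indicator (L.fund c d ξ) t) := by
  have h : ∀ n, StronglyMeasurable fun q : ℝ × ℝ => (Prod.snd ⁻¹' dom L.R).indicator
      (fun q : ℝ × ℝ => ∑ i ∈ Finset.range n, Function.uncurry
        (volterraIter L.aDom L.phase (L.volterraData c d) i) q) q := by
    intro n
    refine StronglyMeasurable.indicator ?_ (measurable_snd (measurableSet_dom L.R))
    exact Finset.stronglyMeasurable_fun_sum _ fun i _ =>
      stronglyMeasurable_volterraIter L.stronglyMeasurable_phase
        (L.stronglyMeasurable_volterraData c d) i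
  refine stronglyMeasurable_of_tendsto atTop h ?_
  rw [tendsto_pi_nhds]
  rintro ⟨ξ, t⟩
  by_cases ht : t ∈ dom L.R
  · have h1 : (ξ, t) ∈ (Prod.snd ⁻¹' dom L.R : Set (ℝ × ℝ)) := ht
    simp only [indicator_of_mem h1, Function.uncurry, indicator_of_mem ht]
    exact (L.hasSum_fund c d ξ ht).tendsto_sum_nat
  · have h1 : (ξ, t) ∉ (Prod.snd ⁻¹' dom L.R : Set (ℝ × ℝ)) := ht
    simp only [indicator_of_notMem h1, Function.uncurry, indicator_of_notMem ht]
    exact tendsto_const_nhds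

theorem OpL.integral_fund_indicator (c d : ℂ) (ξ t : ℝ) :
    ∫ r in Ico 0 t, L.phase ξ r * L.fund c d ξ r ∂L.aDom =
      ∫ r in Ico 0 t, L.phase ξ r * (dom L.R).indicator (L.fund c d ξ) r ∂L.aDom := by
  refine integral_congr_ae (ae_restrict_of_ae ?_)
  filter_upwards [ae_restrict_mem (measurableSet_dom L.R)] with r hr
  rw [indicator_of_mem hr]

theorem OpL.stronglyMeasurable_fundDeriv (c d : ℂ) :
    StronglyMeasurable (Function.uncurry (L.fundDeriv c d)) := by
  have h1 : StronglyMeasurable (Function.uncurry fun ξ t : ℝ => ∫ r in Ico 0 t,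
      L.phase ξ r * L.fund c d ξ r ∂L.aDom) := by
    simp only [L.integral_fund_indicator]
    exact stronglyMeasurable_integral_Ico
      (L.stronglyMeasurable_phase.mul (L.stronglyMeasurable_fund c d))
  have h3 : StronglyMeasurable fun q : ℝ × ℝ => (q.1 : ℂ) ^ 2 :=
    ((Complex.continuous_ofReal.comp continuous_fst).pow 2).stronglyMeasurable
  exact (Complex.continuous_conj.comp_stronglyMeasurable L.stronglyMeasurable_phase).mul
    ((stronglyMeasurable_const (b := d)).add (h3.mul h1))

theorem OpL.fund_zero (c d : ℂ) (ξ : ℝ) : L.fund c d ξ 0 = c := by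
  have h0 : (0 : ℝ) ∈ dom L.R := ⟨le_rfl, L.R_pos⟩
  rw [L.fund_eq c d ξ h0]
  simp [OpL.volterraData, volterra]

theorem OpL.fundDeriv_zero (c d : ℂ) (ξ : ℝ) : L.fundDeriv c d ξ 0 = d := by
  have h0 : (0 : ℝ) ∈ dom L.R := ⟨le_rfl, L.R_pos⟩
  have : L.Bdom 0 = 0 := by rw [OpL.Bdom, indicator_of_mem h0, OpL.B, intervalIntegral.integral_same]
  simp [OpL.fundDeriv, OpL.phase, this]

/-- Write p = exp(2iξB) and χ = pψ. Since |p| = 1, the equation is equivalent to φ' = conj p · χ, χ'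
= ξ²pφ a. The Volterra equation is the first relation after χ is eliminated, and the product rule
for conj p · χ returns the equation for ψ. -/
theorem OpL.isSol_fund (c d : ℂ) (ξ : ℝ) {T : ℝ} (hT : T ∈ dom L.R) :
    IsSol L.a L.b ξ 0 T (L.fund c d ξ) (L.fundDeriv c d ξ) := by
  have hc := L.coeff hT
  have hT0 : 0 ≤ T := hT.1
  set A := L.aDom.real (Ico 0 T)
  have hA0 : 0 ≤ A := measureReal_nonneg
  have hfin := L.aDom_Ico_lt_top hT
  have hmp : StronglyMeasurable (L.phase ξ) :=
    L.stronglyMeasurable_phase.comp_measurable (g := fun t => (ξ, t)) (by fun_prop)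
  have hmf : StronglyMeasurable ((dom L.R).indicator (L.fund c d ξ)) :=
    (L.stronglyMeasurable_fund c d).comp_measurable (g := fun t => (ξ, t)) (by fun_prop)
  have hmd : StronglyMeasurable (L.fundDeriv c d ξ) :=
    (L.stronglyMeasurable_fundDeriv c d).comp_measurable (g := fun t => (ξ, t)) (by fun_prop)
  obtain ⟨D, hD0, hD⟩ : ∃ D, 0 ≤ D ∧ ∀ t ∈ Icc 0 T, ‖L.fund c d ξ t‖ ≤ D := by
    have hs := (Real.summable_pow_div_factorial (ξ ^ 2 * A * T)).mul_left (‖c‖ + ‖d‖ * T)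
    refine ⟨_, ?_, fun t ht => tsum_of_norm_bounded hs.hasSum fun n =>
      norm_volterraIter_le' hfin le_rfl (L.norm_phase ξ) (by positivity)
        (L.norm_volterraData_le c d ξ) n t ht⟩
    exact tsum_nonneg fun n => by positivity
  have hbd : ∀ t ∈ Icc 0 T, ‖L.fundDeriv c d ξ t‖ ≤ ‖d‖ + ξ ^ 2 * (A * D) := by
    intro t ht
    rw [OpL.fundDeriv, norm_mul, RCLike.norm_conj, L.norm_phase, one_mul]
    refine (norm_add_le _ _).trans (add_le_add le_rfl ?_)
    rw [norm_mul, norm_pow, Complex.norm_real, Real.norm_eq_abs, sq_abs]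
    refine mul_le_mul_of_nonneg_left ?_ (sq_nonneg ξ)
    refine norm_integral_Ico_le hfin le_rfl hD0 ht.2 fun u hu => ?_
    rw [norm_mul, L.norm_phase, one_mul]
    exact hD u ⟨hu.1, hu.2.le.trans ht.2⟩
  have hif : IntegrableOn (fun r => L.phase ξ r * L.fund c d ξ r) (Ico 0 T) L.aDom := by
    have : IsFiniteMeasure (L.aDom.restrict (Ico 0 T)) := ⟨by simpa using hfin⟩
    refine Integrable.of_bound ?_ D ?_
    · refine (hmp.mul hmf).aestronglyMeasurable.congr ?_
      filter_upwards [ae_restrict_mem measurableSet_Ico] with u hu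
      rw [Pi.mul_apply, indicator_of_mem (Icc_subset_dom hT (Ico_subset_Icc_self hu))]
    · filter_upwards [ae_restrict_mem measurableSet_Ico] with u hu
      rw [norm_mul, L.norm_phase, one_mul]
      exact hD u (Ico_subset_Icc_self hu)
  have hiψ : IntegrableOn (L.fundDeriv c d ξ) (Icc 0 T) := by
    refine Integrable.of_bound hmd.aestronglyMeasurable (‖d‖ + ξ ^ 2 * (A * D)) ?_
    filter_upwards [ae_restrict_mem measurableSet_Icc] with u hu using hbd u hu
  -- As the exponential with the opposite constant, the conjugate phase falls under `exp_mul_B_eq`,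
  -- which provides its derivative.
  have hconj : ∀ r, starRingEnd ℂ (L.phase ξ r) = Complex.exp (-(2 * Complex.I * ξ) * L.Bdom r) := by
    intro r
    rw [OpL.phase, ← Complex.exp_conj]
    simp [Complex.conj_ofNat]
  have hmpc : StronglyMeasurable fun r => starRingEnd ℂ (L.phase ξ r) :=
    Complex.continuous_conj.comp_stronglyMeasurable hmp
  refine ⟨hiψ, ?_, fun t ht => ?_, fun t ht => ?_⟩
  · refine Integrable.mul_bdd (c := ‖d‖ + ξ ^ 2 * (A * D)) hc.integrableOn.ofReal
      hmd.aestronglyMeasurable ?_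
    filter_upwards [ae_restrict_mem measurableSet_Icc] with u hu using hbd u hu
  · have htd := Icc_subset_dom hT ht
    rw [L.fund_zero, L.fund_eq c d ξ htd, OpL.volterraData, volterra, intervalIntegral.integral_of_le ht.1,
      ← integral_Ico_eq_integral_Ioc, add_assoc, ← integral_const_mul, ← integral_const_mul,
      ← integral_add]
    · congr 1
      refine integral_congr_ae (Eventually.of_forall fun r => ?_)
      simp only [OpL.fundDeriv]
      ring
    · refine Integrable.const_mul ?_ _
      refine Integrable.of_bound hmpc.aestronglyMeasurable 1 (Eventually.of_forall fun r => ?_)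
      rw [RCLike.norm_conj, L.norm_phase]
    · refine Integrable.const_mul ?_ _
      refine (integrableOn_mul_integral_Ico (hfin) (φ' := fun r => starRingEnd ℂ (L.phase ξ r))
        ?_ hif).mono_set (Ico_subset_Icc_self.trans (Icc_subset_Icc_right ht.2))
      refine Integrable.of_bound hmpc.aestronglyMeasurable 1 (Eventually.of_forall fun r => ?_)
      rw [RCLike.norm_conj, L.norm_phase]
  · have htd := Icc_subset_dom hT ht
    have hsub : Icc 0 t ⊆ Icc 0 T := Icc_subset_Icc_right ht.2
    have key := mul_sub_mul_eq (μ := L.aDom) (φ := fun r => starRingEnd ℂ (L.phase ξ r))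
      (φ' := fun r => -(2 * Complex.I * ξ) * L.b r * starRingEnd ℂ (L.phase ξ r))
      (F := fun t => d + (ξ : ℂ) ^ 2 * ∫ r in Ico 0 t, L.phase ξ r * L.fund c d ξ r ∂L.aDom)
      (f := fun r => (ξ : ℂ) ^ 2 * (L.phase ξ r * L.fund c d ξ r)) (k := fun _ => 0) ht.1
      (L.aDom_Ico_lt_top htd) (by
        refine Integrable.mul_bdd (c := 1) ((hc.mono le_rfl ht.2).integrableOn.ofReal.const_mul _)
          hmpc.aestronglyMeasurable (Eventually.of_forall fun r => ?_)
        rw [RCLike.norm_conj, L.norm_phase]) (by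
        intro u hu
        have h0 : L.Bdom 0 = 0 := by
          rw [OpL.Bdom, indicator_of_mem (Icc_subset_dom hT ⟨le_rfl, hT0⟩), OpL.B,
            intervalIntegral.integral_same]
        simp only [hconj]
        rw [exp_mul_B_eq L hT _ u (hsub hu), h0]
        simp)
      ((hif.mono_set (Ico_subset_Ico_right ht.2)).const_mul _) (by simp) (by
        intro u hu
        simp [integral_const_mul])
    have e1 : ∀ r, starRingEnd ℂ (L.phase ξ r) * ((ξ : ℂ) ^ 2 * (L.phase ξ r * L.fund c d ξ r)) =
        (ξ : ℂ) ^ 2 * L.fund c d ξ r := by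
      intro r
      have := Complex.conj_mul' (L.phase ξ r)
      rw [L.norm_phase] at this
      push_cast at this
      linear_combination ((ξ : ℂ) ^ 2 * L.fund c d ξ r) * this
    have e2 : ∀ r, -(2 * Complex.I * ξ) * L.b r * starRingEnd ℂ (L.phase ξ r) *
        (d + (ξ : ℂ) ^ 2 * ∫ r in Ico 0 r, L.phase ξ r * L.fund c d ξ r ∂L.aDom) =
        -(2 * Complex.I * ξ) * (L.b r * L.fundDeriv c d ξ r) := by
      intro r; rw [OpL.fundDeriv]; ring
    simp only [e1, e2, mul_zero, intervalIntegral.integral_zero, add_zero, integral_const_mul,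
      intervalIntegral.integral_const_mul] at key
    have e3 : L.fundDeriv c d ξ t - L.fundDeriv c d ξ 0 = _ := key
    rw [L.restrict_Ico htd] at e3
    linear_combination e3

end HarmExt
end

/-! ### Existence and uniqueness of the distinguished solution -/

noncomputable section
namespace HarmExt

/-- The energy inequality gives ψ = 0 almost everywhere, and the integrated equation then makes ψ
constant. This second step is needed because ψ(s) is a pointwise value. -/
theorem IsSol.deriv_eq_zero {a : Measure ℝ} {b : ℝ → ℝ} {ξ s T : ℝ} {φ ψ : ℝ → ℂ} (hsT : s < T)
    (h : IsSol a b ξ s T φ ψ) (hφ : ∀ t ∈ Icc s T, φ t = 0) (hc : Coeff a b s T) : ψ s = 0 := by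
  have h1 := h.integral_sq_le hsT.le hc
  have h2 : energyFlux φ ψ T - energyFlux φ ψ s = 0 := by
    simp [energyFlux, hφ T ⟨hsT.le, le_rfl⟩, hφ s ⟨le_rfl, hsT.le⟩]
  rw [h2, intervalIntegral.integral_of_le hsT.le] at h1
  have h3 := (setIntegral_eq_zero_iff_of_nonneg_ae (Eventually.of_forall fun _ => by positivity)
    ((h.integrableOn_sq hc).mono_set Ioc_subset_Icc_self)).1
    (le_antisymm h1 (integral_nonneg fun _ => by positivity))
  have h4 : ∀ᵐ r ∂(volume.restrict (Ioc s T)), ψ r = 0 := by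
    filter_upwards [h3, ae_restrict_mem measurableSet_Ioc] with r hr hr'
    rw [hφ r (Ioc_subset_Icc_self hr')] at hr
    simpa using hr
  have h5 : ∀ t ∈ Icc s T, ψ t = ψ s := by
    intro t ht
    have e1 : ∫ r in s..t, (b r : ℂ) * ψ r = 0 := by
      rw [intervalIntegral.integral_of_le ht.1]
      refine integral_eq_zero_of_ae ?_
      filter_upwards [ae_restrict_of_ae_restrict_of_subset (Ioc_subset_Ioc_right ht.2) h4] with r hr
      simp [hr]
    have e2 : ∫ r in Ico s t, φ r ∂a = 0 :=
      setIntegral_eq_zero_of_forall_eq_zero fun r hr => hφ r ⟨hr.1, hr.2.le.trans ht.2⟩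
    rw [h.deriv_eq t ht, e1, e2]
    ring
  have h6 : ∀ᵐ r ∂(volume.restrict (Ioc s T)), ψ s = 0 := by
    filter_upwards [h4, ae_restrict_mem measurableSet_Ioc] with r hr hr'
    rw [← h5 r (Ioc_subset_Icc_self hr'), hr]
  by_contra hne
  rw [ae_iff] at h6
  simp [hne] at h6
  exact absurd hsT (not_lt.2 h6)

variable {L : OpL}

/-- A zero at r besides the one at 0 would, by convexity of |φ|², force φ = 0 on [0, r], against
φ'(0) = 1. -/
theorem OpL.fund_zero_one_ne_zero (ξ : ℝ) {r : ℝ} (hr : r ∈ openDom L.R) : L.fund 0 1 ξ r ≠ 0 := by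
  intro h0
  have hrd := openDom_subset_dom _ hr
  have hs := L.isSol_fund 0 1 ξ hrd
  have h1 : ∀ t ∈ Icc 0 r, L.fund 0 1 ξ t = 0 := by
    intro t ht
    have := hs.norm_sq_mul_le (L.coeff hrd) le_rfl ht.1 ht.2 le_rfl
    rw [h0, L.fund_zero] at this
    have h2 : ‖L.fund 0 1 ξ t‖ ^ 2 ≤ 0 := by
      have h3 : (r - 0) * ‖L.fund 0 1 ξ t‖ ^ 2 ≤ (r - 0) * 0 := by simpa using this
      exact le_of_mul_le_mul_left h3 (by simpa using hr.1)
    have h4 := le_antisymm h2 (by positivity)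
    simpa using h4
  have := hs.deriv_eq_zero hr.1 h1 (L.coeff hrd)
  rw [L.fundDeriv_zero] at this
  exact one_ne_zero this

/-- The initial slope of the solution with `φ(0) = 1` and `φ(r) = 0`. -/
def OpL.slope (L : OpL) (r ξ : ℝ) : ℂ := -(L.fund 1 0 ξ r / L.fund 0 1 ξ r)

/-- A convex function equal to 1 at 0 and to 0 at r lies below the chord. -/
theorem OpL.norm_sq_fund_add_slope_le (ξ : ℝ) {r : ℝ} (hr : r ∈ openDom L.R) {y : ℝ}
    (hy : y ∈ Icc 0 r) : ‖L.fund 1 0 ξ y + L.slope r ξ * L.fund 0 1 ξ y‖ ^ 2 ≤ 1 - y / r := by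
  have hrd := openDom_subset_dom _ hr
  have hc := L.coeff hrd
  have hs := (L.isSol_fund 1 0 ξ hrd).add_const_mul hc.finite (L.isSol_fund 0 1 ξ hrd) (L.slope r ξ)
  have h1 := hs.norm_sq_mul_le hc le_rfl hy.1 hy.2 le_rfl
  have h2 : L.fund 1 0 ξ r + L.slope r ξ * L.fund 0 1 ξ r = 0 := by
    rw [OpL.slope]
    field_simp [L.fund_zero_one_ne_zero ξ hr]
    simp
  rw [h2, L.fund_zero, L.fund_zero] at h1
  have hr0 := hr.1
  rw [one_sub_div hr0.ne', le_div_iff₀ hr0]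
  simp at h1
  linarith

/-- At r, the solution that vanishes at r' equals the difference of slopes times `L.fund 0 1 ξ r`,
and its square is at most 1 - r/r'. By convexity |`L.fund 0 1 ξ r`|² is at least r/r₀ times its
value at r₀. -/
theorem OpL.norm_sq_slope_sub_le (ξ : ℝ) {r₀ r r' : ℝ} (hr₀ : r₀ ∈ openDom L.R) (hr : r₀ ≤ r)
    (hrr' : r ≤ r') (hr' : r' ∈ openDom L.R) :
    ‖L.slope r' ξ - L.slope r ξ‖ ^ 2 ≤ r₀ / ‖L.fund 0 1 ξ r₀‖ ^ 2 * (r⁻¹ - r'⁻¹) := by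
  have hrp : 0 < r := hr₀.1.trans_le hr
  have hrd : r ∈ openDom L.R := ⟨hrp, (EReal.coe_le_coe_iff.2 hrr').trans_lt hr'.2⟩
  have hrdd := openDom_subset_dom _ hrd
  have h1 := L.norm_sq_fund_add_slope_le ξ hr' (y := r) ⟨hrp.le, hrr'⟩
  have h2 : L.fund 1 0 ξ r + L.slope r' ξ * L.fund 0 1 ξ r =
      (L.slope r' ξ - L.slope r ξ) * L.fund 0 1 ξ r := by
    have : L.slope r ξ * L.fund 0 1 ξ r = - L.fund 1 0 ξ r := by
      rw [OpL.slope]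
      field_simp [L.fund_zero_one_ne_zero ξ hrd]
    linear_combination this
  have h3 := (L.isSol_fund 0 1 ξ hrdd).norm_sq_mul_le (L.coeff hrdd) le_rfl hr₀.1.le hr le_rfl
  rw [L.fund_zero] at h3
  rw [h2, norm_mul, mul_pow] at h1
  simp at h3
  have hD : 0 < ‖L.fund 0 1 ξ r₀‖ ^ 2 := by
    have := L.fund_zero_one_ne_zero ξ hr₀
    positivity
  have hr'p := hr'.1
  rw [div_mul_eq_mul_div, le_div_iff₀ hD]
  have h4 : r * (‖L.slope r' ξ - L.slope r ξ‖ ^ 2 * ‖L.fund 0 1 ξ r₀‖ ^ 2) ≤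
      r * (r₀ * (r⁻¹ - r'⁻¹)) := by
    have e : r * (r₀ * (r⁻¹ - r'⁻¹)) = r₀ * (1 - r / r') := by field_simp
    rw [e]
    calc r * (‖L.slope r' ξ - L.slope r ξ‖ ^ 2 * ‖L.fund 0 1 ξ r₀‖ ^ 2)
        = ‖L.slope r' ξ - L.slope r ξ‖ ^ 2 * (r * ‖L.fund 0 1 ξ r₀‖ ^ 2) := by ring
      _ ≤ ‖L.slope r' ξ - L.slope r ξ‖ ^ 2 * (r₀ * ‖L.fund 0 1 ξ r‖ ^ 2) := by gcongr
      _ = r₀ * (‖L.slope r' ξ - L.slope r ξ‖ ^ 2 * ‖L.fund 0 1 ξ r‖ ^ 2) := by ring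
      _ ≤ _ := by have := hr₀.1; gcongr
  exact le_of_mul_le_mul_left h4 hrp

/-- Squared distances of slopes are controlled by differences of 1/r, a decreasing sequence bounded
below. Thus R = ∞ and R < ∞ need no separate treatment. -/
theorem OpL.cauchySeq_slope (ξ : ℝ) {r : ℕ → ℝ} (hr : Monotone r) (hr2 : ∀ n, r n ∈ openDom L.R) :
    CauchySeq fun n => L.slope (r n) ξ := by
  set C := r 0 / ‖L.fund 0 1 ξ (r 0)‖ ^ 2
  have hC : 0 < C := by
    have := L.fund_zero_one_ne_zero ξ (hr2 0)
    have := (hr2 0).1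
    positivity
  have hanti : Antitone fun n => (r n)⁻¹ := fun m n hmn => inv_anti₀ (hr2 m).1 (hr hmn)
  have hbdd : BddBelow (range fun n => (r n)⁻¹) := ⟨0, by
    rintro _ ⟨n, rfl⟩; exact inv_nonneg.2 (hr2 n).1.le⟩
  have hcs := (tendsto_atTop_ciInf hanti hbdd).cauchySeq
  rw [Metric.cauchySeq_iff'] at hcs ⊢
  intro ε hε
  obtain ⟨N, hN⟩ := hcs (ε ^ 2 / C) (by positivity)
  refine ⟨N, fun n hn => ?_⟩
  have h1 := hN n hn
  rw [dist_comm, Real.dist_eq, abs_of_nonneg (sub_nonneg.2 (hanti hn)), lt_div_iff₀ hC] at h1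
  have h2 := L.norm_sq_slope_sub_le ξ (hr2 0) (hr (Nat.zero_le N)) (hr hn) (hr2 n)
  rw [dist_eq_norm]
  refine lt_of_pow_lt_pow_left₀ 2 hε.le (h2.trans_lt ?_)
  rw [mul_comm]
  exact h1

/-- A measurable family of solutions with `φ(0) = 1` that are bounded by `1` and, if `R < ∞`,
vanish at `R`. -/
theorem OpL.exists_family (L : OpL) : ∃ φ ψ : ℝ → ℝ → ℂ,
    Measurable (Function.uncurry φ) ∧ Measurable (Function.uncurry ψ) ∧
    (∀ ξ, ∀ T ∈ dom L.R, IsSol L.a L.b ξ 0 T (φ ξ) (ψ ξ)) ∧ (∀ ξ, φ ξ 0 = 1) ∧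
    (∀ ξ, ∀ y ∈ dom L.R, ‖φ ξ y‖ ≤ 1) ∧
    ∀ r : ℝ, L.R = (r : EReal) → ∀ ξ, ∀ y ∈ dom L.R, ‖φ ξ y‖ ^ 2 ≤ 1 - y / r := by
  obtain ⟨r, hr, hr2, hr3⟩ := exists_seq_openDom L.R_pos
  choose m hm using fun ξ => cauchySeq_tendsto_of_complete (L.cauchySeq_slope ξ hr.monotone hr2)
  have hmeas : ∀ c d y, y ∈ dom L.R → Measurable fun ξ => L.fund c d ξ y := by
    intro c d y hy
    have := (L.stronglyMeasurable_fund c d).measurable.comp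
      (measurable_prodMk_right (y := y) (α := ℝ))
    simpa [Function.comp_def, Function.uncurry, indicator_of_mem hy] using this
  have hmm : Measurable m := by
    refine measurable_of_tendsto_metrizable (f := fun n ξ => L.slope (r n) ξ) (fun n => ?_)
      (tendsto_pi_nhds.2 hm)
    have hn := openDom_subset_dom _ (hr2 n)
    exact ((hmeas 1 0 _ hn).div (hmeas 0 1 _ hn)).neg
  -- The chord bounds pass to the limit. They will be used with C = 1, and with C = 1 - y/R when R
  -- is finite.
  have hfin : ∀ ξ, ∀ y ∈ dom L.R, ∀ C : ℝ, (∀ n, y ≤ r n → 1 - y / r n ≤ C) →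
      ‖L.fund 1 0 ξ y + m ξ * L.fund 0 1 ξ y‖ ^ 2 ≤ C := by
    intro ξ y hy C hC
    have ht : Tendsto (fun n => ‖L.fund 1 0 ξ y + L.slope (r n) ξ * L.fund 0 1 ξ y‖ ^ 2) atTop
        (𝓝 (‖L.fund 1 0 ξ y + m ξ * L.fund 0 1 ξ y‖ ^ 2)) :=
      ((tendsto_const_nhds.add ((hm ξ).mul tendsto_const_nhds)).norm).pow 2
    refine le_of_tendsto ht ?_
    obtain ⟨N, hN⟩ := hr3 y hy
    filter_upwards [eventually_ge_atTop N] with n hn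
    have hyn := hN.le.trans (hr.monotone hn)
    exact (L.norm_sq_fund_add_slope_le ξ (hr2 n) ⟨hy.1, hyn⟩).trans (hC n hyn)
  refine ⟨fun ξ y => (dom L.R).indicator (fun y => L.fund 1 0 ξ y + m ξ * L.fund 0 1 ξ y) y,
    fun ξ y => L.fundDeriv 1 0 ξ y + m ξ * L.fundDeriv 0 1 ξ y, ?_, ?_, ?_, ?_, ?_, ?_⟩
  · have : (Function.uncurry fun ξ y => (dom L.R).indicator
        (fun y => L.fund 1 0 ξ y + m ξ * L.fund 0 1 ξ y) y) =
        fun q : ℝ × ℝ => (Function.uncurry fun ξ t => (dom L.R).indicator (L.fund 1 0 ξ) t) q +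
          m q.1 * (Function.uncurry fun ξ t => (dom L.R).indicator (L.fund 0 1 ξ) t) q := by
      ext ⟨ξ, y⟩
      by_cases hy : y ∈ dom L.R <;> simp [Function.uncurry, hy]
    rw [this]
    exact (L.stronglyMeasurable_fund 1 0).measurable.add
      ((hmm.comp measurable_fst).mul (L.stronglyMeasurable_fund 0 1).measurable)
  · exact (L.stronglyMeasurable_fundDeriv 1 0).measurable.add
      ((hmm.comp measurable_fst).mul (L.stronglyMeasurable_fundDeriv 0 1).measurable)
  · intro ξ T hT
    have hc := L.coeff hT
    have hs := (L.isSol_fund 1 0 ξ hT).add_const_mul hc.finite (L.isSol_fund 0 1 ξ hT) (m ξ)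
    have hin : ∀ t ∈ Icc 0 T, (dom L.R).indicator
        (fun y => L.fund 1 0 ξ y + m ξ * L.fund 0 1 ξ y) t =
        L.fund 1 0 ξ t + m ξ * L.fund 0 1 ξ t := fun t ht => by
      rw [indicator_of_mem (Icc_subset_dom hT ht)]
    refine ⟨hs.int_deriv, hs.int_mul_deriv, fun t ht => ?_, fun t ht => ?_⟩
    · beta_reduce
      rw [hin t ht, hin 0 ⟨le_rfl, hT.1⟩]
      exact hs.eq t ht
    · beta_reduce
      rw [hs.deriv_eq t ht]
      congr 3
      exact setIntegral_congr_fun measurableSet_Ico fun u hu =>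
        (hin u ⟨hu.1, hu.2.le.trans ht.2⟩).symm
  · intro ξ
    have h0 : (0 : ℝ) ∈ dom L.R := ⟨le_rfl, L.R_pos⟩
    simp [indicator_of_mem h0, L.fund_zero]
  · intro ξ y hy
    beta_reduce
    rw [indicator_of_mem hy]
    have := hfin ξ y hy 1 fun n _ => by
      have := (hr2 n).1
      have := hy.1
      have : 0 ≤ y / r n := by positivity
      linarith
    exact (sq_le_one_iff₀ (norm_nonneg _)).1 this
  · intro R hR ξ y hy
    beta_reduce
    rw [indicator_of_mem hy]
    refine hfin ξ y hy _ fun n _ => ?_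
    have h1 : r n < R := EReal.coe_lt_coe_iff.1 (hR ▸ (hr2 n).2)
    have := (hr2 n).1
    have := hy.1
    have : y / R ≤ y / r n := by gcongr
    linarith

/-- A solution that vanishes at `0`, and that is bounded or vanishes at `R`, is zero. -/
theorem eq_zero_of_norm_sq_mul_le {R : EReal} (hR : 0 < R) {N : ℝ → ℝ} (hN : ∀ y ∈ dom R, 0 ≤ N y)
    (hconv : ∀ y ∈ dom R, ∀ z ∈ dom R, y ≤ z → z * N y ≤ y * N z)
    (hbdd : R = ⊤ → ∃ C : ℝ, ∀ y ∈ dom R, N y ≤ C)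
    (hlim : ∀ r : ℝ, R = (r : EReal) → Tendsto N (𝓝[<] r) (𝓝 0)) : ∀ y ∈ dom R, N y = 0 := by
  intro y hy
  refine le_antisymm ?_ (hN y hy)
  induction R using EReal.rec with
  | bot => simp at hR
  | top =>
    obtain ⟨C, hC⟩ := hbdd rfl
    -- N(y) ≤ y N(z)/z, and the right-hand side tends to 0 as z → ∞ because N is bounded. For finite
    -- R it tends to 0 because N does.
    have h1 : Tendsto (fun z : ℝ => y * C / z) atTop (𝓝 0) := tendsto_const_nhds.div_atTop tendsto_id
    refine ge_of_tendsto h1 ?_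
    filter_upwards [eventually_ge_atTop y, eventually_gt_atTop 0] with z hz hz0
    have hzd : z ∈ dom ⊤ := ⟨hz0.le, EReal.coe_lt_top z⟩
    rw [le_div_iff₀ hz0, mul_comm]
    exact (hconv y hy z hzd hz).trans (mul_le_mul_of_nonneg_left (hC z hzd) hy.1)
  | coe r =>
    have hyr : y < r := EReal.coe_lt_coe_iff.1 hy.2
    have hr : 0 < r := hy.1.trans_lt hyr
    have h1 : Tendsto (fun z : ℝ => y * N z / z) (𝓝[<] r) (𝓝 (y * 0 / r)) :=
      (tendsto_const_nhds.mul (hlim r rfl)).div (tendsto_nhdsWithin_of_tendsto_nhds tendsto_id) hr.ne'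
    rw [mul_zero, zero_div] at h1
    refine ge_of_tendsto h1 ?_
    filter_upwards [self_mem_nhdsWithin, mem_nhdsWithin_of_mem_nhds (Ioi_mem_nhds hyr)] with z hz hz2
    have hz0 : 0 < z := hy.1.trans_lt hz2
    rw [le_div_iff₀ hz0, mul_comm]
    exact hconv y hy z ⟨hz0.le, EReal.coe_lt_coe_iff.2 hz⟩ (le_of_lt hz2)

theorem OpL.IsODESolution.exists_isSol {ξ : ℝ} {φ : ℝ → ℂ} (h : L.IsODESolution ξ φ) :
    ∃ ψ, ∀ T ∈ dom L.R, IsSol L.a L.b ξ 0 T φ ψ := by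
  obtain ⟨ψ, hψ⟩ := h
  exact ⟨ψ, fun T hT => ⟨(hψ T hT).1, (hψ T hT).2.1,
    fun t ht => (hψ t (Icc_subset_dom hT ht)).2.2.1,
    fun t ht => (hψ t (Icc_subset_dom hT ht)).2.2.2⟩⟩

theorem isODESolution_of_isSol {ξ : ℝ} {φ ψ : ℝ → ℂ}
    (h : ∀ T ∈ dom L.R, IsSol L.a L.b ξ 0 T φ ψ) : L.IsODESolution ξ φ :=
  ⟨ψ, fun t ht => ⟨(h t ht).int_deriv, (h t ht).int_mul_deriv, (h t ht).eq t ⟨ht.1, le_rfl⟩,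
    (h t ht).deriv_eq t ⟨ht.1, le_rfl⟩⟩⟩

/-- The difference of two candidates solves the same equation and vanishes at 0, so its squared
modulus satisfies the hypotheses of `eq_zero_of_norm_sq_mul_le`. -/
theorem OpL.IsPhi.eqOn {ξ : ℝ} {φ₁ φ₂ : ℝ → ℂ} (h₁ : L.IsPhi ξ φ₁) (h₂ : L.IsPhi ξ φ₂) :
    EqOn φ₁ φ₂ (dom L.R) := by
  rcases eq_or_ne ξ 0 with h0 | h0
  · intro y hy
    rw [h₁.1 h0 y hy, h₂.1 h0 y hy]
  obtain ⟨s₁, z₁, b₁, l₁⟩ := h₁.2 h0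
  obtain ⟨s₂, z₂, b₂, l₂⟩ := h₂.2 h0
  obtain ⟨ψ₁, hs₁⟩ := s₁.exists_isSol
  obtain ⟨ψ₂, hs₂⟩ := s₂.exists_isSol
  intro y hy
  have := eq_zero_of_norm_sq_mul_le L.R_pos (N := fun y => ‖φ₁ y + (-1) * φ₂ y‖ ^ 2)
    (fun _ _ => by positivity) ?_ ?_ ?_ y hy
  · simpa [sub_eq_zero, ← sub_eq_add_neg] using this
  · intro y hy z hz hyz
    have := ((hs₁ z hz).add_const_mul (L.coeff hz).finite (hs₂ z hz) (-1)).norm_sq_mul_le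
      (L.coeff hz) le_rfl hy.1 hyz le_rfl
    simpa [z₁, z₂] using this
  · intro hR
    obtain ⟨C₁, hC₁⟩ := b₁ hR
    obtain ⟨C₂, hC₂⟩ := b₂ hR
    refine ⟨(C₁ + C₂) ^ 2, fun y hy => ?_⟩
    refine pow_le_pow_left₀ (norm_nonneg _) ?_ 2
    refine (norm_add_le _ _).trans (add_le_add (hC₁ y hy) ?_)
    simpa using hC₂ y hy
  · intro r hr
    simpa using (((l₁ r hr).add ((l₂ r hr).const_mul (-1))).norm).pow 2

end HarmExt
end

/-! ### Fourier transform in one variable, measurable in the other -/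

noncomputable section
namespace HarmExt

section PartialFourier

open SchwartzMap

/-- The L² transform agrees with the transform of tempered distributions, which is defined by this
duality. -/
theorem integral_fourier_mul_schwartz (f : Lp ℂ 2 (volume : Measure ℝ)) (g : 𝓢(ℝ, ℂ)) :
    ∫ x, (𝓕 f : Lp ℂ 2 (volume : Measure ℝ)) x * g x = ∫ x, f x * (𝓕 g) x := by
  have h := congrArg (fun T => T g) (Lp.fourier_toTemperedDistribution_eq f)
  simp only [TemperedDistribution.fourier_apply, Lp.toTemperedDistribution_apply, smul_eq_mul] at h
  rw [integral_congr_ae (Eventually.of_forall fun x => mul_comm _ _), ← h]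
  exact integral_congr_ae (Eventually.of_forall fun x => mul_comm _ _)

theorem integral_fourierInv_mul_schwartz (f : Lp ℂ 2 (volume : Measure ℝ)) (g : 𝓢(ℝ, ℂ)) :
    ∫ x, (𝓕⁻ f : Lp ℂ 2 (volume : Measure ℝ)) x * g x = ∫ x, f x * (𝓕⁻ g) x := by
  have h := congrArg (fun T => T g) (Lp.fourierInv_toTemperedDistribution_eq f)
  simp only [TemperedDistribution.fourierInv_apply, Lp.toTemperedDistribution_apply,
    smul_eq_mul] at h
  rw [integral_congr_ae (Eventually.of_forall fun x => mul_comm _ _), ← h]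
  exact integral_congr_ae (Eventually.of_forall fun x => mul_comm _ _)

/-- A sequence of bump functions shrinking to `0`. -/
def bumpSeq (n : ℕ) : ContDiffBump (0 : ℝ) where
  rIn := 1 / (n + 1)
  rOut := 2 / (n + 1)
  rIn_pos := by positivity
  rIn_lt_rOut := by gcongr; norm_num

theorem tendsto_bumpSeq : Tendsto (fun n => (bumpSeq n).rOut) atTop (𝓝 0) := by
  have h := tendsto_one_div_add_atTop_nhds_zero_nat (𝕜 := ℝ)
  have h2 := h.const_mul 2
  rw [mul_zero] at h2
  refine h2.congr fun n => ?_
  simp only [bumpSeq]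
  ring

/-- If an operator on `L²` is given by an exponential kernel in the weak sense, then it can be
applied to the slices of a measurable function in a measurable way. -/
theorem exists_measurable_partial (T : Lp ℂ 2 (volume : Measure ℝ) → Lp ℂ 2 (volume : Measure ℝ))
    (σ : ℝ)
    (hT : ∀ (f : Lp ℂ 2 (volume : Measure ℝ)) (g : 𝓢(ℝ, ℂ)), ∫ x, T f x * g x =
      ∫ x, f x * ∫ η, Complex.exp (((σ * (2 * Real.pi * (η * x)) : ℝ) : ℂ) * Complex.I) * g η)
    {G : ℝ → ℝ → ℂ} (hG : Measurable (Function.uncurry G)) :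
    ∃ H : ℝ → ℝ → ℂ, Measurable (Function.uncurry H) ∧
      ∀ y, ∀ h : MemLp (fun x => G x y) 2 volume,
        (fun ξ => H ξ y) =ᵐ[volume] T (h.toLp (fun x => G x y)) := by
  set ρ : ℕ → ℝ → ℝ := fun n => (bumpSeq n).normed volume with hρ
  -- The exponential kernel smoothed at scale 1/n around ξ. Pairing it with a slice needs no choice
  -- of representative of the transform and is jointly measurable.
  set k : ℕ → ℝ → ℝ → ℂ := fun n ξ x =>
    ∫ η, Complex.exp (((σ * (2 * Real.pi * (η * x)) : ℝ) : ℂ) * Complex.I) * (ρ n (ξ - η) : ℂ)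
    with hk
  have hρc : ∀ n, Continuous (ρ n) := fun n => (bumpSeq n).continuous_normed
  have hkm : ∀ n, StronglyMeasurable (Function.uncurry (k n)) := by
    intro n
    refine StronglyMeasurable.integral_prod_right (f := fun (q : ℝ × ℝ) η =>
      Complex.exp (((σ * (2 * Real.pi * (η * q.2)) : ℝ) : ℂ) * Complex.I) * (ρ n (q.1 - η) : ℂ)) ?_
    have := hρc n
    refine Continuous.stronglyMeasurable ?_
    simp only [Function.uncurry_def]
    fun_prop
  have hHm : ∀ n, StronglyMeasurable (fun q : ℝ × ℝ => ∫ x, G x q.2 * k n q.1 x) := by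
    intro n
    refine StronglyMeasurable.integral_prod_right (f := fun (q : ℝ × ℝ) x => G x q.2 * k n q.1 x) ?_
    refine StronglyMeasurable.mul ?_ ?_
    · exact hG.stronglyMeasurable.comp_measurable (g := fun p : (ℝ × ℝ) × ℝ => (p.2, p.1.2))
        (by fun_prop)
    · exact (hkm n).comp_measurable (g := fun p : (ℝ × ℝ) × ℝ => (p.1.1, p.2)) (by fun_prop)
  refine ⟨fun ξ y => limUnder atTop fun n => ∫ x, G x y * k n ξ x, ?_, fun y h => ?_⟩
  · exact (StronglyMeasurable.limUnder hHm).measurable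
  · have hloc : LocallyIntegrable (T (h.toLp (fun x => G x y))) volume :=
      (Lp.memLp _).locallyIntegrable (by norm_num)
    -- Lebesgue differentiation: averages of T f around ξ converge to T f (ξ) for almost every ξ.
    -- The factor 2 is the ratio of the outer and inner radii of the bumps.
    have hae := ContDiffBump.ae_convolution_tendsto_right_of_locallyIntegrable (φ := bumpSeq)
      (l := atTop) (K := 2) tendsto_bumpSeq
      (Eventually.of_forall fun n => by simp only [bumpSeq]; apply le_of_eq; ring) hloc
    filter_upwards [hae] with ξ hξ
    refine Tendsto.limUnder_eq (hξ.congr fun n => ?_)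
    rw [convolution_eq_swap]
    have hcs : HasCompactSupport fun η => ((ρ n (ξ - η) : ℝ) : ℂ) := by
      have h1 : HasCompactSupport (ρ n) := (bumpSeq n).hasCompactSupport_normed
      have h2 := h1.comp_homeomorph (Homeomorph.subLeft ξ)
      exact h2.comp_left (g := fun r : ℝ => (r : ℂ)) (by simp)
    have hsm : ContDiff ℝ ∞ fun η => ((ρ n (ξ - η) : ℝ) : ℂ) := by
      have h1 : ContDiff ℝ ∞ (ρ n) := (bumpSeq n).contDiff_normed
      exact Complex.ofRealCLM.contDiff.comp (h1.comp (contDiff_const.sub contDiff_id))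
    have h3 := hT (h.toLp (fun x => G x y)) (hcs.toSchwartzMap hsm)
    simp only [HasCompactSupport.toSchwartzMap_toFun] at h3
    have h4 : ∫ x, G x y * k n ξ x = ∫ x, (h.toLp (fun x => G x y)) x * k n ξ x := by
      refine integral_congr_ae ?_
      filter_upwards [h.coeFn_toLp] with x hx
      rw [hx]
    rw [h4]
    refine Eq.trans ?_ h3
    refine integral_congr_ae (Eventually.of_forall fun x => ?_)
    simp [ρ, mul_comm]

end PartialFourier

/-- `F` is the Fourier transform of the square-integrable function `f`. -/
def IsFourier (f F : ℝ → ℂ) : Prop :=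
  ∃ hf : MemLp f 2 volume, F =ᵐ[volume] (𝓕 (hf.toLp f) : Lp ℂ 2 (volume : Measure ℝ))

/-- The inverse Fourier transform of a function, as an integral. -/
def invFT (α : ℝ → ℂ) (ξ : ℝ) : ℂ :=
  ∫ x : ℝ, Complex.exp (Complex.I * ((2 * Real.pi * ξ : ℝ) : ℂ) * x) * α x

variable {f f₁ f₂ F F₁ F₂ α : ℝ → ℂ}

theorem invFT_eq (α : ℝ → ℂ) : invFT α = 𝓕⁻ α := by
  ext ξ
  rw [invFT, Real.fourierInv_eq']
  refine integral_congr_ae (Eventually.of_forall fun x => ?_)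
  simp only [smul_eq_mul, RCLike.inner_apply, conj_trivial]
  congr 2
  push_cast
  ring

theorem exists_measurable_fourier {G : ℝ → ℝ → ℂ} (hG : Measurable (Function.uncurry G)) :
    ∃ H : ℝ → ℝ → ℂ, Measurable (Function.uncurry H) ∧
      ∀ y, MemLp (fun x => G x y) 2 volume → IsFourier (fun x => G x y) (fun ξ => H ξ y) := by
  obtain ⟨H, hH, h⟩ := exists_measurable_partial (fun f => 𝓕 f) (-1) (fun f g => by
    rw [integral_fourier_mul_schwartz]
    refine integral_congr_ae (Eventually.of_forall fun x => ?_)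
    simp only [SchwartzMap.fourier_coe, Real.fourier_eq']
    congr 1
    refine integral_congr_ae (Eventually.of_forall fun η => ?_)
    simp only [smul_eq_mul, RCLike.inner_apply, conj_trivial]
    congr 2
    push_cast
    ring) hG
  exact ⟨H, hH, fun y hy => ⟨hy, h y hy⟩⟩

/-- The given slices are on the Fourier side here; this builds u and ∂_y ũ from their prescribed
transforms. -/
theorem exists_measurable_fourierInv {G : ℝ → ℝ → ℂ} (hG : Measurable (Function.uncurry G)) :
    ∃ H : ℝ → ℝ → ℂ, Measurable (Function.uncurry H) ∧
      ∀ y, MemLp (fun x => G x y) 2 volume → IsFourier (fun ξ => H ξ y) (fun x => G x y) := by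
  obtain ⟨H, hH, h⟩ := exists_measurable_partial (fun f => 𝓕⁻ f) 1 (fun f g => by
    rw [integral_fourierInv_mul_schwartz]
    refine integral_congr_ae (Eventually.of_forall fun x => ?_)
    simp only [SchwartzMap.fourierInv_coe, Real.fourierInv_eq']
    congr 1
    refine integral_congr_ae (Eventually.of_forall fun η => ?_)
    simp only [smul_eq_mul, RCLike.inner_apply, conj_trivial]
    congr 2
    push_cast
    ring) hG
  refine ⟨H, hH, fun y hy => ?_⟩
  have h1 : MemLp (fun ξ => H ξ y) 2 volume := (memLp_congr_ae (h y hy)).2 (Lp.memLp _)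
  refine ⟨h1, ?_⟩
  have h2 : h1.toLp (fun ξ => H ξ y) = 𝓕⁻ (hy.toLp (fun x => G x y)) := by
    refine Lp.ext ?_
    exact h1.coeFn_toLp.trans (h y hy)
  rw [h2, FourierTransform.fourier_fourierInv_eq]
  exact hy.coeFn_toLp.symm

theorem IsFourier.memLp_left (h : IsFourier f F) : MemLp f 2 volume := h.1

theorem IsFourier.memLp_right (h : IsFourier f F) : MemLp F 2 volume :=
  (memLp_congr_ae h.2).2 (Lp.memLp _)

theorem IsFourier.eLpNorm_eq (h : IsFourier f F) : eLpNorm F 2 volume = eLpNorm f 2 volume := by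
  obtain ⟨hf, h⟩ := h
  rw [eLpNorm_congr_ae h, ← Lp.enorm_def, ← eLpNorm_congr_ae hf.coeFn_toLp, ← Lp.enorm_def,
    ← ofReal_norm, ← ofReal_norm, Lp.norm_fourier_eq]

theorem IsFourier.lintegral_eq (h : IsFourier f F) : ∫⁻ ξ, ‖F ξ‖ₑ ^ 2 = ∫⁻ x, ‖f x‖ₑ ^ 2 := by
  have := h.eLpNorm_eq
  rw [eLpNorm_eq_lintegral_rpow_enorm_toReal (by norm_num) (by norm_num),
    eLpNorm_eq_lintegral_rpow_enorm_toReal (by norm_num) (by norm_num)] at this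
  have h2 := ENNReal.rpow_left_injective (x := 1 / (2 : ENNReal).toReal) (by norm_num) this
  simpa using h2

theorem IsFourier.sub (h₁ : IsFourier f₁ F₁) (h₂ : IsFourier f₂ F₂) :
    IsFourier (fun x => f₁ x - f₂ x) (fun x => F₁ x - F₂ x) := by
  obtain ⟨m₁, e₁⟩ := h₁
  obtain ⟨m₂, e₂⟩ := h₂
  refine ⟨m₁.sub m₂, ?_⟩
  have h3 : (m₁.sub m₂).toLp (fun x => f₁ x - f₂ x) = m₁.toLp f₁ - m₂.toLp f₂ :=
    MemLp.toLp_sub m₁ m₂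
  have h4 : 𝓕 (m₁.toLp f₁ - m₂.toLp f₂) = 𝓕 (m₁.toLp f₁) - 𝓕 (m₂.toLp f₂) :=
    map_sub (Lp.fourierTransformₗᵢ ℝ ℂ) _ _
  rw [h3, h4]
  filter_upwards [e₁, e₂, Lp.coeFn_sub (𝓕 (m₁.toLp f₁)) (𝓕 (m₂.toLp f₂))] with x h1 h2 h3
  rw [h3, Pi.sub_apply, h1, h2]

theorem IsFourier.ae_eq_left (h₁ : IsFourier f₁ F₁) (h₂ : IsFourier f₂ F₂)
    (h : F₁ =ᵐ[volume] F₂) : f₁ =ᵐ[volume] f₂ := by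
  obtain ⟨m₁, e₁⟩ := h₁
  obtain ⟨m₂, e₂⟩ := h₂
  have h3 : 𝓕 (m₁.toLp f₁) = 𝓕 (m₂.toLp f₂) := Lp.ext (e₁.symm.trans (h.trans e₂))
  have h4 : m₁.toLp f₁ = m₂.toLp f₂ := (Lp.fourierTransformₗᵢ ℝ ℂ).injective h3
  exact (MemLp.toLp_eq_toLp_iff m₁ m₂).1 h4

/-- The multiplication formula applied to the inverse transform of α, whose transform is α again. -/
theorem IsFourier.integral_mul (h : IsFourier f F) (hα : ContDiff ℝ ∞ α)
    (hs : HasCompactSupport α) : ∫ x, f x * α x = ∫ ξ, F ξ * invFT α ξ := by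
  obtain ⟨m, e⟩ := h
  have h1 := integral_fourier_mul_schwartz (m.toLp f) (𝓕⁻ (hs.toSchwartzMap hα))
  rw [FourierTransform.fourier_fourierInv_eq] at h1
  have h2 : ⇑(𝓕⁻ (hs.toSchwartzMap hα) : SchwartzMap ℝ ℂ) = invFT α := by
    rw [SchwartzMap.fourierInv_coe, invFT_eq]
    rfl
  rw [h2] at h1
  refine Eq.trans ?_ (h1.symm.trans ?_)
  · refine integral_congr_ae ?_
    filter_upwards [m.coeFn_toLp] with x hx
    rw [hx]
    rfl
  · refine integral_congr_ae ?_
    filter_upwards [e] with x hx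
    rw [hx]

theorem memLp_invFT (hα : ContDiff ℝ ∞ α) (hs : HasCompactSupport α) : MemLp (invFT α) 2 volume := by
  have h2 : ⇑(𝓕⁻ (hs.toSchwartzMap hα) : SchwartzMap ℝ ℂ) = invFT α := by
    rw [SchwartzMap.fourierInv_coe, invFT_eq]
    rfl
  rw [← h2]
  exact SchwartzMap.memLp _ _ _

theorem IsFourier.integrable_left (h : IsFourier f F) (hα : ContDiff ℝ ∞ α)
    (hs : HasCompactSupport α) : Integrable (fun x => f x * α x) :=
  h.memLp_left.integrable_mul (q := 2) (hα.continuous.memLp_of_hasCompactSupport hs)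

theorem norm_invFT_le (α : ℝ → ℂ) (ξ : ℝ) : ‖invFT α ξ‖ ≤ ∫ x, ‖α x‖ := by
  refine (norm_integral_le_integral_norm _).trans (le_of_eq ?_)
  refine integral_congr_ae (Eventually.of_forall fun x => ?_)
  have : Complex.I * ((2 * Real.pi * ξ : ℝ) : ℂ) * x = ((2 * Real.pi * ξ * x : ℝ) : ℂ) * Complex.I := by
    push_cast; ring
  simp only [norm_mul, this, Complex.norm_exp_ofReal_mul_I, one_mul]

theorem invFT_deriv (hα : ContDiff ℝ ∞ α) (hs : HasCompactSupport α) (ξ : ℝ) :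
    invFT (deriv α) ξ = -(Complex.I * ((2 * Real.pi * ξ : ℝ) : ℂ)) * invFT α ξ := by
  have hd : Continuous (deriv α) := hα.continuous_deriv (by simp)
  have hsd : HasCompactSupport (deriv α) := hs.deriv
  have hu : ∀ x : ℝ, HasDerivAt (fun x : ℝ => Complex.exp (Complex.I * ((2 * Real.pi * ξ : ℝ) : ℂ) * x))
      (Complex.I * ((2 * Real.pi * ξ : ℝ) : ℂ) *
        Complex.exp (Complex.I * ((2 * Real.pi * ξ : ℝ) : ℂ) * x)) x := by
    intro x
    have h1 : HasDerivAt (fun x : ℝ => Complex.I * ((2 * Real.pi * ξ : ℝ) : ℂ) * (x : ℂ))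
        (Complex.I * ((2 * Real.pi * ξ : ℝ) : ℂ) * 1) x :=
      (HasDerivAt.ofReal_comp (hasDerivAt_id x)).const_mul _
    convert! h1.cexp using 1
    ring
  have hcu : Continuous fun x : ℝ => Complex.exp (Complex.I * ((2 * Real.pi * ξ : ℝ) : ℂ) * x) := by
    fun_prop
  have h := integral_mul_deriv_eq_deriv_mul_of_integrable (v := α) (v' := deriv α)
    (fun x _ => hu x) (fun x _ => (hα.differentiable (by simp) x).hasDerivAt)
    ((hcu.mul hd).integrable_of_hasCompactSupport hsd.mul_left)
    (((continuous_const.mul hcu).mul hα.continuous).integrable_of_hasCompactSupport hs.mul_left)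
    ((hcu.mul hα.continuous).integrable_of_hasCompactSupport hs.mul_left)
  rw [invFT, h, invFT, neg_mul, ← integral_const_mul]
  congr 2
  ext x
  ring

/-- With c = B(y), this turns the shear into multiplication by a phase. -/
theorem invFT_translate (α : ℝ → ℂ) (c ξ : ℝ) : invFT (fun x => α (x - c)) ξ =
    Complex.exp (Complex.I * ((2 * Real.pi * ξ : ℝ) : ℂ) * c) * invFT α ξ := by
  rw [invFT, ← integral_add_right_eq_self _ c, invFT, ← integral_const_mul]
  refine integral_congr_ae (Eventually.of_forall fun x => ?_)
  simp only [add_sub_cancel_right]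
  rw [← mul_assoc, ← Complex.exp_add]
  congr 2
  push_cast
  ring

end HarmExt
end

/-! ### Test functions and their transforms in x -/

noncomputable section
namespace HarmExt

variable {R : EReal} {v : ℝ → ℝ → ℂ}

theorem IsTest.hasDerivAt_fst (hv : IsTest R v) (x y : ℝ) :
    HasDerivAt (fun s => v s y) (fderiv ℝ (Function.uncurry v) (x, y) (1, 0)) x := by
  have h1 : HasFDerivAt (Function.uncurry v) (fderiv ℝ (Function.uncurry v) (x, y)) (x, y) :=
    (hv.smooth.differentiable (by simp) (x, y)).hasFDerivAt
  exact h1.comp_hasDerivAt (f := fun s => (s, y)) x ((hasDerivAt_id x).prodMk (hasDerivAt_const x y))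

theorem IsTest.hasDerivAt_snd (hv : IsTest R v) (x y : ℝ) :
    HasDerivAt (fun t => v x t) (fderiv ℝ (Function.uncurry v) (x, y) (0, 1)) y := by
  have h1 : HasFDerivAt (Function.uncurry v) (fderiv ℝ (Function.uncurry v) (x, y)) (x, y) :=
    (hv.smooth.differentiable (by simp) (x, y)).hasFDerivAt
  exact h1.comp_hasDerivAt (f := fun t => (x, t)) y ((hasDerivAt_const y x).prodMk (hasDerivAt_id y))

theorem isTest_fderiv_apply (hv : IsTest R v) (w : ℝ × ℝ) {d : ℝ → ℝ → ℂ}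
    (hd : Function.uncurry d = fun q => fderiv ℝ (Function.uncurry v) q w) : IsTest R d := by
  refine ⟨?_, ?_, ?_⟩
  · rw [hd]
    exact (hv.smooth.fderiv_right (m := ∞) (by simp)).clm_apply contDiff_const
  · rw [hd]
    exact hv.compact.fderiv_apply ℝ w
  · rw [hd]
    exact (tsupport_fderiv_apply_subset ℝ w).trans hv.support

theorem isTest_dx (hv : IsTest R v) : IsTest R (dx v) :=
  isTest_fderiv_apply hv (1, 0) (funext fun q => (hv.hasDerivAt_fst q.1 q.2).deriv)

theorem isTest_dy (hv : IsTest R v) : IsTest R (dy v) :=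
  isTest_fderiv_apply hv (0, 1) (funext fun q => (hv.hasDerivAt_snd q.1 q.2).deriv)

theorem IsTest.contDiff_slice (hv : IsTest R v) (y : ℝ) : ContDiff ℝ ∞ fun x => v x y :=
  hv.smooth.comp (contDiff_id.prodMk contDiff_const)

theorem tsupport_dx_subset (hv : IsTest R v) :
    tsupport (Function.uncurry (dx v)) ⊆ tsupport (Function.uncurry v) := by
  have : Function.uncurry (dx v) = fun q => fderiv ℝ (Function.uncurry v) q (1, 0) :=
    funext fun q => (hv.hasDerivAt_fst q.1 q.2).deriv
  rw [this]
  exact tsupport_fderiv_apply_subset ℝ (1, 0)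

theorem tsupport_dy_subset (hv : IsTest R v) :
    tsupport (Function.uncurry (dy v)) ⊆ tsupport (Function.uncurry v) := by
  have : Function.uncurry (dy v) = fun q => fderiv ℝ (Function.uncurry v) q (0, 1) :=
    funext fun q => (hv.hasDerivAt_snd q.1 q.2).deriv
  rw [this]
  exact tsupport_fderiv_apply_subset ℝ (0, 1)

theorem IsTest.exists_support (hR : 0 < R) (hv : IsTest R v) :
    ∃ K s T : ℝ, 0 < s ∧ s ≤ T ∧ T ∈ openDom R ∧
      tsupport (Function.uncurry v) ⊆ Icc (-K) K ×ˢ Icc s T := by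
  have hc : IsCompact (tsupport (Function.uncurry v)) := hv.compact
  obtain ⟨K, hK⟩ := (hc.image continuous_fst).isBounded.exists_norm_le
  have h0 : (0 : ℝ) ∈ dom R := ⟨le_rfl, by exact_mod_cast hR⟩
  obtain ⟨T₀, hT₀, -⟩ := exists_between_dom h0
  -- The extra point T₀ of (0, R) keeps the set nonempty when v = 0, so that its infimum and
  -- supremum are attained.
  have hc2 : IsCompact (insert T₀ (Prod.snd '' tsupport (Function.uncurry v))) :=
    (hc.image continuous_snd).insert T₀
  have hne : (insert T₀ (Prod.snd '' tsupport (Function.uncurry v))).Nonempty := insert_nonempty _ _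
  have hsub : insert T₀ (Prod.snd '' tsupport (Function.uncurry v)) ⊆ openDom R := by
    refine insert_subset hT₀ ?_
    rintro _ ⟨q, hq, rfl⟩
    exact (hv.support hq).2
  have hsI := hc2.sInf_mem hne
  have hsS := hc2.sSup_mem hne
  refine ⟨K, _, _, (hsub hsI).1, csInf_le hc2.bddBelow hsS, hsub hsS, fun q hm => ?_⟩
  refine ⟨abs_le.1 (hK q.1 ⟨_, hm, rfl⟩), ?_, ?_⟩
  · exact csInf_le hc2.bddBelow (mem_insert_of_mem _ ⟨_, hm, rfl⟩)
  · exact le_csSup hc2.bddAbove (mem_insert_of_mem _ ⟨_, hm, rfl⟩)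

theorem eq_zero_of_tsupport_subset {A B : Set ℝ} (h : tsupport (Function.uncurry v) ⊆ A ×ˢ B)
    {x y : ℝ} (hxy : x ∉ A ∨ y ∉ B) : v x y = 0 := by
  by_contra hne
  have := h (subset_tsupport (Function.uncurry v) (show (x, y) ∈ Function.support _ from hne))
  exact hxy.elim (fun h => h this.1) (fun h => h this.2)

theorem IsTest.hasCompactSupport_slice (hv : IsTest R v) (y : ℝ) :
    HasCompactSupport fun x => v x y := by
  refine HasCompactSupport.intro (hv.compact.image continuous_fst) fun x hx => ?_
  by_contra h
  exact hx ⟨(x, y), subset_tsupport _ h, rfl⟩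

theorem IsTest.exists_bound (hv : IsTest R v) : ∃ C, ∀ x y, ‖v x y‖ ≤ C := by
  obtain ⟨C, hC⟩ := hv.compact.exists_bound_of_continuous hv.smooth.continuous
  exact ⟨C, fun x y => hC (x, y)⟩

theorem IsTest.continuous (hv : IsTest R v) : Continuous (Function.uncurry v) := hv.smooth.continuous

theorem IsTest.exists_bound_invFT (hR : 0 < R) (hv : IsTest R v) :
    ∃ C, 0 ≤ C ∧ ∀ ξ y, ‖invFT (fun x => v x y) ξ‖ ≤ C := by
  obtain ⟨C, hC⟩ := hv.exists_bound
  obtain ⟨K, s, T, -, -, -, hK⟩ := hv.exists_support hR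
  have hC0 : 0 ≤ C := (norm_nonneg _).trans (hC 0 0)
  refine ⟨∫ x in Icc (-K) K, C, integral_nonneg fun _ => hC0, fun ξ y => ?_⟩
  refine (norm_invFT_le _ ξ).trans ?_
  rw [← integral_indicator measurableSet_Icc]
  refine integral_mono ((hv.contDiff_slice y).continuous.norm.integrable_of_hasCompactSupport
    (hv.hasCompactSupport_slice y).norm) ((integrable_indicator_iff measurableSet_Icc).2
      (integrable_const C : Integrable _ (volume.restrict (Icc (-K) K)))) fun x => ?_
  by_cases hx : x ∈ Icc (-K) K
  · rw [indicator_of_mem hx]; exact hC x y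
  · have : v x y = 0 := eq_zero_of_tsupport_subset hK (Or.inl hx)
    simp [this, indicator_of_notMem hx]

theorem IsTest.invFT_dx (hv : IsTest R v) (ξ y : ℝ) : invFT (fun x => dx v x y) ξ =
    -(Complex.I * ((2 * Real.pi * ξ : ℝ) : ℂ)) * invFT (fun x => v x y) ξ :=
  invFT_deriv (hv.contDiff_slice y) (hv.hasCompactSupport_slice y) ξ

theorem IsTest.invFT_dx_dx (hv : IsTest R v) (ξ y : ℝ) : invFT (fun x => dx (dx v) x y) ξ =
    -((2 * Real.pi * ξ : ℝ) : ℂ) ^ 2 * invFT (fun x => v x y) ξ := by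
  rw [(isTest_dx hv).invFT_dx, hv.invFT_dx]
  linear_combination ((2 * Real.pi * ξ : ℝ) : ℂ) ^ 2 * invFT (fun x => v x y) ξ * Complex.I_sq

/-- Two x-derivatives give quadratic decay, uniformly in y. The bound lies in L¹ and in L², which is
what the applications of Fubini require. -/
theorem IsTest.exists_decay (hR : 0 < R) (hv : IsTest R v) :
    ∃ C, 0 ≤ C ∧ ∀ ξ y, ‖invFT (fun x => v x y) ξ‖ ≤ C * (1 + ξ ^ 2)⁻¹ := by
  obtain ⟨C₀, h00, h0⟩ := hv.exists_bound_invFT hR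
  obtain ⟨C₂, h02, h2⟩ := (isTest_dx (isTest_dx hv)).exists_bound_invFT hR
  refine ⟨C₀ + C₂, by positivity, fun ξ y => ?_⟩
  rw [← div_eq_mul_inv, le_div_iff₀ (by positivity)]
  have e0 := h0 ξ y
  have e2 := h2 ξ y
  rw [hv.invFT_dx_dx, norm_mul, norm_neg, norm_pow, Complex.norm_real, Real.norm_eq_abs, sq_abs] at e2
  have h3 : ξ ^ 2 ≤ (2 * Real.pi * ξ) ^ 2 := by
    have : 1 ≤ (2 * Real.pi) ^ 2 := by nlinarith [Real.pi_gt_three]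
    rw [mul_pow]
    nlinarith [sq_nonneg ξ]
  have h4 := mul_le_mul_of_nonneg_right h3 (norm_nonneg (invFT (fun x => v x y) ξ))
  linarith

theorem IsTest.stronglyMeasurable_invFT (hv : IsTest R v) :
    StronglyMeasurable (Function.uncurry fun ξ y => invFT (fun x => v x y) ξ) := by
  refine StronglyMeasurable.integral_prod_right (f := fun (q : ℝ × ℝ) (x : ℝ) =>
    Complex.exp (Complex.I * ((2 * Real.pi * q.1 : ℝ) : ℂ) * x) * v x q.2) ?_
  refine Continuous.stronglyMeasurable ?_
  have h1 : Continuous fun p : (ℝ × ℝ) × ℝ => v p.2 p.1.2 :=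
    hv.continuous.comp (continuous_snd.prodMk (continuous_snd.comp continuous_fst))
  have h2 : Continuous fun p : (ℝ × ℝ) × ℝ =>
    Complex.exp (Complex.I * ((2 * Real.pi * p.1.1 : ℝ) : ℂ) * p.2) := by fun_prop
  exact h2.mul h1

theorem invFT_eq_zero_of_tsupport_subset {A B : Set ℝ}
    (h : tsupport (Function.uncurry v) ⊆ A ×ˢ B) (ξ : ℝ) {y : ℝ} (hy : y ∉ B) :
    invFT (fun x => v x y) ξ = 0 := by
  have : ∀ x, v x y = 0 := fun x => eq_zero_of_tsupport_subset h (Or.inr hy)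
  simp [invFT, this]

/-- Differentiation under the integral, dominated by a constant on a fixed interval that contains
all x-supports. -/
theorem IsTest.hasDerivAt_invFT (hR : 0 < R) (hv : IsTest R v) (ξ y : ℝ) :
    HasDerivAt (fun y => invFT (fun x => v x y) ξ) (invFT (fun x => dy v x y) ξ) y := by
  obtain ⟨C, hC⟩ := (isTest_dy hv).exists_bound
  obtain ⟨K, s, T, -, -, -, hK⟩ := (isTest_dy hv).exists_support hR
  have hC0 : 0 ≤ C := (norm_nonneg _).trans (hC 0 0)
  have hexp : ∀ x : ℝ, ‖Complex.exp (Complex.I * ((2 * Real.pi * ξ : ℝ) : ℂ) * x)‖ = 1 := by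
    intro x
    have : Complex.I * ((2 * Real.pi * ξ : ℝ) : ℂ) * x =
        ((2 * Real.pi * ξ * x : ℝ) : ℂ) * Complex.I := by push_cast; ring
    rw [this, Complex.norm_exp_ofReal_mul_I]
  have hce : Continuous fun x : ℝ => Complex.exp (Complex.I * ((2 * Real.pi * ξ : ℝ) : ℂ) * x) := by
    fun_prop
  refine (hasDerivAt_integral_of_dominated_loc_of_deriv_le (μ := volume) (s := univ)
    (F := fun y x => Complex.exp (Complex.I * ((2 * Real.pi * ξ : ℝ) : ℂ) * x) * v x y)
    (F' := fun y x => Complex.exp (Complex.I * ((2 * Real.pi * ξ : ℝ) : ℂ) * x) * dy v x y)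
    (bound := (Icc (-K) K).indicator fun _ => C) univ_mem ?_ ?_ ?_ ?_ ?_ ?_).2
  · exact Eventually.of_forall fun y =>
      (hce.mul (hv.contDiff_slice y).continuous).aestronglyMeasurable
  · exact (hce.mul (hv.contDiff_slice y).continuous).integrable_of_hasCompactSupport
      (hv.hasCompactSupport_slice y).mul_left
  · exact (hce.mul ((isTest_dy hv).contDiff_slice y).continuous).aestronglyMeasurable
  · refine Eventually.of_forall fun x y _ => ?_
    rw [norm_mul, hexp, one_mul]
    by_cases hx : x ∈ Icc (-K) K
    · rw [indicator_of_mem hx]; exact hC x y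
    · have : dy v x y = 0 := eq_zero_of_tsupport_subset hK (Or.inl hx)
      simp [this, indicator_of_notMem hx]
  · exact (integrable_indicator_iff measurableSet_Icc).2
      (integrable_const C : Integrable _ (volume.restrict (Icc (-K) K)))
  · refine Eventually.of_forall fun x y _ => ?_
    have h1 := hv.hasDerivAt_snd x y
    have h2 : dy v x y = fderiv ℝ (Function.uncurry v) (x, y) (0, 1) := h1.deriv
    rw [h2]
    exact h1.const_mul _

theorem IsTest.continuous_invFT (hR : 0 < R) (hv : IsTest R v) (ξ : ℝ) :
    Continuous fun y => invFT (fun x => v x y) ξ :=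
  continuous_iff_continuousAt.2 fun y => (hv.hasDerivAt_invFT hR ξ y).continuousAt

theorem IsTest.invFT_eq_integral (hR : 0 < R) (hv : IsTest R v) (ξ s t : ℝ) :
    invFT (fun x => v x t) ξ =
      invFT (fun x => v x s) ξ + ∫ r in s..t, invFT (fun x => dy v x r) ξ := by
  rw [intervalIntegral.integral_eq_sub_of_hasDerivAt
    (fun y _ => hv.hasDerivAt_invFT hR ξ y)
    (((isTest_dy hv).continuous_invFT hR ξ).intervalIntegrable _ _)]
  ring

end HarmExt
end

/-! ### The equation at one frequency, tested against functions of y -/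

noncomputable section
namespace HarmExt

variable {a : Measure ℝ} {b : ℝ → ℝ} {ξ s t T : ℝ} {φ ψ : ℝ → ℂ}

theorem integrableOn_mul_of_continuousOn {μ : Measure ℝ} {f g : ℝ → ℂ}
    (hf : ContinuousOn f (Icc s T)) (hg : IntegrableOn g (Icc s T) μ) :
    IntegrableOn (fun r => f r * g r) (Icc s T) μ := by
  obtain ⟨D, hD⟩ := isCompact_Icc.exists_bound_of_continuousOn hf
  refine Integrable.bdd_mul (c := D) hg (hf.aestronglyMeasurable measurableSet_Icc) ?_
  filter_upwards [ae_restrict_mem measurableSet_Icc] with r hr using hD r hr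

/-- The product of two absolutely continuous functions. -/
theorem mul_eq_integral {f f' g g' : ℝ → ℂ} (hf' : IntegrableOn f' (Icc s T))
    (hf : ∀ u ∈ Icc s T, f u = f s + ∫ r in s..u, f' r) (hg' : IntegrableOn g' (Icc s T))
    (hg : ∀ u ∈ Icc s T, g u = g s + ∫ r in s..u, g' r) :
    IntegrableOn (fun r => f' r * g r + f r * g' r) (Icc s T) ∧
    ∀ u ∈ Icc s T, f u * g u = f s * g s + ∫ r in s..u, (f' r * g r + f r * g' r) := by
  have i1 : IntegrableOn (fun r => f' r * g r) (Icc s T) :=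
    (integrableOn_mul_of_continuousOn (continuousOn_of_eq_integral hg' hg) hf').congr
      (Eventually.of_forall fun r => mul_comm _ _)
  have i2 : IntegrableOn (fun r => f r * g' r) (Icc s T) :=
    integrableOn_mul_of_continuousOn (continuousOn_of_eq_integral hf' hf) hg'
  refine ⟨i1.add i2, fun u hu => ?_⟩
  have hsub : Icc s u ⊆ Icc s T := Icc_subset_Icc_right hu.2
  have key := mul_sub_mul_eq (μ := 0) (φ := f) (φ' := f') (F := g) (f := fun _ => 0) (k := g') hu.1
    (by simp) (hf'.mono_set hsub) (fun x hx => hf x (hsub hx)) (by simp) (hg'.mono_set hsub)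
    (fun x hx => by rw [hg x (hsub hx)]; simp)
  have hss : s ∈ Icc s T := ⟨le_rfl, hu.1.trans hu.2⟩
  rw [intervalIntegral.integral_add (intervalIntegrable_of_Icc i1 hss hu)
    (intervalIntegrable_of_Icc i2 hss hu)]
  simp only [mul_zero, integral_zero, add_zero] at key
  linear_combination key

theorem setIntegral_Icc_eq {μ : Measure ℝ} {h : ℝ → ℂ} {T' : ℝ} (hs : 0 < s) (hT : T < T')
    (h0 : ∀ y, y ∉ Icc s T → h y = 0) : ∫ y in Ico 0 T', h y ∂μ = ∫ y in Icc s T, h y ∂μ :=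
  setIntegral_eq_of_subset_of_forall_sdiff_eq_zero measurableSet_Ico
    (fun _ hy => ⟨hs.le.trans hy.1, hy.2.trans_lt hT⟩) fun y hy => h0 y hy.2

theorem intervalIntegral_eq_Icc {h : ℝ → ℂ} {T' : ℝ} (hs : 0 < s) (hsT : s ≤ T) (hT : T < T')
    (h0 : ∀ y, y ∉ Icc s T → h y = 0) : ∫ y in (0 : ℝ)..T', h y = ∫ y in Icc s T, h y := by
  rw [intervalIntegral.integral_of_le (hs.le.trans (hsT.trans hT.le)), ← integral_Ico_eq_integral_Ioc,
    setIntegral_Icc_eq hs hT h0]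

theorem setIntegral_openDom_eq {R : EReal} {μ : Measure ℝ} {h : ℝ → ℂ} (hs : 0 < s)
    (hT : T ∈ openDom R) (h0 : ∀ y, y ∉ Icc s T → h y = 0) :
    ∫ y in openDom R, h y ∂μ = ∫ y in Icc s T, h y ∂μ :=
  setIntegral_eq_of_subset_of_forall_sdiff_eq_zero (measurableSet_openDom R)
    (Icc_subset_openDom hs (openDom_subset_dom _ hT)) fun y hy => h0 y hy.2

/-- The weak form of the equation for `φ`. -/
theorem IsSol.weak_form {T' : ℝ} (hc : Coeff a b 0 T') (h : IsSol a b ξ 0 T' φ ψ) (hs : 0 < s)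
    (hsT : s ≤ T) (hT : T < T') {β β' β'' : ℝ → ℂ} (hβ' : Continuous β') (hβ'' : Continuous β'')
    (e1 : ∀ t, β t = β 0 + ∫ r in (0 : ℝ)..t, β' r) (e2 : ∀ t, β' t = β' 0 + ∫ r in (0 : ℝ)..t, β'' r)
    (h0 : ∀ y, y ∉ Icc s T → β y = 0) (h1 : ∀ y, y ∉ Icc s T → β' y = 0)
    (h2 : ∀ y, y ∉ Icc s T → β'' y = 0) :
    ∫ y in Icc s T, β'' y * φ y = (ξ : ℂ) ^ 2 * (∫ y in Icc s T, β y * φ y ∂a) -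
      2 * Complex.I * ξ * ∫ y in Icc s T, β y * (b y * ψ y) := by
  have n0 : (0 : ℝ) ∉ Icc s T := fun h => absurd h.1 (not_le.2 hs)
  have nT : T' ∉ Icc s T := fun h => absurd h.2 (not_le.2 hT)
  have hT0 : 0 ≤ T' := hs.le.trans (hsT.trans hT.le)
  -- Two integrations by parts, for β'φ and then for βψ. On [0, T'] the boundary terms vanish, and
  -- since T < T' the set [0, T') does not lose an atom of a at T.
  have k1 := (mul_eq_integral (f := β') (hβ''.integrableOn_Icc) (fun u _ => e2 u) h.int_deriv
    h.eq).2 T' ⟨hT0, le_rfl⟩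
  have k2 := mul_sub_mul_eq (μ := a) (φ := β) (φ' := β') (F := ψ) (f := fun r => (ξ : ℂ) ^ 2 * φ r)
    (k := fun r => - (2 * Complex.I * ξ) * (b r * ψ r)) hT0
    ((measure_mono Ico_subset_Icc_self).trans_lt hc.finite)
    hβ'.integrableOn_Icc (fun u _ => e1 u)
    ((integrableOn_of_continuousOn hc.finite h.continuousOn).const_mul _)
    (h.int_mul_deriv.const_mul _) (by
      intro u hu
      rw [h.deriv_eq u hu, integral_const_mul, intervalIntegral.integral_const_mul]
      ring)
  rw [h0 0 n0, h0 T' nT] at k2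
  rw [h1 0 n0, h1 T' nT] at k1
  have hss : (0 : ℝ) ∈ Icc 0 T' := ⟨le_rfl, hT0⟩
  have hTT : T' ∈ Icc 0 T' := ⟨hT0, le_rfl⟩
  rw [intervalIntegral.integral_add (by
      refine intervalIntegrable_of_Icc ?_ hss hTT
      exact integrableOn_mul_of_continuousOn hβ''.continuousOn
        (h.continuousOn.integrableOn_Icc)) (by
      refine intervalIntegrable_of_Icc ?_ hss hTT
      exact integrableOn_mul_of_continuousOn hβ'.continuousOn h.int_deriv)] at k1
  rw [← intervalIntegral_eq_Icc hs hsT hT (h := fun y => β'' y * φ y)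
      (fun y hy => by simp [h2 y hy]),
    ← intervalIntegral_eq_Icc hs hsT hT (h := fun y => β y * (b y * ψ y))
      (fun y hy => by simp [h0 y hy]),
    ← setIntegral_Icc_eq hs hT (h := fun y => β y * φ y) (fun y hy => by simp [h0 y hy])]
  have e3 : ∀ r, β r * ((ξ : ℂ) ^ 2 * φ r) = (ξ : ℂ) ^ 2 * (β r * φ r) := fun r => by ring
  have e4 : ∀ r, β r * (-(2 * Complex.I * ξ) * (b r * ψ r)) =
    -(2 * Complex.I * ξ) * (β r * (b r * ψ r)) := fun r => by ring
  simp only [e3, e4, integral_const_mul, intervalIntegral.integral_const_mul] at k2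
  linear_combination k2 - k1

variable {L : OpL}

/-- The product rule. This is the shear at frequency ξ, and its derivative has the modulus that the
energy inequality controls. -/
theorem OpL.exp_mul_isSol {T : ℝ} (hT : T ∈ dom L.R) (h : IsSol L.a L.b ξ 0 T φ ψ) :
    IntegrableOn (fun r => Complex.exp (Complex.I * ξ * L.Bdom r) *
        (ψ r + Complex.I * ξ * L.b r * φ r)) (Icc 0 T) ∧
    ∀ u ∈ Icc 0 T, Complex.exp (Complex.I * ξ * L.Bdom u) * φ u =
      Complex.exp (Complex.I * ξ * L.Bdom 0) * φ 0 +
      ∫ r in (0 : ℝ)..u, Complex.exp (Complex.I * ξ * L.Bdom r) *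
        (ψ r + Complex.I * ξ * L.b r * φ r) := by
  have hB0 : L.Bdom 0 = 0 := by
    rw [OpL.Bdom, indicator_of_mem (Icc_subset_dom hT ⟨le_rfl, hT.1⟩), OpL.B,
      intervalIntegral.integral_same]
  have hcB : ContinuousOn L.Bdom (Icc 0 T) :=
    (L.continuousOn_B.mono (Icc_subset_dom hT)).congr fun y hy => by
      rw [OpL.Bdom, indicator_of_mem (Icc_subset_dom hT hy)]
  have hce : ContinuousOn (fun r => Complex.exp (Complex.I * ξ * L.Bdom r)) (Icc 0 T) := by
    fun_prop
  have hi : IntegrableOn (fun r => Complex.I * ξ * L.b r * Complex.exp (Complex.I * ξ * L.Bdom r))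
      (Icc 0 T) := by
    simp only [mul_comm _ (Complex.exp _)]
    exact integrableOn_mul_of_continuousOn hce ((L.coeff hT).integrableOn.ofReal.const_mul _)
  have hE := exp_mul_B_eq L hT (Complex.I * ξ)
  have := mul_eq_integral (f := fun r => Complex.exp (Complex.I * ξ * L.Bdom r)) hi
    (fun u hu => by rw [hE u hu, hB0]; simp) h.int_deriv h.eq
  have e : ∀ r, Complex.I * ξ * L.b r * Complex.exp (Complex.I * ξ * L.Bdom r) * φ r +
      Complex.exp (Complex.I * ξ * L.Bdom r) * ψ r = Complex.exp (Complex.I * ξ * L.Bdom r) *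
        (ψ r + Complex.I * ξ * L.b r * φ r) := fun r => by ring
  simpa only [e] using this

theorem OpL.weak_deriv_form {T' : ℝ} (hT' : T' ∈ dom L.R) (h : IsSol L.a L.b ξ 0 T' φ ψ)
    (hs : 0 < s) (hsT : s ≤ T) (hT : T < T') {β β' : ℝ → ℂ} (hβ' : Continuous β')
    (e1 : ∀ t, β t = β 0 + ∫ r in (0 : ℝ)..t, β' r)
    (h0 : ∀ y, y ∉ Icc s T → β y = 0) (h1 : ∀ y, y ∉ Icc s T → β' y = 0) :
    ∫ y in Icc s T, β y * (Complex.exp (Complex.I * ξ * L.Bdom y) *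
      (ψ y + Complex.I * ξ * L.b y * φ y)) =
    -∫ y in Icc s T, β' y * (Complex.exp (Complex.I * ξ * L.Bdom y) * φ y) := by
  have n0 : (0 : ℝ) ∉ Icc s T := fun h => absurd h.1 (not_le.2 hs)
  have nT : T' ∉ Icc s T := fun h => absurd h.2 (not_le.2 hT)
  have hT0 : 0 ≤ T' := hs.le.trans (hsT.trans hT.le)
  have hss : (0 : ℝ) ∈ Icc 0 T' := ⟨le_rfl, hT0⟩
  have hTT : T' ∈ Icc 0 T' := ⟨hT0, le_rfl⟩
  obtain ⟨i, e⟩ := L.exp_mul_isSol hT' h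
  have k := (mul_eq_integral (f := β) (g := fun r => Complex.exp (Complex.I * ξ * L.Bdom r) * φ r)
    hβ'.integrableOn_Icc (fun u _ => e1 u) i e).2 T' hTT
  have hc := continuousOn_of_eq_integral i e
  have hβ : ContinuousOn β (Icc 0 T') :=
    continuousOn_of_eq_integral (hβ'.integrableOn_Icc) fun u _ => e1 u
  rw [h0 0 n0, h0 T' nT, intervalIntegral.integral_add (by
      refine intervalIntegrable_of_Icc ?_ hss hTT
      exact integrableOn_mul_of_continuousOn hβ'.continuousOn
        (hc.integrableOn_Icc)) (by
      refine intervalIntegrable_of_Icc ?_ hss hTT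
      exact integrableOn_mul_of_continuousOn hβ i)] at k
  rw [← intervalIntegral_eq_Icc hs hsT hT (fun y hy => by simp [h0 y hy]),
    ← intervalIntegral_eq_Icc hs hsT hT (fun y hy => by simp [h1 y hy])]
  linear_combination -k

/-- The tangent bounds on [T, z] and [0, s], with |φ| ≤ 1, bound the flux above at T and below at s.
The result does not depend on ξ. -/
theorem IsSol.integral_sq_le_of_norm_le_one {z : ℝ} (hc : Coeff a b 0 z) (h : IsSol a b ξ 0 z φ ψ)
    (hs : 0 < s) (hsT : s ≤ T) (hT : T < z) (hb : ∀ y ∈ Icc 0 z, ‖φ y‖ ≤ 1) :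
    ∫ r in Icc s T, ‖ψ r + Complex.I * ξ * b r * φ r‖ ^ 2 ≤ 1 / (z - T) + 1 / s := by
  have h1 := (h.mono hc.finite hs.le hsT hT.le).integral_sq_le hsT (hc.mono hs.le hT.le)
  have hT0 : 0 ≤ T := hs.le.trans hsT
  have h2 := (h.mono hc.finite hT0 hT.le le_rfl).le_norm_sq_sub hT.le (hc.mono hT0 le_rfl)
  have hsz : s ≤ z := hsT.trans hT.le
  have h3 := (h.mono hc.finite le_rfl hs.le hsz).norm_sq_sub_le hs.le (hc.mono le_rfl hsz)
  have hz0 : 0 ≤ z := hT0.trans hT.le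
  have b1 : ‖φ z‖ ^ 2 ≤ 1 := pow_le_one₀ (norm_nonneg _) (hb z ⟨hz0, le_rfl⟩)
  have b2 : ‖φ 0‖ ^ 2 ≤ 1 := pow_le_one₀ (norm_nonneg _) (hb 0 ⟨le_rfl, hz0⟩)
  have c1 : energyFlux φ ψ T ≤ 1 / (z - T) := by
    rw [le_div_iff₀ (sub_pos.2 hT)]
    nlinarith [sq_nonneg ‖φ T‖]
  have c2 : -(1 / s) ≤ energyFlux φ ψ s := by
    rw [neg_le, ← sub_nonneg]
    have : 0 ≤ (1 + energyFlux φ ψ s * s) / s :=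
      div_nonneg (by nlinarith [sq_nonneg ‖φ s‖]) hs.le
    have e : (1 + energyFlux φ ψ s * s) / s = 1 / s - -energyFlux φ ψ s := by field_simp; ring
    linarith
  rw [intervalIntegral.integral_of_le hsT, ← integral_Icc_eq_integral_Ioc] at h1
  linarith

end HarmExt
end

/-! ### The candidate solution on the Fourier side, and integrability -/

noncomputable section
namespace HarmExt

theorem IsFourier.integral_translate_mul {f F α : ℝ → ℂ} (h : IsFourier f F) (hα : ContDiff ℝ ∞ α)
    (hs : HasCompactSupport α) (c : ℝ) : ∫ x, f (x + c) * α x =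
      ∫ ξ, F ξ * (Complex.exp (Complex.I * ((2 * Real.pi * ξ : ℝ) : ℂ) * c) * invFT α ξ) := by
  rw [← integral_sub_right_eq_self _ c]
  have h1 : ContDiff ℝ ∞ fun x => α (x - c) := hα.comp (contDiff_id.sub contDiff_const)
  have h2 : HasCompactSupport fun x => α (x - c) := hs.comp_homeomorph (Homeomorph.subRight c)
  simp only [sub_add_cancel, ← invFT_translate]
  exact h.integral_mul h1 h2

theorem tendsto_eLpNorm_two_zero {ι : Type*} {l : Filter ι} {f : ι → ℝ → ℂ} {μ : Measure ℝ}
    (h : Tendsto (fun i => ∫⁻ x, ‖f i x‖ₑ ^ 2 ∂μ) l (𝓝 0)) :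
    Tendsto (fun i => eLpNorm (f i) 2 μ) l (𝓝 0) := by
  have h1 : ∀ i, eLpNorm (f i) 2 μ = (∫⁻ x, ‖f i x‖ₑ ^ 2 ∂μ) ^ (1 / (2 : ℝ)) := by
    intro i
    rw [eLpNorm_eq_lintegral_rpow_enorm_toReal (by norm_num) (by norm_num)]
    simp
  simp only [h1]
  have := (ENNReal.continuous_rpow_const (y := 1 / (2 : ℝ))).tendsto 0
  rw [ENNReal.zero_rpow_of_pos (by norm_num)] at this
  exact this.comp h

theorem memLp_two_iff_lintegral {α : Type*} [MeasurableSpace α] {μ : Measure α} {f : α → ℂ}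
    (hf : AEStronglyMeasurable f μ) : MemLp f 2 μ ↔ ∫⁻ x, ‖f x‖ₑ ^ 2 ∂μ < ⊤ := by
  rw [MemLp, and_iff_right hf, eLpNorm_lt_top_iff_lintegral_rpow_enorm_lt_top (by norm_num) (by norm_num)]
  simp

/-- The family of solutions of the equation, with its properties. -/
structure IsFamily (L : OpL) (φ ψ : ℝ → ℝ → ℂ) : Prop where
  measurable : Measurable (Function.uncurry φ)
  measurable_deriv : Measurable (Function.uncurry ψ)
  isSol : ∀ ξ, ∀ T ∈ dom L.R, IsSol L.a L.b ξ 0 T (φ ξ) (ψ ξ)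
  zero : ∀ ξ, φ ξ 0 = 1
  norm_le : ∀ ξ, ∀ y ∈ dom L.R, ‖φ ξ y‖ ≤ 1
  norm_sq_le : ∀ r : ℝ, L.R = (r : EReal) → ∀ ξ, ∀ y ∈ dom L.R, ‖φ ξ y‖ ^ 2 ≤ 1 - y / r

theorem OpL.exists_isFamily (L : OpL) : ∃ φ ψ, IsFamily L φ ψ := by
  obtain ⟨φ, ψ, h1, h2, h3, h4, h5, h6⟩ := L.exists_family
  exact ⟨φ, ψ, h1, h2, h3, h4, h5, h6⟩

variable {L : OpL} {φ ψ : ℝ → ℝ → ℂ} {F : ℝ → ℂ} {s T : ℝ}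

/-- The Fourier transform of the harmonic function. -/
def specU (F : ℝ → ℂ) (φ : ℝ → ℝ → ℂ) (η y : ℝ) : ℂ := F η * φ (2 * Real.pi * η) y

/-- The derivative of the sheared solution, up to a phase. -/
def OpL.specD (L : OpL) (φ ψ : ℝ → ℝ → ℂ) (η y : ℝ) : ℂ :=
  ψ (2 * Real.pi * η) y + Complex.I * ((2 * Real.pi * η : ℝ) : ℂ) * L.b y * φ (2 * Real.pi * η) y

/-- The phase `exp (i ξ B(y))`, with `ξ = 2 π η`. -/
def OpL.specE (L : OpL) (η y : ℝ) : ℂ :=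
  Complex.exp (Complex.I * ((2 * Real.pi * η : ℝ) : ℂ) * L.Bdom y)

theorem OpL.norm_specE (L : OpL) (η y : ℝ) : ‖L.specE η y‖ = 1 := by
  have : Complex.I * ((2 * Real.pi * η : ℝ) : ℂ) * L.Bdom y =
      ((2 * Real.pi * η * L.Bdom y : ℝ) : ℂ) * Complex.I := by push_cast; ring
  rw [OpL.specE, this, Complex.norm_exp_ofReal_mul_I]

theorem OpL.measurable_specE (L : OpL) : Measurable (Function.uncurry L.specE) := by
  have := L.measurable_Bdom
  simp only [OpL.specE, Function.uncurry_def]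
  fun_prop

/-- The Fourier transform of the derivative of the sheared harmonic function. -/
def OpL.specG (L : OpL) (F : ℝ → ℂ) (φ ψ : ℝ → ℝ → ℂ) (η y : ℝ) : ℂ :=
  F η * (L.specE η y * L.specD φ ψ η y)

theorem IsFamily.measurable_scaled (h : IsFamily L φ ψ) :
    Measurable fun q : ℝ × ℝ => φ (2 * Real.pi * q.1) q.2 :=
  h.measurable.comp (g := Function.uncurry φ) (f := fun q : ℝ × ℝ => (2 * Real.pi * q.1, q.2))
    (by fun_prop)

theorem IsFamily.measurable_deriv_scaled (h : IsFamily L φ ψ) :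
    Measurable fun q : ℝ × ℝ => ψ (2 * Real.pi * q.1) q.2 :=
  h.measurable_deriv.comp (g := Function.uncurry ψ) (f := fun q : ℝ × ℝ => (2 * Real.pi * q.1, q.2))
    (by fun_prop)

theorem IsFamily.measurable_specD (h : IsFamily L φ ψ) :
    Measurable (Function.uncurry (L.specD φ ψ)) := by
  have h1 := h.measurable_scaled
  have h2 := h.measurable_deriv_scaled
  have h3 : Measurable fun q : ℝ × ℝ => Complex.I * ((2 * Real.pi * q.1 : ℝ) : ℂ) * (L.b q.2 : ℂ) := by
    have := L.b_measurable
    fun_prop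
  exact h2.add (h3.mul h1)

theorem IsFamily.measurable_specU (h : IsFamily L φ ψ) (hF : Measurable F) :
    Measurable (Function.uncurry (specU F φ)) :=
  (hF.comp measurable_fst).mul h.measurable_scaled

theorem IsFamily.measurable_specG (h : IsFamily L φ ψ) (hF : Measurable F) :
    Measurable (Function.uncurry (L.specG F φ ψ)) :=
  (hF.comp measurable_fst).mul (L.measurable_specE.mul h.measurable_specD)

theorem IsFamily.memLp_specU (h : IsFamily L φ ψ) (hFm : Measurable F) (hF : MemLp F 2 volume) {y : ℝ}
    (hy : y ∈ dom L.R) : MemLp (fun η => specU F φ η y) 2 volume := by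
  refine hF.of_le ((h.measurable_specU hFm).comp
    (measurable_id.prodMk measurable_const)).aestronglyMeasurable (Eventually.of_forall fun η => ?_)
  simp only [specU]
  rw [norm_mul]
  exact mul_le_of_le_one_right (norm_nonneg _) (h.norm_le _ y hy)

/-- An auxiliary point z in (T, R) gives the energy bound. It is important that C does not depend on
the frequency. -/
theorem IsFamily.lintegral_specD_le (h : IsFamily L φ ψ) (hs : 0 < s) (hsT : s ≤ T)
    (hT : T ∈ openDom L.R) : ∃ C : ENNReal, C < ⊤ ∧ ∀ η,
      ∫⁻ y in Icc s T, ‖L.specD φ ψ η y‖ₑ ^ 2 ≤ C := by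
  obtain ⟨z, hz, hTz⟩ := exists_between_dom (openDom_subset_dom _ hT)
  have hzd := openDom_subset_dom _ hz
  refine ⟨ENNReal.ofReal (1 / (z - T) + 1 / s), ENNReal.ofReal_lt_top, fun η => ?_⟩
  have hsol := h.isSol (2 * Real.pi * η) z hzd
  have h1 := hsol.integral_sq_le_of_norm_le_one (L.coeff hzd) hs hsT hTz
    (fun y hy => h.norm_le _ y (Icc_subset_dom hzd hy))
  have h2 := (hsol.integrableOn_sq (L.coeff hzd)).mono_set (Icc_subset_Icc hs.le hTz.le)
  have h3 := ofReal_integral_eq_lintegral_ofReal h2 (Eventually.of_forall fun _ => by positivity)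
  refine le_trans (le_of_eq ?_) (h3.symm.le.trans (ENNReal.ofReal_le_ofReal h1))
  refine lintegral_congr fun y => ?_
  rw [OpL.specD, ENNReal.ofReal_pow (norm_nonneg _), ofReal_norm]

/-- By Tonelli the y-integral is done first at each frequency, leaving a constant times ‖F‖². Via
Plancherel this becomes square integrability of ∂_y ũ on strips. -/
theorem IsFamily.lintegral_specG_lt_top (h : IsFamily L φ ψ) (hFm : Measurable F)
    (hF : MemLp F 2 volume) (hs : 0 < s) (hsT : s ≤ T) (hT : T ∈ openDom L.R) :
    ∫⁻ y in Icc s T, ∫⁻ η, ‖L.specG F φ ψ η y‖ₑ ^ 2 < ⊤ := by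
  obtain ⟨C, hC, hle⟩ := h.lintegral_specD_le hs hsT hT
  have hm : Measurable fun q : ℝ × ℝ => ‖L.specG F φ ψ q.2 q.1‖ₑ ^ 2 :=
    ((h.measurable_specG hFm).comp measurable_swap).enorm.pow_const 2
  rw [lintegral_lintegral_swap (f := fun y η => ‖L.specG F φ ψ η y‖ₑ ^ 2) hm.aemeasurable]
  have h1 : ∀ η, ∫⁻ y in Icc s T, ‖L.specG F φ ψ η y‖ₑ ^ 2 ≤ ‖F η‖ₑ ^ 2 * C := by
    intro η
    have : ∀ y, ‖L.specG F φ ψ η y‖ₑ ^ 2 = ‖F η‖ₑ ^ 2 * ‖L.specD φ ψ η y‖ₑ ^ 2 := by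
      intro y
      have h2 : ‖L.specE η y‖ₑ = 1 := by rw [← ofReal_norm, L.norm_specE]; simp
      rw [OpL.specG, enorm_mul, enorm_mul, h2, one_mul, mul_pow]
    simp only [this]
    rw [lintegral_const_mul' _ _ (by finiteness)]
    gcongr
    exact hle η
  refine (lintegral_mono h1).trans_lt ?_
  rw [lintegral_mul_const' _ _ hC.ne]
  exact ENNReal.mul_lt_top ((memLp_two_iff_lintegral hF.1).1 hF) hC

/-- The energy bound holds only after integration in y, so a slice of the derivative is known to be
in L² only for almost every y. -/
theorem IsFamily.ae_memLp_specG (h : IsFamily L φ ψ) (hFm : Measurable F)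
    (hF : MemLp F 2 volume) (hs : 0 < s) (hsT : s ≤ T) (hT : T ∈ openDom L.R) :
    ∀ᵐ y ∂(volume.restrict (Icc s T)), MemLp (fun η => L.specG F φ ψ η y) 2 volume := by
  have hm : Measurable fun q : ℝ × ℝ => ‖L.specG F φ ψ q.2 q.1‖ₑ ^ 2 :=
    ((h.measurable_specG hFm).comp measurable_swap).enorm.pow_const 2
  have h1 := ae_lt_top (μ := volume.restrict (Icc s T))
    (Measurable.lintegral_prod_right' hm) (h.lintegral_specG_lt_top hFm hF hs hsT hT).ne
  filter_upwards [h1] with y hy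
  refine (memLp_two_iff_lintegral ?_).2 hy
  exact ((h.measurable_specG hFm).comp (measurable_id.prodMk measurable_const)).aestronglyMeasurable

theorem memLp_inv_one_add_sq : MemLp (fun η : ℝ => (((1 + η ^ 2)⁻¹ : ℝ) : ℂ)) 2 volume := by
  have hc : Continuous fun η : ℝ => (((1 + η ^ 2)⁻¹ : ℝ) : ℂ) :=
    Complex.continuous_ofReal.comp (Continuous.inv₀ (by fun_prop) fun x => by positivity)
  rw [memLp_two_iff_integrable_sq_norm hc.aestronglyMeasurable]
  refine integrable_inv_one_add_sq.mono' (hc.norm.pow 2).aestronglyMeasurable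
    (Eventually.of_forall fun η => ?_)
  have h0 : 0 ≤ (1 + η ^ 2)⁻¹ := by positivity
  have h1 : (1 + η ^ 2)⁻¹ ≤ 1 := inv_le_one_of_one_le₀ (by nlinarith)
  rw [Complex.norm_real, Real.norm_eq_abs, Real.norm_eq_abs, sq_abs, abs_of_nonneg (by positivity)]
  nlinarith

theorem integrable_norm_mul_inv (hF : MemLp F 2 volume) :
    Integrable fun η : ℝ => ‖F η‖ * (1 + η ^ 2)⁻¹ := by
  have := (hF.integrable_mul memLp_inv_one_add_sq).norm
  refine this.congr (Eventually.of_forall fun η => ?_)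
  simp only [Pi.mul_apply, norm_mul, Complex.norm_real, Real.norm_eq_abs]
  rw [abs_of_nonneg (by positivity)]

/-- Fubini's theorem applies to products with a factor of fast decay. -/
theorem integrable_prod_of_decay {μ : Measure ℝ} [SFinite μ] (hFm : Measurable F)
    (hF : MemLp F 2 volume) {c W : ℝ → ℝ → ℂ} {w : ℝ → ℝ} (hw : Integrable w μ) {C : ℝ}
    (hc : Measurable (Function.uncurry c)) (hW : Measurable (Function.uncurry W))
    (hcw : ∀ᵐ y ∂μ, ∀ η, ‖c η y‖ ≤ w y) (hWC : ∀ η y, ‖W η y‖ ≤ C * (1 + η ^ 2)⁻¹) :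
    Integrable (Function.uncurry fun y η => F η * (c η y * W η y)) (μ.prod volume) := by
  have h1 := (hw.mul_const C).mul_prod (integrable_norm_mul_inv hF)
  refine h1.mono' ?_ ?_
  · exact ((hFm.comp measurable_snd).mul ((hc.comp measurable_swap).mul
      (hW.comp measurable_swap))).aestronglyMeasurable
  · have h2 : ∀ᵐ q : ℝ × ℝ ∂(μ.prod volume), ∀ η, ‖c η q.1‖ ≤ w q.1 :=
      Measure.quasiMeasurePreserving_fst.ae hcw
    filter_upwards [h2] with q hq
    simp only [Function.uncurry, norm_mul]
    have e1 := hq q.2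
    have e2 := hWC q.2 q.1
    have e3 : 0 ≤ w q.1 := (norm_nonneg _).trans e1
    calc ‖F q.2‖ * (‖c q.2 q.1‖ * ‖W q.2 q.1‖)
        ≤ ‖F q.2‖ * (w q.1 * (C * (1 + q.2 ^ 2)⁻¹)) := by gcongr
      _ = _ := by ring

/-- Fubini's theorem applies to the terms that contain the derivative. -/
theorem IsFamily.integrable_prod_specD (h : IsFamily L φ ψ) (hFm : Measurable F)
    (hF : MemLp F 2 volume) (hs : 0 < s) (hsT : s ≤ T) (hT : T ∈ openDom L.R) {c W : ℝ → ℝ → ℂ}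
    {w : ℝ → ℝ} {C : ℝ} (hw : IntegrableOn (fun y => w y ^ 2) (Icc s T))
    (hc : Measurable (Function.uncurry c)) (hcw : ∀ η y, ‖c η y‖ ≤ w y)
    (hW : Measurable (Function.uncurry W)) (hWC : ∀ η y, ‖W η y‖ ≤ C * (1 + η ^ 2)⁻¹) :
    Integrable (Function.uncurry fun y η => F η * (L.specD φ ψ η y * c η y * W η y))
      ((volume.restrict (Icc s T)).prod volume) := by
  have h1 : Integrable (fun q : ℝ × ℝ => ‖L.specG F φ ψ q.2 q.1‖ ^ 2)
      ((volume.restrict (Icc s T)).prod volume) := by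
    have hm : Measurable fun q : ℝ × ℝ => L.specG F φ ψ q.2 q.1 :=
      (h.measurable_specG hFm).comp measurable_swap
    rw [← memLp_two_iff_integrable_sq_norm hm.aestronglyMeasurable,
      memLp_two_iff_lintegral hm.aestronglyMeasurable,
      lintegral_prod _ (hm.enorm.pow_const 2).aemeasurable]
    exact h.lintegral_specG_lt_top hFm hF hs hsT hT
  have h2 : Integrable (fun q : ℝ × ℝ => (w q.1 ^ 2 * C ^ 2) * (1 + q.2 ^ 2)⁻¹)
      ((volume.restrict (Icc s T)).prod volume) :=
    (hw.mul_const (C ^ 2)).mul_prod integrable_inv_one_add_sq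
  refine (h1.add h2).mono' ?_ (Eventually.of_forall fun q => ?_)
  · exact ((hFm.comp measurable_snd).mul (((h.measurable_specD.comp measurable_swap).mul
      (hc.comp measurable_swap)).mul (hW.comp measurable_swap))).aestronglyMeasurable
  · simp only [Function.uncurry, Pi.add_apply, OpL.specG, norm_mul, L.norm_specE, one_mul]
    have e1 := hcw q.2 q.1
    have e2 := hWC q.2 q.1
    have e3 : 0 ≤ w q.1 := (norm_nonneg _).trans e1
    have e4 : (1 + q.2 ^ 2)⁻¹ ≤ 1 := inv_le_one_of_one_le₀ (by nlinarith [sq_nonneg q.2])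
    have e5 : 0 ≤ (1 + q.2 ^ 2)⁻¹ := by positivity
    have e6 : ‖c q.2 q.1‖ * ‖W q.2 q.1‖ ≤ w q.1 * (C * (1 + q.2 ^ 2)⁻¹) := by gcongr
    have e7 : (w q.1 * (C * (1 + q.2 ^ 2)⁻¹)) ^ 2 ≤ (w q.1 ^ 2 * C ^ 2) * (1 + q.2 ^ 2)⁻¹ := by
      have : (w q.1 * (C * (1 + q.2 ^ 2)⁻¹)) ^ 2 =
        (w q.1 ^ 2 * C ^ 2) * ((1 + q.2 ^ 2)⁻¹ * (1 + q.2 ^ 2)⁻¹) := by ring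
      rw [this]
      have e8 : (1 + q.2 ^ 2)⁻¹ * (1 + q.2 ^ 2)⁻¹ ≤ (1 + q.2 ^ 2)⁻¹ := mul_le_of_le_one_left e5 e4
      gcongr
    have e9 : 0 ≤ ‖c q.2 q.1‖ * ‖W q.2 q.1‖ := by positivity
    have e10 : (‖c q.2 q.1‖ * ‖W q.2 q.1‖) ^ 2 ≤ (w q.1 * (C * (1 + q.2 ^ 2)⁻¹)) ^ 2 := by gcongr
    -- The product is bounded by the sum of squares of the factors |F D| and |c W|: the first square
    -- is integrable by the energy bound, the second by the decay of W.
    nlinarith [sq_nonneg (‖F q.2‖ * ‖L.specD φ ψ q.2 q.1‖ - ‖c q.2 q.1‖ * ‖W q.2 q.1‖),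
      sq_nonneg (‖F q.2‖ * ‖L.specD φ ψ q.2 q.1‖), sq_nonneg (‖c q.2 q.1‖ * ‖W q.2 q.1‖)]

end HarmExt
end

/-! ### The candidate satisfies the weak identities -/

noncomputable section
namespace HarmExt

variable {L : OpL} {φ ψ : ℝ → ℝ → ℂ} {F : ℝ → ℂ} {s T : ℝ} {u g v : ℝ → ℝ → ℂ}

theorem OpL.B_eq_Bdom {y : ℝ} (hy : y ∈ dom L.R) : L.B y = L.Bdom y := by
  rw [OpL.Bdom, indicator_of_mem hy]

/-- Parseval in x and Fubini reduce the identity to `OpL.weak_deriv_form` at each frequency. -/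
theorem IsFamily.isWeakDy_byParts (h : IsFamily L φ ψ) (hFm : Measurable F) (hF : MemLp F 2 volume)
    (hu : ∀ y ∈ dom L.R, IsFourier (fun x => u x y) (fun η => specU F φ η y))
    (hg : ∀ y, MemLp (fun η => L.specG F φ ψ η y) 2 volume →
      IsFourier (fun x => g x y) (fun η => L.specG F φ ψ η y)) (hv : IsTest L.R v) :
    ∫ y in openDom L.R, ∫ x, g x y * v x y =
      -∫ y in openDom L.R, ∫ x, L.shear u x y * dy v x y := by
  obtain ⟨K, s, T, hs, hsT, hT, hsup⟩ := hv.exists_support L.R_pos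
  obtain ⟨z, hz, hTz⟩ := exists_between_dom (openDom_subset_dom _ hT)
  have hzd := openDom_subset_dom _ hz
  have hSd : Icc s T ⊆ dom L.R :=
    (Icc_subset_openDom hs (openDom_subset_dom _ hT)).trans (openDom_subset_dom _)
  have hvy := isTest_dy hv
  have hsupy := (tsupport_dy_subset hv).trans hsup
  obtain ⟨C₀, -, hC₀⟩ := hv.exists_decay L.R_pos
  obtain ⟨C₁, -, hC₁⟩ := hvy.exists_decay L.R_pos
  have hφE : Measurable (Function.uncurry fun η y => φ (2 * Real.pi * η) y * L.specE η y) :=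
    h.measurable_scaled.mul L.measurable_specE
  have i1 := h.integrable_prod_specD hFm hF hs hsT hT (c := L.specE) (w := fun _ => 1)
    (by simp) L.measurable_specE (fun η y => (L.norm_specE η y).le)
    hv.stronglyMeasurable_invFT.measurable hC₀
  have i2 := integrable_prod_of_decay (μ := volume.restrict (Icc s T)) (w := fun _ => 1) hFm hF
    (by simp) hφE hvy.stronglyMeasurable_invFT.measurable (by
      filter_upwards [ae_restrict_mem measurableSet_Icc] with y hy η
      rw [norm_mul, L.norm_specE, mul_one]
      exact h.norm_le _ y (hSd hy)) hC₁
  have e1 : ∫ y in openDom L.R, ∫ x, g x y * v x y =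
      ∫ y in Icc s T, ∫ η, F η * (L.specD φ ψ η y * L.specE η y * invFT (fun x => v x y) η) := by
    rw [setIntegral_openDom_eq hs hT (fun y hy => by
      simp [fun x => eq_zero_of_tsupport_subset hsup (x := x) (Or.inr hy)])]
    refine integral_congr_ae ?_
    filter_upwards [h.ae_memLp_specG hFm hF hs hsT hT] with y hy
    rw [(hg y hy).integral_mul (hv.contDiff_slice y) (hv.hasCompactSupport_slice y)]
    refine integral_congr_ae (Eventually.of_forall fun η => ?_)
    simp only [OpL.specG]
    ring
  have e2 : ∫ y in openDom L.R, ∫ x, L.shear u x y * dy v x y =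
      ∫ y in Icc s T, ∫ η, F η * (φ (2 * Real.pi * η) y * L.specE η y *
        invFT (fun x => dy v x y) η) := by
    rw [setIntegral_openDom_eq hs hT (fun y hy => by
      simp [fun x => eq_zero_of_tsupport_subset hsupy (x := x) (Or.inr hy)])]
    refine setIntegral_congr_fun measurableSet_Icc fun y hy => ?_
    simp only [OpL.shear, L.B_eq_Bdom (hSd hy)]
    rw [(hu y (hSd hy)).integral_translate_mul (hvy.contDiff_slice y)
      (hvy.hasCompactSupport_slice y) (L.Bdom y)]
    refine integral_congr_ae (Eventually.of_forall fun η => ?_)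
    simp only [specU, OpL.specE]
    ring
  rw [e1, e2, integral_integral_swap i1, integral_integral_swap i2, ← integral_neg]
  refine integral_congr_ae (Eventually.of_forall fun η => ?_)
  simp only [integral_const_mul]
  rw [← mul_neg]
  congr 1
  have := L.weak_deriv_form hzd (h.isSol (2 * Real.pi * η) z hzd) hs hsT hTz
    (β := fun y => invFT (fun x => v x y) η) (β' := fun y => invFT (fun x => dy v x y) η)
    (hvy.continuous_invFT L.R_pos η) (fun t => hv.invFT_eq_integral L.R_pos η 0 t)
    (fun y hy => invFT_eq_zero_of_tsupport_subset hsup η hy)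
    (fun y hy => invFT_eq_zero_of_tsupport_subset hsupy η hy)
  refine Eq.trans ?_ (this.trans (congrArg _ ?_))
  · refine integral_congr_ae (Eventually.of_forall fun y => ?_)
    simp only [OpL.specD, OpL.specE]
    ring
  · refine integral_congr_ae (Eventually.of_forall fun y => ?_)
    simp only [OpL.specE]
    ring

theorem integral_combination {A B C : ℝ → ℂ} (hA : Integrable A) (hB : Integrable B)
    (hC : Integrable C) :
    ∫ η, (A η - 2 * B η + C η) = (∫ η, A η) - 2 * (∫ η, B η) + ∫ η, C η := by
  have h1 : Integrable fun η => A η - 2 * B η := hA.sub (hB.const_mul 2)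
  rw [integral_add h1 hC, integral_sub hA (hB.const_mul 2), integral_const_mul]

/-- Each of the three terms is moved to the Fourier side and its integrals are interchanged. At a
fixed frequency the sum vanishes by `IsSol.weak_form`. -/
theorem IsFamily.weakEq (h : IsFamily L φ ψ) (hFm : Measurable F) (hF : MemLp F 2 volume)
    (hu : ∀ y ∈ dom L.R, IsFourier (fun x => u x y) (fun η => specU F φ η y))
    (hg : ∀ y, MemLp (fun η => L.specG F φ ψ η y) 2 volume →
      IsFourier (fun x => g x y) (fun η => L.specG F φ ψ η y)) : L.WeakEq u g := by
  intro v hv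
  obtain ⟨K, s, T, hs, hsT, hT, hsup⟩ := hv.exists_support L.R_pos
  obtain ⟨z, hz, hTz⟩ := exists_between_dom (openDom_subset_dom _ hT)
  have hzd := openDom_subset_dom _ hz
  have hTd := openDom_subset_dom _ hT
  have hSd : Icc s T ⊆ dom L.R := (Icc_subset_openDom hs hTd).trans (openDom_subset_dom _)
  have hvx := isTest_dx hv
  have hvxx := isTest_dx hvx
  have hvy := isTest_dy hv
  have hvyy := isTest_dy hvy
  have hsupx := (tsupport_dx_subset hv).trans hsup
  have hsupxx := (tsupport_dx_subset hvx).trans hsupx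
  have hsupy := (tsupport_dy_subset hv).trans hsup
  have hsupyy := (tsupport_dy_subset hvy).trans hsupy
  obtain ⟨C₁, -, hC₁⟩ := hvx.exists_decay L.R_pos
  obtain ⟨C₂, -, hC₂⟩ := hvxx.exists_decay L.R_pos
  obtain ⟨C₃, -, hC₃⟩ := hvyy.exists_decay L.R_pos
  have hbm := L.b_measurable
  have hb2 : IntegrableOn (fun y => L.b y ^ 2) (Icc s T) :=
    (L.b_sq_integrable T hTd).mono_set (Icc_subset_Icc_left hs.le)
  have : IsFiniteMeasure (L.a.restrict (Icc s T)) := ⟨by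
    rw [Measure.restrict_apply_univ]
    exact (measure_mono (Icc_subset_Icc_left hs.le)).trans_lt (L.a_finite T hTd)⟩
  have hφ : Measurable (Function.uncurry fun η y => φ (2 * Real.pi * η) y) := h.measurable_scaled
  have hbφ : Measurable (Function.uncurry fun η y => (L.b y : ℂ) ^ 2 * φ (2 * Real.pi * η) y) :=
    Measurable.mul (f := fun q : ℝ × ℝ => (L.b q.2 : ℂ) ^ 2) (by fun_prop) hφ
  have hbm' : Measurable (Function.uncurry fun _ y : ℝ => (L.b y : ℂ)) := by
    simp only [Function.uncurry_def]
    fun_prop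
  have i1 := integrable_prod_of_decay (μ := L.a.restrict (Icc s T)) (w := fun _ => 1) hFm hF
    (by simp) hφ hvxx.stronglyMeasurable_invFT.measurable (by
      filter_upwards [ae_restrict_mem measurableSet_Icc] with y hy η
      exact h.norm_le _ y (hSd hy)) hC₂
  have i3 := integrable_prod_of_decay (μ := volume.restrict (Icc s T)) (w := fun _ => 1) hFm hF
    (by simp) hφ hvyy.stronglyMeasurable_invFT.measurable (by
      filter_upwards [ae_restrict_mem measurableSet_Icc] with y hy η
      exact h.norm_le _ y (hSd hy)) hC₃
  have i2 := h.integrable_prod_specD hFm hF hs hsT hT (c := fun _ y => (L.b y : ℂ))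
    (w := fun y => |L.b y|) (by simpa only [sq_abs] using hb2) hbm'
    (fun η y => by simp) hvx.stronglyMeasurable_invFT.measurable hC₁
  have i2' := integrable_prod_of_decay (μ := volume.restrict (Icc s T)) hFm hF hb2 hbφ
    hvxx.stronglyMeasurable_invFT.measurable (by
      filter_upwards [ae_restrict_mem measurableSet_Icc] with y hy η
      rw [norm_mul, norm_pow, Complex.norm_real, Real.norm_eq_abs, sq_abs]
      exact mul_le_of_le_one_right (sq_nonneg _) (h.norm_le _ y (hSd hy))) hC₂
  have e1 : (∫ y in openDom L.R, (∫ x, u x y * dx (dx v) x y) ∂L.a) =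
      ∫ y in Icc s T,
        (∫ η, F η * (φ (2 * Real.pi * η) y * invFT (fun x => dx (dx v) x y) η)) ∂L.a := by
    rw [setIntegral_openDom_eq hs hT (fun y hy => by
      simp [fun x => eq_zero_of_tsupport_subset hsupxx (x := x) (Or.inr hy)])]
    refine setIntegral_congr_fun measurableSet_Icc fun y hy => ?_
    rw [(hu y (hSd hy)).integral_mul (hvxx.contDiff_slice y) (hvxx.hasCompactSupport_slice y)]
    simp only [specU, mul_assoc]
  have e3 : (∫ y in openDom L.R, ∫ x, u x y * dy (dy v) x y) =
      ∫ y in Icc s T, ∫ η, F η * (φ (2 * Real.pi * η) y * invFT (fun x => dy (dy v) x y) η) := by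
    rw [setIntegral_openDom_eq hs hT (fun y hy => by
      simp [fun x => eq_zero_of_tsupport_subset hsupyy (x := x) (Or.inr hy)])]
    refine setIntegral_congr_fun measurableSet_Icc fun y hy => ?_
    rw [(hu y (hSd hy)).integral_mul (hvyy.contDiff_slice y) (hvyy.hasCompactSupport_slice y)]
    simp only [specU, mul_assoc]
  have e2 : (∫ y in openDom L.R,
      (∫ x, (g (x - L.B y) y * dx v x y + (L.b y : ℂ) * u x y * dx (dx v) x y)) * (L.b y : ℂ)) =
      ∫ y in Icc s T, ∫ η, (F η * (L.specD φ ψ η y * L.b y * invFT (fun x => dx v x y) η) +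
        F η * ((L.b y : ℂ) ^ 2 * φ (2 * Real.pi * η) y * invFT (fun x => dx (dx v) x y) η)) := by
    rw [setIntegral_openDom_eq hs hT (fun y hy => by
      simp [fun x => eq_zero_of_tsupport_subset hsupxx (x := x) (Or.inr hy),
        fun x => eq_zero_of_tsupport_subset hsupx (x := x) (Or.inr hy)])]
    refine integral_congr_ae ?_
    filter_upwards [h.ae_memLp_specG hFm hF hs hsT hT, ae_restrict_mem measurableSet_Icc,
      i2.prod_right_ae, i2'.prod_right_ae] with y hy hyS j2 j2'
    have hgy := hg y hy
    have huy := hu y (hSd hyS)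
    have k1 : Integrable fun x => g (x - L.B y) y * dx v x y := by
      have hm : MemLp (fun x => g (x - L.B y) y) 2 volume :=
        hgy.memLp_left.comp_measurePreserving (measurePreserving_sub_right volume (L.B y))
      exact hm.integrable_mul (q := 2) ((hvx.contDiff_slice y).continuous.memLp_of_hasCompactSupport
        (hvx.hasCompactSupport_slice y))
    have k2 : Integrable fun x => (L.b y : ℂ) * u x y * dx (dx v) x y := by
      simp only [mul_assoc]
      exact (huy.integrable_left (hvxx.contDiff_slice y) (hvxx.hasCompactSupport_slice y)).const_mul _
    have k3 := huy.integral_mul (hvxx.contDiff_slice y) (hvxx.hasCompactSupport_slice y)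
    have k4 := hgy.integral_translate_mul (hvx.contDiff_slice y) (hvx.hasCompactSupport_slice y)
      (-L.B y)
    simp only [← sub_eq_add_neg] at k4
    rw [integral_add k1 k2, k4]
    simp only [mul_assoc (L.b y : ℂ) (u _ _), integral_const_mul]
    rw [k3, add_mul, ← integral_mul_const, ← integral_const_mul, ← integral_mul_const]
    simp only [Function.uncurry] at j2 j2'
    rw [integral_add j2 j2']
    congr 1
    · refine integral_congr_ae (Eventually.of_forall fun η => ?_)
      -- The weak equation evaluates g at x - B(y), which undoes the shear: the two phases cancel.
      have h1 : L.specE η y * Complex.exp (Complex.I * ((2 * Real.pi * η : ℝ) : ℂ) *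
          ((-L.B y : ℝ) : ℂ)) = 1 := by
        rw [OpL.specE, ← Complex.exp_add, L.B_eq_Bdom (hSd hyS)]
        push_cast
        rw [mul_neg, add_neg_cancel, Complex.exp_zero]
      simp only [OpL.specG]
      linear_combination (F η * L.specD φ ψ η y * invFT (fun x => dx v x y) η * L.b y) * h1
    · refine integral_congr_ae (Eventually.of_forall fun η => ?_)
      simp only [specU]
      ring
  have i4 : Integrable (Function.uncurry fun y η =>
      F η * (L.specD φ ψ η y * L.b y * invFT (fun x => dx v x y) η) +
        F η * ((L.b y : ℂ) ^ 2 * φ (2 * Real.pi * η) y * invFT (fun x => dx (dx v) x y) η))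
      ((volume.restrict (Icc s T)).prod volume) := i2.add i2'
  rw [e1, e2, e3, integral_integral_swap i1, integral_integral_swap i4, integral_integral_swap i3]
  refine (integral_combination i1.integral_prod_right i4.integral_prod_right
    i3.integral_prod_right).symm.trans
    (integral_eq_zero_of_ae (Eventually.of_forall fun η => ?_))
  have key := (h.isSol (2 * Real.pi * η) z hzd).weak_form (L.coeff hzd) hs hsT hTz
    (β := fun y => invFT (fun x => v x y) η) (β' := fun y => invFT (fun x => dy v x y) η)
    (β'' := fun y => invFT (fun x => dy (dy v) x y) η)
    (hvy.continuous_invFT L.R_pos η) (hvyy.continuous_invFT L.R_pos η)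
    (fun t => hv.invFT_eq_integral L.R_pos η 0 t)
    (fun t => hvy.invFT_eq_integral L.R_pos η 0 t)
    (fun y hy => invFT_eq_zero_of_tsupport_subset hsup η hy)
    (fun y hy => invFT_eq_zero_of_tsupport_subset hsupy η hy)
    (fun y hy => invFT_eq_zero_of_tsupport_subset hsupyy η hy)
  set k : ℂ := ((2 * Real.pi * η : ℝ) : ℂ) with hk
  have p1 : ∀ y, F η * (φ (2 * Real.pi * η) y * invFT (fun x => dx (dx v) x y) η) =
      (-(F η * k ^ 2)) * (invFT (fun x => v x y) η * φ (2 * Real.pi * η) y) := by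
    intro y; rw [hv.invFT_dx_dx]; ring
  have p3 : ∀ y, F η * (φ (2 * Real.pi * η) y * invFT (fun x => dy (dy v) x y) η) =
      F η * (invFT (fun x => dy (dy v) x y) η * φ (2 * Real.pi * η) y) := by
    intro y; ring
  -- The terms with b²φ cancel, since the derivative of the shear contains ikbφ and -ik · ik = k².
  -- Only bψ remains, as in the ordinary differential equation.
  have p2 : ∀ y, F η * (L.specD φ ψ η y * L.b y * invFT (fun x => dx v x y) η) +
        F η * ((L.b y : ℂ) ^ 2 * φ (2 * Real.pi * η) y * invFT (fun x => dx (dx v) x y) η) =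
      (-(F η * Complex.I * k)) * (invFT (fun x => v x y) η * (L.b y * ψ (2 * Real.pi * η) y)) := by
    intro y
    rw [hv.invFT_dx_dx, hv.invFT_dx, OpL.specD, ← hk]
    linear_combination (-F η * k ^ 2 * (L.b y) ^ 2 * φ (2 * Real.pi * η) y *
      invFT (fun x => v x y) η) * Complex.I_sq
  simp only [Function.uncurry, p1, p2, p3, integral_const_mul, Pi.zero_apply]
  rw [key]
  ring

end HarmExt
end

/-! ### Construction of the harmonic function -/

noncomputable section
namespace HarmExt

variable {L : OpL} {φ ψ : ℝ → ℝ → ℂ} {F : ℝ → ℂ} {s T : ℝ} {u g v : ℝ → ℝ → ℂ}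

theorem measurable_domRestrict_uncurry {t : Set (ℝ × ℝ)} (hg : Measurable (Function.uncurry g)) :
    Measurable (t.domRestrict (Function.uncurry g)) :=
  hg.comp measurable_subtype_coe

theorem IsFamily.continuousOn (h : IsFamily L φ ψ) (ξ : ℝ) : ContinuousOn (φ ξ) (dom L.R) := by
  intro y hy
  obtain ⟨T, hT, hyT⟩ := exists_between_dom hy
  have h1 := (h.isSol ξ T (openDom_subset_dom _ hT)).continuousOn
  refine (h1 y ⟨hy.1, hyT.le⟩).mono_of_mem_nhdsWithin ?_
  filter_upwards [self_mem_nhdsWithin, mem_nhdsWithin_of_mem_nhds (Iio_mem_nhds hyT)] with z hz hz'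
  exact ⟨hz.1, le_of_lt hz'⟩

theorem locallyIntegrableOn_of_memLp_strip {R : EReal}
    (hg : ∀ y₁ y₂ : ℝ, 0 < y₁ → y₁ < y₂ → (y₂ : EReal) < R →
      MemLp (Function.uncurry g) 2 (volume.restrict (univ ×ˢ Ioo y₁ y₂))) :
    LocallyIntegrableOn (Function.uncurry g) (univ ×ˢ openDom R) volume := by
  rintro ⟨x, y⟩ ⟨-, hy⟩
  obtain ⟨T, hT, hyT⟩ := exists_between_dom (openDom_subset_dom _ hy)
  have hy0 : 0 < y := hy.1
  have h1 := hg (y / 2) T (by positivity) (by linarith) hT.2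
  refine ⟨Ioo (x - 1) (x + 1) ×ˢ Ioo (y / 2) T, mem_nhdsWithin_of_mem_nhds
    (prod_mem_nhds (Ioo_mem_nhds (by linarith) (by linarith)) (Ioo_mem_nhds (by linarith) hyT)), ?_⟩
  have h2 : MemLp (Function.uncurry g) 2
      (volume.restrict (Ioo (x - 1) (x + 1) ×ˢ Ioo (y / 2) T)) :=
    h1.mono_measure (Measure.restrict_mono (prod_mono (subset_univ _) Subset.rfl) le_rfl)
  have : IsFiniteMeasure ((volume : Measure (ℝ × ℝ)).restrict
      (Ioo (x - 1) (x + 1) ×ˢ Ioo (y / 2) T)) := ⟨by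
    rw [Measure.restrict_apply_univ, Measure.volume_eq_prod, Measure.prod_prod]
    simp [ENNReal.mul_lt_top_iff]⟩
  exact h2.integrable (by norm_num)

/-- Plancherel on almost every slice transfers the energy bound to g. -/
theorem IsFamily.memLp_strip (h : IsFamily L φ ψ) (hFm : Measurable F) (hF : MemLp F 2 volume)
    (hgm : Measurable (Function.uncurry g))
    (hg : ∀ y, MemLp (fun η => L.specG F φ ψ η y) 2 volume →
      IsFourier (fun x => g x y) (fun η => L.specG F φ ψ η y)) {y₁ y₂ : ℝ} (h1 : 0 < y₁)
    (h12 : y₁ < y₂) (h2 : (y₂ : EReal) < L.R) :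
    MemLp (Function.uncurry g) 2 (volume.restrict (univ ×ˢ Ioo y₁ y₂)) := by
  have hT : y₂ ∈ openDom L.R := ⟨h1.trans h12, h2⟩
  have hm : Measurable fun q : ℝ × ℝ => ‖Function.uncurry g q‖ₑ ^ 2 := hgm.enorm.pow_const 2
  rw [memLp_two_iff_lintegral hgm.aestronglyMeasurable, Measure.volume_eq_prod,
    ← Measure.prod_restrict, Measure.restrict_univ, lintegral_prod_symm _ hm.aemeasurable]
  refine (lintegral_mono_set Ioo_subset_Icc_self).trans_lt ?_
  refine (lintegral_congr_ae ?_).trans_lt (h.lintegral_specG_lt_top hFm hF h1 h12.le hT)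
  filter_upwards [h.ae_memLp_specG hFm hF h1 h12.le hT] with y hy
  exact (hg y hy).lintegral_eq.symm

/-- Dominated convergence: every φ_ξ is continuous, and |φ_ξ| ≤ 1 gives the majorant 4|F|². -/
theorem IsFamily.tendsto_eLpNorm_sub (h : IsFamily L φ ψ) (hFm : Measurable F)
    (hF : MemLp F 2 volume) {y₀ : ℝ} (hy₀ : y₀ ∈ dom L.R) :
    Tendsto (fun y => eLpNorm (fun η => specU F φ η y - specU F φ η y₀) 2 volume)
      (𝓝[dom L.R] y₀) (𝓝 0) := by
  refine tendsto_eLpNorm_two_zero ?_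
  have hm : ∀ y, Measurable fun η => specU F φ η y := fun y =>
    (h.measurable_specU hFm).comp (measurable_id.prodMk measurable_const)
  have h4 : ∫⁻ η, ‖F η‖ₑ ^ 2 < ⊤ := (memLp_two_iff_lintegral hF.1).1 hF
  have := tendsto_lintegral_filter_of_dominated_convergence (μ := volume) (l := 𝓝[dom L.R] y₀)
    (F := fun y η => ‖specU F φ η y - specU F φ η y₀‖ₑ ^ 2) (f := fun _ => 0)
    (fun η => 4 * ‖F η‖ₑ ^ 2)
    (Eventually.of_forall fun y => ((hm y).sub (hm y₀)).enorm.pow_const 2) ?_ ?_ ?_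
  · simpa using this
  · filter_upwards [self_mem_nhdsWithin] with y hy
    refine Eventually.of_forall fun η => ?_
    have h5 : ‖specU F φ η y - specU F φ η y₀‖ ≤ 2 * ‖F η‖ := by
      refine (norm_sub_le _ _).trans ?_
      simp only [specU, norm_mul]
      nlinarith [h.norm_le (2 * Real.pi * η) y hy, h.norm_le (2 * Real.pi * η) y₀ hy₀,
        norm_nonneg (F η)]
    have h6 : ‖specU F φ η y - specU F φ η y₀‖ₑ ≤ 2 * ‖F η‖ₑ := by
      have := enorm_le_iff_norm_le (x := specU F φ η y - specU F φ η y₀) (y := 2 * F η)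
      rw [enorm_mul, norm_mul] at this
      simpa [enorm_eq_nnnorm] using this.2 (by simpa using h5)
    calc _ ≤ (2 * ‖F η‖ₑ) ^ 2 := by gcongr
      _ = _ := by rw [mul_pow]; norm_num
  · rw [lintegral_const_mul' _ _ (by norm_num)]
    exact (ENNReal.mul_lt_top (by norm_num) h4).ne
  · refine Eventually.of_forall fun η => ?_
    have h7 : Tendsto (fun y => specU F φ η y - specU F φ η y₀) (𝓝[dom L.R] y₀) (𝓝 0) := by
      have := ((h.continuousOn (2 * Real.pi * η) y₀ hy₀).tendsto.const_mul (F η)).sub_const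
        (specU F φ η y₀)
      simpa [specU] using this
    have h8 := ((ENNReal.continuous_pow 2).comp continuous_enorm).tendsto (0 : ℂ)
    simpa [Function.comp_def] using h8.comp h7

theorem IsFamily.lintegral_specU_le (h : IsFamily L φ ψ) {r : ℝ} (hr : L.R = (r : EReal)) {y : ℝ}
    (hy : y ∈ dom L.R) :
    ∫⁻ η, ‖specU F φ η y‖ₑ ^ 2 ≤ ENNReal.ofReal (1 - y / r) * ∫⁻ η, ‖F η‖ₑ ^ 2 := by
  rw [← lintegral_const_mul' _ _ ENNReal.ofReal_ne_top]
  refine lintegral_mono fun η => ?_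
  simp only [specU]
  rw [enorm_mul, mul_pow, mul_comm]
  gcongr
  rw [← ofReal_norm, ← ENNReal.ofReal_pow (norm_nonneg _)]
  exact ENNReal.ofReal_le_ofReal (h.norm_sq_le r hr _ y hy)

/-- Both u and g are measurable slicewise inverse transforms, and the norm conditions are read off
from the transforms. For finite R, |φ_ξ|² ≤ 1 - y/R yields vanishing at R. -/
theorem IsFamily.exists_harmonic (h : IsFamily L φ ψ) (hFm : Measurable F)
    (hF : MemLp F 2 volume) : ∃ u : ℝ → ℝ → ℂ, L.IsHarmonic u ∧
      ∀ y ∈ dom L.R, IsFourier (fun x => u x y) (fun η => specU F φ η y) := by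
  obtain ⟨u, hum, hu⟩ := exists_measurable_fourierInv (h.measurable_specU hFm)
  obtain ⟨g, hgm, hg⟩ := exists_measurable_fourierInv (h.measurable_specG hFm)
  have hu' : ∀ y ∈ dom L.R, IsFourier (fun x => u x y) (fun η => specU F φ η y) := fun y hy =>
    hu y (h.memLp_specU hFm hF hy)
  have h4 : ∫⁻ η, ‖F η‖ₑ ^ 2 < ⊤ := (memLp_two_iff_lintegral hF.1).1 hF
  refine ⟨u, ⟨measurable_domRestrict_uncurry hum, fun y hy => (hu' y hy).memLp_left, ?_, ?_, ?_,
    ⟨g, ⟨measurable_domRestrict_uncurry hgm, ?_, ?_⟩, ?_, h.weakEq hFm hF hu' hg⟩⟩, hu'⟩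
  · intro y₀ hy₀
    refine (h.tendsto_eLpNorm_sub hFm hF hy₀).congr' ?_
    filter_upwards [self_mem_nhdsWithin] with y hy
    exact ((hu' y hy).sub (hu' y₀ hy₀)).eLpNorm_eq
  · intro _
    refine ⟨(eLpNorm F 2 volume).toReal, fun y hy => ?_⟩
    rw [ENNReal.ofReal_toReal hF.2.ne, ← (hu' y hy).eLpNorm_eq]
    refine eLpNorm_mono fun η => ?_
    simp only [specU]
    rw [norm_mul]
    exact mul_le_of_le_one_right (norm_nonneg _) (h.norm_le _ y hy)
  · intro r hr
    have hr0 : 0 < r := by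
      have := L.R_pos
      rw [hr] at this
      exact_mod_cast this
    refine tendsto_eLpNorm_two_zero ?_
    have h5 : Tendsto (fun y => ENNReal.ofReal (1 - y / r) * ∫⁻ η, ‖F η‖ₑ ^ 2) (𝓝[<] r) (𝓝 0) := by
      have h6 : Tendsto (fun y : ℝ => 1 - y / r) (𝓝[<] r) (𝓝 0) := by
        have : ContinuousAt (fun y : ℝ => 1 - y / r) r := by fun_prop
        have h7 := this.tendsto.mono_left (nhdsWithin_le_nhds (s := Iio r))
        simpa [div_self hr0.ne'] using h7
      have h8 := ENNReal.Tendsto.mul_const (ENNReal.tendsto_ofReal h6)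
        (b := ∫⁻ η, ‖F η‖ₑ ^ 2) (Or.inr h4.ne)
      simpa using h8
    refine tendsto_of_tendsto_of_tendsto_of_le_of_le' tendsto_const_nhds h5
      (Eventually.of_forall fun y => zero_le) ?_
    filter_upwards [Ioo_mem_nhdsLT hr0] with y hy
    have hyd : y ∈ dom L.R := ⟨hy.1.le, by rw [hr]; exact EReal.coe_lt_coe_iff.2 hy.2⟩
    rw [← (hu' y hyd).lintegral_eq]
    exact h.lintegral_specU_le hr hyd
  · exact locallyIntegrableOn_of_memLp_strip fun y₁ y₂ h1 h2 h3 =>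
      h.memLp_strip hFm hF hgm hg h1 h2 h3
  · exact fun v hv => h.isWeakDy_byParts hFm hF hu' hg hv
  · exact fun y₁ y₂ h1 h2 h3 => h.memLp_strip hFm hF hgm hg h1 h2 h3

end HarmExt
end

/-! ### Du Bois-Reymond lemmas and a countable family of test functions -/

noncomputable section
namespace HarmExt

/-- Real smooth functions with compact support in `(p, q)`. -/
structure IsBump (p q : ℝ) (β : ℝ → ℝ) : Prop where
  smooth : ContDiff ℝ ∞ β
  compact : HasCompactSupport β
  support : tsupport β ⊆ Ioo p q

variable {p q : ℝ} {β γ : ℝ → ℝ} {f : ℝ → ℂ}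

theorem IsBump.isBump_deriv (h : IsBump p q β) : IsBump p q (deriv β) :=
  ⟨(contDiff_infty_iff_deriv.1 h.smooth).2, h.compact.deriv, (tsupport_deriv_subset).trans h.support⟩

theorem IsBump.continuous (h : IsBump p q β) : Continuous β := h.smooth.continuous

theorem IsBump.integrable (h : IsBump p q β) : Integrable β :=
  h.continuous.integrable_of_hasCompactSupport h.compact

theorem IsBump.sub_const_mul (h : IsBump p q β) (h' : IsBump p q γ) (c : ℝ) :
    IsBump p q (fun x => β x - c * γ x) where
  smooth := h.smooth.sub (contDiff_const.mul h'.smooth)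
  compact := h.compact.sub (h'.compact.mul_left (f := fun _ => c))
  support := (tsupport_sub _ _).trans (union_subset h.support
    ((tsupport_mul_subset_right (f := fun _ => c)).trans h'.support))

theorem exists_isBump (hpq : p < q) : ∃ β, IsBump p q β ∧ ∫ x, β x = 1 := by
  let φ : ContDiffBump ((p + q) / 2) := ⟨(q - p) / 8, (q - p) / 4, by linarith, by linarith⟩
  refine ⟨φ.normed volume, ⟨φ.contDiff_normed, φ.hasCompactSupport_normed, ?_⟩, φ.integral_normed⟩
  rw [φ.tsupport_normed_eq, Real.closedBall_eq_Icc]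
  rintro x ⟨h1, h2⟩
  simp only [φ] at h1 h2
  constructor <;> linarith

theorem IsBump.exists_Icc (hpq : p < q) (h : IsBump p q β) :
    ∃ s t, p < s ∧ s < t ∧ t < q ∧ tsupport β ⊆ Icc s t := by
  obtain ⟨s, hs, h1⟩ : ∃ s ∈ Ioo p ((p + q) / 2), ∀ x ∈ tsupport β, s ≤ x := by
    rcases (tsupport β).eq_empty_or_nonempty with h0 | h0
    · obtain ⟨s, hs⟩ := exists_between (show p < (p + q) / 2 by linarith)
      exact ⟨s, hs, by simp [h0]⟩
    · obtain ⟨m, hm, hm2⟩ := h.compact.exists_isLeast h0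
      obtain ⟨s, hs1, hs2⟩ := exists_between (show p < min m ((p + q) / 2) from
        lt_min (h.support hm).1 (by linarith))
      exact ⟨s, ⟨hs1, hs2.trans_le (min_le_right _ _)⟩, fun x hx =>
        (hs2.le.trans (min_le_left _ _)).trans (hm2 hx)⟩
  obtain ⟨t, ht, h2⟩ : ∃ t ∈ Ioo ((p + q) / 2) q, ∀ x ∈ tsupport β, x ≤ t := by
    rcases (tsupport β).eq_empty_or_nonempty with h0 | h0
    · obtain ⟨s, hs⟩ := exists_between (show (p + q) / 2 < q by linarith)
      exact ⟨s, hs, by simp [h0]⟩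
    · obtain ⟨m, hm, hm2⟩ := h.compact.exists_isGreatest h0
      obtain ⟨s, hs1, hs2⟩ := exists_between (show max m ((p + q) / 2) < q from
        max_lt (h.support hm).2 (by linarith))
      exact ⟨s, ⟨(le_max_right _ _).trans_lt hs1, hs2⟩, fun x hx =>
        (hm2 hx).trans ((le_max_left _ _).trans hs1.le)⟩
  exact ⟨s, t, hs.1, hs.2.trans ht.1, ht.2, fun x hx => ⟨h1 x hx, h2 x hx⟩⟩

/-- The primitive of γ vanishes left of the support, and right of it because the total integral is
zero. -/
theorem IsBump.exists_deriv_eq (hpq : p < q) (h : IsBump p q γ) (h0 : ∫ x, γ x = 0) :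
    ∃ β, IsBump p q β ∧ deriv β = γ := by
  obtain ⟨s, t, hs, hst, ht, hsup⟩ := h.exists_Icc hpq
  have hz : ∀ x, x ∉ Icc s t → γ x = 0 := fun x hx => image_eq_zero_of_notMem_tsupport fun h => hx (hsup h)
  have hd : ∀ x, HasDerivAt (fun x => ∫ r in s..x, γ r) (γ x) x := fun x =>
    intervalIntegral.integral_hasDerivAt_right (h.continuous.intervalIntegrable _ _)
      (h.continuous.stronglyMeasurableAtFilter _ _) h.continuous.continuousAt
  have hd' : deriv (fun x => ∫ r in s..x, γ r) = γ := funext fun x => (hd x).deriv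
  have hl : ∀ x, x < s → ∫ r in s..x, γ r = 0 := by
    intro x hx
    rw [intervalIntegral.integral_symm, intervalIntegral.integral_of_le hx.le,
      ← integral_Ico_eq_integral_Ioc, setIntegral_eq_zero_of_forall_eq_zero, neg_zero]
    exact fun r hr => hz r fun h => absurd h.1 (not_le.2 hr.2)
  have hr : ∀ x, t < x → ∫ r in s..x, γ r = 0 := by
    intro x hx
    rw [intervalIntegral.integral_of_le (hst.trans hx).le, ← integral_Icc_eq_integral_Ioc,
      setIntegral_eq_integral_of_forall_compl_eq_zero, h0]
    exact fun r hr => hz r fun h => hr ⟨h.1, h.2.trans hx.le⟩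
  have hsub : tsupport (fun x => ∫ r in s..x, γ r) ⊆ Icc s t := by
    refine closure_minimal (fun x hx => ?_) isClosed_Icc
    by_contra hc
    rcases lt_or_ge x s with h1 | h1
    · exact hx (hl x h1)
    · exact hx (hr x (lt_of_not_ge fun h2 => hc ⟨h1, h2⟩))
  refine ⟨fun x => ∫ r in s..x, γ r, ⟨?_, ?_, hsub.trans (Icc_subset_Ioo hs ht)⟩, hd'⟩
  · rw [contDiff_infty_iff_deriv, hd']
    exact ⟨fun x => (hd x).differentiableAt, h.smooth⟩
  · exact isCompact_Icc.of_isClosed_subset (isClosed_tsupport _) hsub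

theorem IsBump.integrable_smul (h : IsBump p q β) (hf : ContinuousOn f (Ioo p q)) :
    Integrable fun x => β x • f x := by
  have h1 : Continuous fun x => β x • f x := by
    rw [continuous_iff_continuousAt]
    intro x
    by_cases hx : x ∈ tsupport β
    · exact h.continuous.continuousAt.smul (hf.continuousAt (Ioo_mem_nhds (h.support hx).1 (h.support hx).2))
    · have : (fun x => β x • f x) =ᶠ[𝓝 x] fun _ => 0 := by
        filter_upwards [(isClosed_tsupport β).isOpen_compl.mem_nhds hx] with y hy
        rw [image_eq_zero_of_notMem_tsupport hy, zero_smul]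
      exact this.continuousAt
  exact h1.integrable_of_hasCompactSupport h.compact.smul_right

theorem eq_of_ae_eq_Ioo {g : ℝ → ℂ} (hf : ContinuousOn f (Ioo p q)) (hg : ContinuousOn g (Ioo p q))
    (h : ∀ᵐ x, x ∈ Ioo p q → f x = g x) : EqOn f g (Ioo p q) :=
  Measure.eqOn_open_of_ae_eq ((ae_restrict_iff' measurableSet_Ioo).2 h) isOpen_Ioo hf hg

/-- The lemma of du Bois-Reymond. -/
theorem eq_const_of_integral_deriv_smul (hpq : p < q) (hf : ContinuousOn f (Ioo p q))
    (h : ∀ β, IsBump p q β → ∫ x, deriv β x • f x = 0) : ∃ c, ∀ x ∈ Ioo p q, f x = c := by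
  obtain ⟨β₀, hβ₀, h1⟩ := exists_isBump hpq
  set c := ∫ x, β₀ x • f x with hc
  refine ⟨c, eq_of_ae_eq_Ioo hf continuousOn_const ?_⟩
  have hfc : ContinuousOn (fun x => f x - c) (Ioo p q) := hf.sub continuousOn_const
  have := isOpen_Ioo.ae_eq_zero_of_integral_contDiff_smul_eq_zero (μ := volume)
    (hfc.locallyIntegrableOn measurableSet_Ioo) ?_
  · filter_upwards [this] with x hx hx' using sub_eq_zero.1 (hx hx')
  intro γ g1 g2 g3
  have hγ : IsBump p q γ := ⟨g1, g2, g3⟩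
  -- Subtracting a multiple of the normalised bump β₀ makes the integral zero, so the difference is
  -- a derivative of a bump.
  obtain ⟨β, hβ, hd⟩ := (hγ.sub_const_mul hβ₀ (∫ x, γ x)).exists_deriv_eq hpq (by
    rw [integral_sub hγ.integrable (hβ₀.integrable.const_mul _), integral_const_mul, h1]
    ring)
  have h2 := h β hβ
  rw [hd] at h2
  simp only [sub_smul, mul_smul] at h2
  rw [integral_sub (hγ.integrable_smul hf) ((hβ₀.integrable_smul hf).fun_smul _), integral_smul,
    ← hc] at h2
  simp only [smul_sub]
  rw [integral_sub (hγ.integrable_smul hf) (hγ.integrable.smul_const _), integral_smul_const, h2]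

/-- Reduction to the first-order lemma. The linear term x d, with d = ∫ β₀' f, makes f + x d
orthogonal to all first derivatives because ∫ γ' x = -∫ γ. -/
theorem eq_affine_of_integral_deriv_deriv_smul (hpq : p < q) (hf : ContinuousOn f (Ioo p q))
    (h : ∀ β, IsBump p q β → ∫ x, deriv (deriv β) x • f x = 0) :
    ∃ c d, ∀ x ∈ Ioo p q, f x = c + x * d := by
  obtain ⟨β₀, hβ₀, h1⟩ := exists_isBump hpq
  set d := ∫ x, deriv β₀ x • f x with hd
  have hfd : ContinuousOn (fun x : ℝ => f x + x * d) (Ioo p q) := by fun_prop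
  suffices hz : ∀ γ, IsBump p q γ → ∫ x, deriv γ x • (f x + x * d) = 0 by
    obtain ⟨c, hc⟩ := eq_const_of_integral_deriv_smul hpq hfd hz
    refine ⟨c, -d, fun x hx => ?_⟩
    rw [← hc x hx]
    ring
  intro γ hγ
  obtain ⟨β, hβ, hb⟩ := (hγ.sub_const_mul hβ₀ (∫ x, γ x)).exists_deriv_eq hpq (by
    rw [integral_sub hγ.integrable (hβ₀.integrable.const_mul _), integral_const_mul, h1]
    ring)
  have h2 := h β hβ
  have hγd := hγ.smooth.differentiable (by simp)
  have hβd := hβ₀.smooth.differentiable (by simp)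
  have e : deriv (deriv β) = fun x => deriv γ x - (∫ x, γ x) * deriv β₀ x := by
    rw [hb]
    ext x
    rw [deriv_fun_sub (hγd x) ((hβd x).const_mul _), deriv_const_mul _ (hβd x)]
  rw [e] at h2
  simp only [sub_smul, mul_smul] at h2
  rw [integral_sub (hγ.isBump_deriv.integrable_smul hf) ((hβ₀.isBump_deriv.integrable_smul hf).fun_smul _),
    integral_smul, ← hd] at h2
  have h3 : ∫ x, deriv γ x * x = - ∫ x, γ x := by
    have := integral_mul_deriv_eq_deriv_mul_of_integrable (u := fun x : ℝ => x) (v := γ)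
      (u' := fun _ => 1) (v' := deriv γ) (fun x _ => hasDerivAt_id x)
      (fun x _ => (hγd x).hasDerivAt)
      ((continuous_id.mul hγ.isBump_deriv.continuous).integrable_of_hasCompactSupport
        hγ.isBump_deriv.compact.mul_left)
      (hγ.integrable.congr (Eventually.of_forall fun x => by simp))
      ((continuous_id.mul hγ.continuous).integrable_of_hasCompactSupport hγ.compact.mul_left)
    simpa [mul_comm] using this
  have e2 : ∀ x : ℝ, deriv γ x • (f x + x * d) = deriv γ x • f x + (deriv γ x * x) • d := by
    intro x
    simp only [smul_add, Complex.real_smul]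
    push_cast
    ring
  simp only [e2]
  have i1 : Integrable fun x => deriv γ x * x :=
    (hγ.isBump_deriv.continuous.mul continuous_id).integrable_of_hasCompactSupport
      hγ.isBump_deriv.compact.mul_right
  rw [integral_add (hγ.isBump_deriv.integrable_smul hf) (i1.smul_const d), integral_smul_const, h3, neg_smul]
  exact h2

/-- A countable family of test functions is enough to detect affine functions. -/
theorem exists_seq_isBump (hpq : p < q) : ∃ β : ℕ → ℝ → ℝ, (∀ n, IsBump p q (β n)) ∧
    ∀ f : ℝ → ℂ, ContinuousOn f (Icc p q) → (∀ n, ∫ x, deriv (deriv (β n)) x • f x = 0) →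
      ∃ c d, ∀ x ∈ Icc p q, f x = c + x * d := by
  let S := {β : ℝ → ℝ // IsBump p q β}
  obtain ⟨b₀, hb₀, -⟩ := exists_isBump hpq
  have : Nonempty S := ⟨⟨b₀, hb₀⟩⟩
  -- The second derivatives form a subset of the separable space C([p, q]). A dense sequence in it
  -- suffices because pairing with f is continuous for the uniform norm.
  let ι : S → C(Icc p q, ℝ) := fun β => ⟨fun x => deriv (deriv β.1) x,
    β.2.isBump_deriv.isBump_deriv.continuous.comp continuous_subtype_val⟩
  have : Nonempty (range ι) := (range_nonempty ι).to_subtype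
  obtain ⟨δ, hδ⟩ := TopologicalSpace.exists_dense_seq (range ι)
  choose b hb using fun n => (δ n).2
  refine ⟨fun n => (b n).1, fun n => (b n).2, fun f hf h => ?_⟩
  let Λ : C(Icc p q, ℝ) → ℂ := fun c => ∫ x in Icc p q, c (projIcc p q hpq.le x) • f x
  have hcont : ∀ c : C(Icc p q, ℝ), IntegrableOn (fun x => c (projIcc p q hpq.le x) • f x) (Icc p q) :=
    fun c => ContinuousOn.integrableOn_Icc
      ((c.continuous.comp continuous_projIcc).continuousOn.smul hf)
  have hΛ : Continuous Λ := by
    refine LipschitzWith.continuous (K := ⟨∫ x in Icc p q, ‖f x‖, by positivity⟩)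
      (LipschitzWith.of_dist_le_mul fun c c' => ?_)
    simp only [Λ]
    rw [dist_eq_norm, ← integral_sub (hcont c) (hcont c')]
    change _ ≤ (∫ x in Icc p q, ‖f x‖) * _
    rw [← integral_mul_const]
    refine (norm_integral_le_integral_norm _).trans
      (integral_mono ((hcont c).sub (hcont c')).norm (hf.norm.integrableOn_Icc.mul_const _)
      fun x => ?_)
    simp only
    rw [← sub_smul, norm_smul, mul_comm, ← dist_eq_norm]
    gcongr
    exact ContinuousMap.dist_apply_le_dist _
  have hι : ∀ β : S, Λ (ι β) = ∫ x, deriv (deriv β.1) x • f x := by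
    intro β
    rw [← setIntegral_eq_integral_of_forall_compl_eq_zero (s := Icc p q)]
    · refine setIntegral_congr_fun measurableSet_Icc fun x hx => ?_
      simp [ι, projIcc_of_mem hpq.le hx]
    · intro x hx
      rw [image_eq_zero_of_notMem_tsupport fun h' =>
        hx (Ioo_subset_Icc_self (β.2.isBump_deriv.isBump_deriv.support h')), zero_smul]
  have hz : ∀ c : range ι, Λ c = 0 := by
    have h1 : IsClosed {c : range ι | Λ c = 0} :=
      isClosed_eq (hΛ.comp continuous_subtype_val) continuous_const
    have h2 : range δ ⊆ {c : range ι | Λ c = 0} := by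
      rintro _ ⟨n, rfl⟩
      change Λ (δ n) = 0
      rw [← hb n, hι]
      exact h n
    intro c
    exact (h1.closure_subset_iff.2 h2) (hδ c)
  obtain ⟨c, d, hcd⟩ := eq_affine_of_integral_deriv_deriv_smul hpq (hf.mono Ioo_subset_Icc_self)
    fun β hβ => by rw [← hι ⟨β, hβ⟩]; exact hz ⟨_, mem_range_self _⟩
  refine ⟨c, d, fun x hx => ?_⟩
  have h1 : Icc p q ⊆ closure (Ioo p q) := by rw [closure_Ioo hpq.ne]
  exact (show EqOn f (fun x : ℝ => c + x * d) (Ioo p q) from hcd).of_subset_closure hf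
    (by fun_prop) Ioo_subset_Icc_self h1 hx

end HarmExt
end

/-! ### Functions annihilated by transforms of test functions -/

noncomputable section
namespace HarmExt

/-- Every test function is the transform of a Schwartz function, so self-adjointness of the
transform moves it onto h. -/
theorem ae_eq_zero_of_fourier_eq_zero {h : ℝ → ℂ} (hi : Integrable h) (h0 : ∀ x, 𝓕 h x = 0) :
    h =ᵐ[volume] 0 := by
  refine ae_eq_zero_of_integral_contDiff_smul_eq_zero hi.locallyIntegrable fun κ hκ hs => ?_
  have hκ' : ContDiff ℝ ∞ fun x => (κ x : ℂ) := Complex.ofRealCLM.contDiff.comp hκ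
  have hs' : HasCompactSupport fun x => (κ x : ℂ) := hs.comp_left Complex.ofReal_zero
  set S := hs'.toSchwartzMap hκ'
  have h1 := VectorFourier.integral_fourierIntegral_smul_eq_flip (L := innerₗ ℝ) (e := Real.fourierChar)
    (μ := volume) (ν := volume) Real.continuous_fourierChar continuous_inner hi
    (SchwartzMap.integrable (𝓕⁻ S))
  have h2 : ∀ ξ, VectorFourier.fourierIntegral Real.fourierChar volume (innerₗ ℝ) h ξ = 0 :=
    fun ξ => h0 ξ
  have h3 : ∀ x, VectorFourier.fourierIntegral Real.fourierChar volume (innerₗ ℝ).flip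
      (⇑(𝓕⁻ S : SchwartzMap ℝ ℂ)) x = (κ x : ℂ) := by
    intro x
    rw [flip_innerₗ]
    change 𝓕 (⇑(𝓕⁻ S : SchwartzMap ℝ ℂ)) x = _
    rw [← SchwartzMap.fourier_coe, FourierTransform.fourier_fourierInv_eq]
    rfl
  simp only [h2, h3, zero_smul, integral_zero] at h1
  rw [h1]
  refine integral_congr_ae (Eventually.of_forall fun x => ?_)
  simp [mul_comm]

/-- Bump functions around `0`, as complex functions. -/
def bumpC (n : ℕ) (x : ℝ) : ℂ := ((bumpSeq n).normed volume x : ℂ)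

theorem contDiff_bumpC (n : ℕ) : ContDiff ℝ ∞ (bumpC n) :=
  Complex.ofRealCLM.contDiff.comp (bumpSeq n).contDiff_normed

theorem hasCompactSupport_bumpC (n : ℕ) : HasCompactSupport (bumpC n) :=
  (bumpSeq n).hasCompactSupport_normed.comp_left Complex.ofReal_zero

/-- The bumps are an approximate identity, so their transforms converge to 1 at each frequency. -/
theorem exists_invFT_bumpC_ne_zero (ξ : ℝ) : ∃ n, invFT (bumpC n) ξ ≠ 0 := by
  have h1 := ContDiffBump.convolution_tendsto_right_of_continuous (μ := volume) tendsto_bumpSeq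
    (g := fun x : ℝ => Complex.exp (-(Complex.I * ((2 * Real.pi * ξ : ℝ) : ℂ) * x))) (by fun_prop) 0
  have h2 : ∀ n, invFT (bumpC n) ξ = MeasureTheory.convolution ((bumpSeq n).normed volume)
      (fun x : ℝ => Complex.exp (-(Complex.I * ((2 * Real.pi * ξ : ℝ) : ℂ) * x)))
      (ContinuousLinearMap.lsmul ℝ ℝ) volume 0 := by
    intro n
    rw [invFT, convolution_def]
    refine integral_congr_ae (Eventually.of_forall fun x => ?_)
    simp only [bumpC, ContinuousLinearMap.lsmul_apply, Complex.real_smul]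
    rw [mul_comm]
    congr 2
    push_cast
    ring
  simp only [← h2] at h1
  have h3 := h1.eventually_ne (b₂ := (0 : ℂ)) (by simp)
  exact h3.exists

/-- A function is zero if it annihilates all Fourier transforms of test functions. -/
theorem ae_eq_zero_of_integral_mul_invFT {K : ℝ → ℂ}
    (hi : ∀ α : ℝ → ℂ, ContDiff ℝ ∞ α → HasCompactSupport α → Integrable fun η => K η * invFT α η)
    (h0 : ∀ α : ℝ → ℂ, ContDiff ℝ ∞ α → HasCompactSupport α → ∫ η, K η * invFT α η = 0) :
    ∀ᵐ η, K η = 0 := by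
  -- Translating a bump multiplies its transform by a character, so the hypothesis says that this
  -- integrable product has zero Fourier transform.
  have h1 : ∀ n, ∀ᵐ η, K η * invFT (bumpC n) η = 0 := by
    intro n
    refine ae_eq_zero_of_fourier_eq_zero (hi _ (contDiff_bumpC n) (hasCompactSupport_bumpC n))
      fun x => ?_
    rw [← h0 (fun y => bumpC n (y - (-x))) ((contDiff_bumpC n).comp (contDiff_id.sub contDiff_const))
      ((hasCompactSupport_bumpC n).comp_homeomorph (Homeomorph.subRight (-x))), Real.fourier_eq']
    refine integral_congr_ae (Eventually.of_forall fun η => ?_)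
    simp only [invFT_translate, smul_eq_mul, RCLike.inner_apply, conj_trivial]
    rw [mul_left_comm]
    congr 2
    push_cast
    ring_nf
  filter_upwards [ae_all_iff.2 h1] with η hη
  obtain ⟨n, hn⟩ := exists_invFT_bumpC_ne_zero η
  exact (mul_eq_zero.1 (hη n)).resolve_right hn

end HarmExt
end

/-! ### Weak derivatives in one variable, and product test functions -/

noncomputable section
namespace HarmExt

theorem enorm_integral_mul_le {f g : ℝ → ℂ} (hf : MemLp f 2 volume) (hg : MemLp g 2 volume) :
    ‖∫ x, f x * g x‖ₑ ≤ eLpNorm f 2 volume * eLpNorm g 2 volume := by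
  refine (enorm_integral_le_lintegral_enorm _).trans ?_
  rw [← eLpNorm_one_eq_lintegral_enorm]
  have h : eLpNorm (f • g) 1 volume ≤ eLpNorm f 2 volume * eLpNorm g 2 volume :=
    eLpNorm_smul_le_mul_eLpNorm hg.1 hf.1
  exact h

/-- Products of square integrable functions are integrable. -/
theorem integrable_prod_of_sq {μ : Measure ℝ} [SFinite μ] {X : ℝ → ℝ → ℂ} {c A : ℝ → ℂ}
    (hX : Measurable (Function.uncurry X)) (hX2 : ∫⁻ y, (∫⁻ η, ‖X η y‖ₑ ^ 2) ∂μ < ⊤)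
    (hc : MemLp c 2 μ) (hA : MemLp A 2 volume) :
    Integrable (Function.uncurry fun y η => X η y * (c y * A η)) (μ.prod volume) := by
  have hm : Measurable fun q : ℝ × ℝ => X q.2 q.1 := hX.comp measurable_swap
  have h1 : MemLp (fun q : ℝ × ℝ => X q.2 q.1) 2 (μ.prod volume) := by
    rw [memLp_two_iff_lintegral hm.aestronglyMeasurable,
      lintegral_prod _ (hm.enorm.pow_const 2).aemeasurable]
    exact hX2
  have h2 : MemLp (fun q : ℝ × ℝ => c q.1 * A q.2) 2 (μ.prod volume) := by
    have hm2 : AEStronglyMeasurable (fun q : ℝ × ℝ => c q.1 * A q.2) (μ.prod volume) :=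
      hc.1.comp_fst.mul hA.1.comp_snd
    rw [memLp_two_iff_integrable_sq_norm hm2]
    refine (((memLp_two_iff_integrable_sq_norm hc.1).1 hc).mul_prod
      ((memLp_two_iff_integrable_sq_norm hA.1).1 hA)).congr (Eventually.of_forall fun q => ?_)
    simp [mul_pow]
  exact h1.integrable_mul h2

variable {p q : ℝ}

theorem intervalIntegral_eq_integral {h : ℝ → ℂ} (hpq : p ≤ q) (h0 : ∀ x, x ∉ Ioo p q → h x = 0) :
    ∫ x in p..q, h x = ∫ x, h x := by
  rw [intervalIntegral.integral_of_le hpq, integral_Ioc_eq_integral_Ioo,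
    setIntegral_eq_integral_of_forall_compl_eq_zero h0]

/-- A weak derivative on an interval determines the function up to a constant. -/
theorem eq_add_integral_of_weak_deriv {U G : ℝ → ℂ} (hpq : p < q) (hU : ContinuousOn U (Ioo p q))
    (hG : IntegrableOn G (Icc p q))
    (h : ∀ β, IsBump p q β → ∫ y, β y • G y = -∫ y, deriv β y • U y) {s t : ℝ} (hs : s ∈ Ioo p q)
    (ht : t ∈ Ioo p q) (hst : s ≤ t) : U t = U s + ∫ y in Icc s t, G y := by
  have hp : p ∈ Icc p q := ⟨le_rfl, hpq.le⟩
  have hIcc : ∀ u ∈ Icc p q, (fun u => ∫ r in p..u, G r) u =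
      (fun u => ∫ r in p..u, G r) p + ∫ r in p..u, G r := fun u _ => by simp
  have hc : ContinuousOn (fun u => ∫ r in p..u, G r) (Icc p q) :=
    continuousOn_of_eq_integral hG hIcc
  have hcI := hc.mono Ioo_subset_Icc_self
  -- U minus a primitive of G has zero weak derivative, so it is constant; continuity of U makes
  -- this hold at every point.
  obtain ⟨c, hc'⟩ := eq_const_of_integral_deriv_smul hpq (hU.sub hcI) (fun β hβ => by
    have hz : ∀ x, x ∉ Ioo p q → β x = 0 := fun x hx =>
      image_eq_zero_of_notMem_tsupport fun h => hx (hβ.support h)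
    have hz' : ∀ x, x ∉ Ioo p q → deriv β x = 0 := fun x hx =>
      image_eq_zero_of_notMem_tsupport fun h => hx (hβ.isBump_deriv.support h)
    have e1 : ∀ u ∈ Icc p q, (β u : ℂ) = β p + ∫ r in p..u, ((deriv β r : ℝ) : ℂ) := by
      intro u _
      rw [intervalIntegral.integral_ofReal, intervalIntegral.integral_deriv_eq_sub
        (fun x _ => (hβ.smooth.differentiable (by simp)) x)
        (hβ.isBump_deriv.continuous.intervalIntegrable _ _)]
      push_cast
      ring
    have k := (mul_eq_integral (f := fun u => (β u : ℂ)) (f' := fun u => ((deriv β u : ℝ) : ℂ))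
      (Complex.continuous_ofReal.comp hβ.isBump_deriv.continuous).integrableOn_Icc e1 hG hIcc).2 q
      ⟨hpq.le, le_rfl⟩
    have i1 : IntegrableOn (fun r => ((deriv β r : ℝ) : ℂ) * ∫ y in p..r, G y) (Icc p q) :=
      ((Complex.continuous_ofReal.comp hβ.isBump_deriv.continuous).continuousOn.mul hc).integrableOn_Icc
    have i2 : IntegrableOn (fun r => (β r : ℂ) * G r) (Icc p q) :=
      integrableOn_mul_of_continuousOn
        (Complex.continuous_ofReal.comp hβ.continuous).continuousOn hG
    rw [hz p (by simp), hz q (by simp), intervalIntegral.integral_add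
      (intervalIntegrable_of_Icc i1 hp ⟨hpq.le, le_rfl⟩)
      (intervalIntegrable_of_Icc i2 hp ⟨hpq.le, le_rfl⟩)] at k
    simp only [Complex.ofReal_zero, zero_mul, zero_add] at k
    rw [intervalIntegral_eq_integral hpq.le fun x hx => by rw [hz' x hx]; simp,
      intervalIntegral_eq_integral hpq.le fun x hx => by rw [hz x hx]; simp] at k
    have h1 := h β hβ
    have j := hβ.isBump_deriv.integrable_smul hcI
    simp only [Pi.sub_apply, smul_sub]
    rw [integral_sub (hβ.isBump_deriv.integrable_smul hU) j]
    simp only [Complex.real_smul] at h1 ⊢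
    linear_combination h1 + k)
  have h1 := hc' s hs
  have h2 := hc' t ht
  simp only [Pi.sub_apply] at h1 h2
  have h3 := intervalIntegral.integral_add_adjacent_intervals
    (intervalIntegrable_of_Icc hG hp (Ioo_subset_Icc_self hs))
    (intervalIntegrable_of_Icc hG (Ioo_subset_Icc_self hs) (Ioo_subset_Icc_self ht))
  rw [integral_Icc_eq_integral_Ioc, ← intervalIntegral.integral_of_le hst]
  linear_combination h2 - h1 - h3

variable {R : EReal} {α : ℝ → ℂ} {β : ℝ → ℝ}

theorem isTest_mul (hα : ContDiff ℝ ∞ α) (hs : HasCompactSupport α) (hβ : IsBump p q β)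
    (hpq : Icc p q ⊆ openDom R) : IsTest R fun x y => α x * (β y : ℂ) := by
  have hsub : tsupport (Function.uncurry fun x y => α x * (β y : ℂ)) ⊆ tsupport α ×ˢ tsupport β := by
    refine closure_minimal ?_ ((isClosed_tsupport α).prod (isClosed_tsupport β))
    rintro ⟨x, y⟩ hxy
    have hne : α x * (β y : ℂ) ≠ 0 := hxy
    refine ⟨subset_tsupport _ (left_ne_zero_of_mul hne), subset_tsupport _ fun h0 => ?_⟩
    exact right_ne_zero_of_mul hne (by rw [h0]; simp)
  refine ⟨?_, ?_, ?_⟩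
  · exact (hα.comp contDiff_fst).mul
      (Complex.ofRealCLM.contDiff.comp (hβ.smooth.comp contDiff_snd))
  · exact (IsCompact.prod hs hβ.compact).of_isClosed_subset (isClosed_tsupport _) hsub
  · exact hsub.trans (prod_mono (subset_univ _) (hβ.support.trans (Ioo_subset_Icc_self.trans hpq)))

theorem dx_mul (α : ℝ → ℂ) (β : ℝ → ℝ) :
    (dx fun x y => α x * (β y : ℂ)) = fun x y => deriv α x * (β y : ℂ) := by
  ext x y
  simp only [dx]
  rw [deriv_mul_const_field]

theorem dy_mul (α : ℝ → ℂ) (hβ : IsBump p q β) :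
    (dy fun x y => α x * (β y : ℂ)) = fun x y => α x * ((deriv β y : ℝ) : ℂ) := by
  ext x y
  simp only [dy]
  rw [deriv_const_mul_field]
  congr 1
  exact ((hβ.smooth.differentiable (by simp) y).hasDerivAt.ofReal_comp).deriv

end HarmExt
end

/-! ### Transforms of an arbitrary harmonic function -/

noncomputable section
namespace HarmExt

theorem abs_toReal_eLpNorm_sub_le {f g : ℝ → ℂ} (hf : MemLp f 2 volume) (hg : MemLp g 2 volume) :
    |(eLpNorm f 2 volume).toReal - (eLpNorm g 2 volume).toReal| ≤
      (eLpNorm (fun x => f x - g x) 2 volume).toReal := by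
  have h := abs_norm_sub_norm_le (hf.toLp f) (hg.toLp g)
  rw [← MemLp.toLp_sub hf hg, Lp.norm_toLp, Lp.norm_toLp, Lp.norm_toLp] at h
  exact h

theorem continuousOn_toReal_eLpNorm {w : ℝ → ℝ → ℂ} {D : Set ℝ}
    (hw : ∀ y ∈ D, MemLp (fun x => w x y) 2 volume)
    (hc : ∀ y₀ ∈ D, Tendsto (fun y => eLpNorm (fun x => w x y - w x y₀) 2 volume) (𝓝[D] y₀) (𝓝 0)) :
    ContinuousOn (fun y => (eLpNorm (fun x => w x y) 2 volume).toReal) D := by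
  intro y₀ hy₀
  rw [ContinuousWithinAt, tendsto_iff_dist_tendsto_zero]
  have h1 := (ENNReal.tendsto_toReal ENNReal.zero_ne_top).comp (hc y₀ hy₀)
  refine squeeze_zero' (Eventually.of_forall fun _ => dist_nonneg) ?_ h1
  filter_upwards [self_mem_nhdsWithin] with y hy
  exact abs_toReal_eLpNorm_sub_le (hw y hy) (hw y₀ hy₀)

theorem measurable_indicator_of_domRestrict {t : Set (ℝ × ℝ)} (ht : MeasurableSet t)
    {f : ℝ × ℝ → ℂ} (hf : Measurable (t.domRestrict f)) : Measurable (t.indicator f) := by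
  refine measurable_of_restrict_of_restrict_compl ht ?_ ?_
  · have : t.domRestrict (t.indicator f) = t.domRestrict f := by
      ext x
      simp [domRestrict]
    rwa [this]
  · have : tᶜ.domRestrict (t.indicator f) = fun _ => 0 := by
      ext x
      simp [domRestrict, indicator_of_notMem x.2]
    rw [this]
    exact measurable_const

/-- The Fourier transforms in `x` of a harmonic function `w` and of the derivative `g` of its shear. -/
structure IsSpec (L : OpL) (w g W G : ℝ → ℝ → ℂ) : Prop where
  measurable : Measurable (Function.uncurry W)
  measurable_deriv : Measurable (Function.uncurry G)
  fourier : ∀ y ∈ dom L.R, IsFourier (fun x => w x y) (fun η => W η y)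
  continuous : ∀ y₀ ∈ dom L.R,
    Tendsto (fun y => eLpNorm (fun x => w x y - w x y₀) 2 volume) (𝓝[dom L.R] y₀) (𝓝 0)
  fourier_deriv : ∀ s T, 0 < s → T ∈ openDom L.R →
    ∀ᵐ y ∂(volume.restrict (Icc s T)), IsFourier (fun x => g x y) (fun η => G η y)
  sq_deriv : ∀ s T, 0 < s → T ∈ openDom L.R → ∫⁻ y in Icc s T, ∫⁻ η, ‖G η y‖ₑ ^ 2 < ⊤
  byParts : ∀ v, IsTest L.R v → ∫ y in openDom L.R, ∫ x, g x y * v x y =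
    -∫ y in openDom L.R, ∫ x, L.shear w x y * dy v x y
  weakEq : L.WeakEq w g

variable {L : OpL} {w g W G : ℝ → ℝ → ℂ} {s t T : ℝ}

/-- Measurability is assumed only on ℝ × [0, R) and ℝ × (0, R), so the functions are extended by
zero before transforming. -/
theorem OpL.IsHarmonic.exists_isSpec (hw : L.IsHarmonic w) : ∃ g W G, IsSpec L w g W G := by
  obtain ⟨g, hg, hg2, hweak⟩ := hw.equation
  have hw1 := measurable_indicator_of_domRestrict (MeasurableSet.univ.prod (measurableSet_dom L.R))
    hw.borel
  have hg1 := measurable_indicator_of_domRestrict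
    (MeasurableSet.univ.prod (measurableSet_openDom L.R)) hg.borel
  have ew : ∀ y ∈ dom L.R, (fun x => (univ ×ˢ dom L.R).indicator (Function.uncurry w) (x, y)) =
      fun x => w x y := fun y hy => funext fun x => indicator_of_mem (by exact ⟨mem_univ _, hy⟩) _
  have eg : ∀ y ∈ openDom L.R,
      (fun x => (univ ×ˢ openDom L.R).indicator (Function.uncurry g) (x, y)) =
      fun x => g x y := fun y hy => funext fun x => indicator_of_mem (by exact ⟨mem_univ _, hy⟩) _
  obtain ⟨W, hWm, hW⟩ := exists_measurable_fourier
    (G := fun x y => (univ ×ˢ dom L.R).indicator (Function.uncurry w) (x, y)) hw1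
  obtain ⟨G, hGm, hG⟩ := exists_measurable_fourier
    (G := fun x y => (univ ×ˢ openDom L.R).indicator (Function.uncurry g) (x, y)) hg1
  -- Square integrability is assumed on open strips only; a slightly larger strip, from s/2 to some
  -- q > T, covers the closed one.
  have key : ∀ s T, 0 < s → T ∈ openDom L.R →
      ∫⁻ y in Icc s T, ∫⁻ x, ‖(univ ×ˢ openDom L.R).indicator (Function.uncurry g) (x, y)‖ₑ ^ 2 < ⊤ := by
    intro s T hs hT
    obtain ⟨q, hq, hTq⟩ := exists_between_dom (openDom_subset_dom _ hT)
    rcases lt_or_ge T s with h | h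
    · simp [Icc_eq_empty (not_le.2 h)]
    have h1 := hg2 (s / 2) q (by linarith) (by linarith) hq.2
    rw [memLp_two_iff_lintegral h1.1] at h1
    have h2 : ∫⁻ z in univ ×ˢ Ioo (s / 2) q,
        ‖(univ ×ˢ openDom L.R).indicator (Function.uncurry g) z‖ₑ ^ 2 < ⊤ := by
      refine (setLIntegral_congr_fun (MeasurableSet.univ.prod measurableSet_Ioo)
        fun z hz => ?_).trans_lt h1
      have hz2 : z.2 ∈ openDom L.R := Icc_subset_openDom (half_pos hs) (openDom_subset_dom _ hq)
        (Ioo_subset_Icc_self hz.2)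
      rw [indicator_of_mem (show z ∈ univ ×ˢ openDom L.R from ⟨mem_univ _, hz2⟩)]
    rw [Measure.volume_eq_prod, ← Measure.prod_restrict, Measure.restrict_univ,
      lintegral_prod_symm _ (hg1.enorm.pow_const 2).aemeasurable] at h2
    exact (lintegral_mono_set (Icc_subset_Ioo (by linarith) hTq)).trans_lt h2
  have key2 : ∀ s T, 0 < s → T ∈ openDom L.R → ∀ᵐ y ∂(volume.restrict (Icc s T)),
      IsFourier (fun x => g x y) (fun η => G η y) := by
    intro s T hs hT
    have hm : Measurable fun y => ∫⁻ x,
        ‖(univ ×ˢ openDom L.R).indicator (Function.uncurry g) (x, y)‖ₑ ^ 2 :=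
      (hg1.enorm.pow_const 2).lintegral_prod_left'
    filter_upwards [ae_lt_top hm (key s T hs hT).ne, ae_restrict_mem measurableSet_Icc] with y hy hyI
    have hyo := Icc_subset_openDom hs (openDom_subset_dom _ hT) hyI
    have := hG y ((memLp_two_iff_lintegral
      (hg1.comp (measurable_id.prodMk measurable_const)).aestronglyMeasurable).2 hy)
    rwa [eg y hyo] at this
  refine ⟨g, W, G, hWm, hGm, fun y hy => ?_, hw.continuous, key2, fun s T hs hT => ?_, hg.byParts, hweak⟩
  · have := hW y (by rw [ew y hy]; exact hw.memLp y hy)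
    rwa [ew y hy] at this
  · refine (lintegral_congr_ae ?_).trans_lt (key s T hs hT)
    filter_upwards [key2 s T hs hT, ae_restrict_mem measurableSet_Icc] with y hy hyI
    rw [hy.lintegral_eq]
    refine lintegral_congr fun x => ?_
    rw [congrFun (eg y (Icc_subset_openDom hs (openDom_subset_dom _ hT) hyI)) x]

theorem lintegral_enorm_sq_eq (f : ℝ → ℂ) : ∫⁻ x, ‖f x‖ₑ ^ 2 = eLpNorm f 2 volume ^ 2 := by
  rw [eLpNorm_eq_lintegral_rpow_enorm_toReal (by norm_num) (by norm_num), ← ENNReal.rpow_natCast,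
    ← ENNReal.rpow_mul]
  simp

/-- The L² norm of a slice is continuous in y, hence bounded on [0, T], and Plancherel transfers the
bound. -/
theorem IsSpec.exists_bound (h : IsSpec L w g W G) (hT : T ∈ dom L.R) :
    ∃ C : ENNReal, C < ⊤ ∧ ∀ y ∈ Icc 0 T, ∫⁻ η, ‖W η y‖ₑ ^ 2 ≤ C := by
  have hc := continuousOn_toReal_eLpNorm (fun y hy => (h.fourier y hy).memLp_left) h.continuous
  obtain ⟨D, hD⟩ := isCompact_Icc.exists_bound_of_continuousOn (hc.mono (Icc_subset_dom hT))
  refine ⟨ENNReal.ofReal D ^ 2, by simp [ENNReal.pow_lt_top_iff], fun y hy => ?_⟩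
  have hyd := Icc_subset_dom hT hy
  have h1 := (h.fourier y hyd).eLpNorm_eq
  have h2 := hD y hy
  rw [Real.norm_of_nonneg ENNReal.toReal_nonneg, ← h1] at h2
  have h3 := ENNReal.le_ofReal_iff_toReal_le (h.fourier y hyd).memLp_right.2.ne
    (ENNReal.toReal_nonneg.trans h2) |>.2 h2
  rw [lintegral_enorm_sq_eq]
  gcongr

theorem IsSpec.ae_memLp_deriv (h : IsSpec L w g W G) (hs : 0 < s) (hT : T ∈ openDom L.R) :
    ∀ᵐ η, MemLp (fun y => G η y) 2 (volume.restrict (Icc s T)) := by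
  have hm : Measurable fun z : ℝ × ℝ => ‖G z.2 z.1‖ₑ ^ 2 :=
    (h.measurable_deriv.comp measurable_swap).enorm.pow_const 2
  have h1 := h.sq_deriv s T hs hT
  rw [lintegral_lintegral_swap (f := fun y η => ‖G η y‖ₑ ^ 2) hm.aemeasurable] at h1
  filter_upwards [ae_lt_top hm.lintegral_prod_left' h1.ne] with η hη
  exact (memLp_two_iff_lintegral
    (h.measurable_deriv.comp (measurable_const.prodMk measurable_id)).aestronglyMeasurable).2 hη

end HarmExt
end

/-! ### Absolute continuity of the sheared transform -/

noncomputable section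
namespace HarmExt

variable {L : OpL} {w g W G : ℝ → ℝ → ℂ} {s t T : ℝ} {α : ℝ → ℂ}

theorem OpL.continuousOn_specE (L : OpL) (η : ℝ) : ContinuousOn (L.specE η) (dom L.R) := by
  have h : ContinuousOn L.Bdom (dom L.R) := L.continuousOn_B.congr fun y hy => (B_eq_Bdom hy).symm
  have e : L.specE η = fun y => Complex.exp (Complex.I * ((2 * Real.pi * η : ℝ) : ℂ) * L.Bdom y) := rfl
  rw [e]
  fun_prop

theorem OpL.measurable_specE_left (L : OpL) (y : ℝ) : Measurable fun η => L.specE η y :=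
  L.measurable_specE.comp (measurable_id.prodMk measurable_const)

theorem MemLp.specE_mul {F : ℝ → ℂ} (hF : MemLp F 2 volume) (L : OpL) (y : ℝ) :
    MemLp (fun η => L.specE η y * F η) 2 volume :=
  hF.of_le ((L.measurable_specE_left y).aestronglyMeasurable.mul hF.1)
    (Eventually.of_forall fun η => by rw [norm_mul, L.norm_specE, one_mul])

theorem IsSpec.integral_shear_mul (h : IsSpec L w g W G) (hα : ContDiff ℝ ∞ α)
    (hs : HasCompactSupport α) {y : ℝ} (hy : y ∈ dom L.R) :
    ∫ x, L.shear w x y * α x = ∫ η, W η y * (L.specE η y * invFT α η) := by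
  simp only [OpL.shear, L.B_eq_Bdom hy]
  exact (h.fourier y hy).integral_translate_mul hα hs _

/-- The change in W is handled by Cauchy-Schwarz and L²-continuity, the change in the phase by
dominated convergence with W frozen at y₀. -/
theorem IsSpec.continuousOn_integral_shear (h : IsSpec L w g W G) (hα : ContDiff ℝ ∞ α)
    (hs : HasCompactSupport α) :
    ContinuousOn (fun y => ∫ x, L.shear w x y * α x) (dom L.R) := by
  intro y₀ hy₀
  have hA := memLp_invFT hα hs
  have hW := fun y hy => (h.fourier y hy).memLp_right
  have h1 : Tendsto (fun y => ∫ η, (W η y - W η y₀) * (L.specE η y * invFT α η)) (𝓝[dom L.R] y₀)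
      (𝓝 0) := by
    rw [tendsto_zero_iff_enorm_tendsto_zero]
    have h2 := ENNReal.Tendsto.mul_const (h.continuous y₀ hy₀) (b := eLpNorm (invFT α) 2 volume)
      (Or.inr hA.2.ne)
    rw [zero_mul] at h2
    refine tendsto_of_tendsto_of_tendsto_of_le_of_le' tendsto_const_nhds h2
      (Eventually.of_forall fun y => zero_le) ?_
    filter_upwards [self_mem_nhdsWithin] with y hy
    refine (enorm_integral_mul_le ((hW y hy).sub (hW y₀ hy₀)) (MemLp.specE_mul hA L y)).trans
      (le_of_eq ?_)
    congr 1
    · exact ((h.fourier y hy).sub (h.fourier y₀ hy₀)).eLpNorm_eq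
    · exact eLpNorm_congr_norm_ae (Eventually.of_forall fun η => by
        rw [norm_mul, L.norm_specE, one_mul])
  have h3 : Tendsto (fun y => ∫ η, W η y₀ * (L.specE η y * invFT α η)) (𝓝[dom L.R] y₀)
      (𝓝 (∫ η, W η y₀ * (L.specE η y₀ * invFT α η))) := by
    refine tendsto_integral_filter_of_dominated_convergence (fun η => ‖W η y₀ * invFT α η‖)
      (Eventually.of_forall fun y => ((hW y₀ hy₀).integrable_mul
        (MemLp.specE_mul hA L y)).aestronglyMeasurable)
      (Eventually.of_forall fun y => Eventually.of_forall fun η => ?_)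
      ((hW y₀ hy₀).integrable_mul hA).norm (Eventually.of_forall fun η => ?_)
    · rw [norm_mul, norm_mul, norm_mul, L.norm_specE, one_mul]
    · exact ((L.continuousOn_specE η y₀ hy₀).tendsto.mul_const _).const_mul _
  have h4 := h1.add h3
  rw [zero_add, ← h.integral_shear_mul hα hs hy₀] at h4
  refine h4.congr' ?_
  filter_upwards [self_mem_nhdsWithin] with y hy
  have i1 : Integrable fun η => (W η y - W η y₀) * (L.specE η y * invFT α η) :=
    ((hW y hy).sub (hW y₀ hy₀)).integrable_mul (MemLp.specE_mul hA L y)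
  have i2 : Integrable fun η => W η y₀ * (L.specE η y * invFT α η) :=
    (hW y₀ hy₀).integrable_mul (MemLp.specE_mul hA L y)
  rw [h.integral_shear_mul hα hs hy, ← integral_add i1 i2]
  refine integral_congr_ae (Eventually.of_forall fun η => ?_)
  ring

theorem IsSpec.integrable_deriv_mul (h : IsSpec L w g W G) (hs : 0 < s) (hT : T ∈ openDom L.R)
    {A c : ℝ → ℂ} (hA : MemLp A 2 volume) (hc : MemLp c 2 (volume.restrict (Icc s T))) :
    Integrable (Function.uncurry fun y η => G η y * (c y * A η))
      ((volume.restrict (Icc s T)).prod volume) :=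
  integrable_prod_of_sq h.measurable_deriv (h.sq_deriv s T hs hT) hc hA

/-- Testing with α(x)β(y) makes the pairing with g a weak derivative in y of the pairing with the
shear; the latter is continuous, so the identity holds for all s and t. -/
theorem IsSpec.integral_shear_eq (h : IsSpec L w g W G) (hα : ContDiff ℝ ∞ α)
    (hsα : HasCompactSupport α) (hs : 0 < s) (hst : s ≤ t) (ht : t ∈ openDom L.R) :
    ∫ x, L.shear w x t * α x = (∫ x, L.shear w x s * α x) + ∫ y in Icc s t, ∫ x, g x y * α x := by
  obtain ⟨q, hq, htq⟩ := exists_between_dom (openDom_subset_dom _ ht)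
  have hqd := openDom_subset_dom _ hq
  have hsub : Icc (s / 2) q ⊆ openDom L.R := Icc_subset_openDom (half_pos hs) hqd
  have hsubI : Ioo (s / 2) q ⊆ dom L.R :=
    Ioo_subset_Icc_self.trans (hsub.trans (openDom_subset_dom _))
  refine eq_add_integral_of_weak_deriv (U := fun y => ∫ x, L.shear w x y * α x)
    (G := fun y => ∫ x, g x y * α x) (p := s / 2) (q := q) (by linarith)
    ((h.continuousOn_integral_shear hα hsα).mono hsubI) ?_ ?_ ⟨by linarith, by linarith⟩
    ⟨by linarith, htq⟩ hst
  · have i1 := (h.integrable_deriv_mul (half_pos hs) hq (memLp_invFT hα hsα)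
      (memLp_const (1 : ℂ))).integral_prod_left
    refine i1.congr ?_
    filter_upwards [h.fourier_deriv _ _ (half_pos hs) hq] with y hy
    rw [hy.integral_mul hα hsα]
    simp [Function.uncurry]
  · intro β hβ
    have h1 := h.byParts _ (isTest_mul hα hsα hβ hsub)
    rw [dy_mul α hβ] at h1
    have e : ∀ (β : ℝ → ℝ) (hβ : IsBump (s / 2) q β) (f : ℝ → ℝ → ℂ),
        ∫ y in openDom L.R, ∫ x, f x y * (α x * (β y : ℂ)) = ∫ y, β y • ∫ x, f x y * α x := by
      intro β hβ f
      have e1 : ∀ y, ∫ x, f x y * (α x * (β y : ℂ)) = β y • ∫ x, f x y * α x := by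
        intro y
        simp only [← mul_assoc, integral_mul_const, Complex.real_smul]
        rw [mul_comm]
      simp only [e1]
      refine setIntegral_eq_integral_of_forall_compl_eq_zero fun y hy => ?_
      rw [image_eq_zero_of_notMem_tsupport fun h' =>
        hy (hsub (Ioo_subset_Icc_self (hβ.support h'))), zero_smul]
    rw [e β hβ, e (deriv β) hβ.isBump_deriv] at h1
    exact h1

/-- The Fourier transform of the shear of a harmonic function is absolutely continuous in `y`. -/
theorem IsSpec.specE_mul_eq (h : IsSpec L w g W G) (hs : 0 < s) (hst : s ≤ t)
    (ht : t ∈ openDom L.R) :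
    ∀ᵐ η, L.specE η t * W η t = L.specE η s * W η s + ∫ y in Icc s t, G η y := by
  have htd := openDom_subset_dom _ ht
  have hsd : s ∈ dom L.R := Icc_subset_dom htd ⟨hs.le, hst⟩
  have j : ∀ (α : ℝ → ℂ), ContDiff ℝ ∞ α → HasCompactSupport α → ∀ y ∈ dom L.R,
      Integrable fun η => W η y * (L.specE η y * invFT α η) := fun α hα hsα y hy =>
    (h.fourier y hy).memLp_right.integrable_mul (MemLp.specE_mul (memLp_invFT hα hsα) L y)
  have i1 : ∀ (α : ℝ → ℂ), ContDiff ℝ ∞ α → HasCompactSupport α →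
      Integrable (Function.uncurry fun y η => G η y * invFT α η)
        ((volume.restrict (Icc s t)).prod volume) := fun α hα hsα => by
    simpa using h.integrable_deriv_mul hs ht (memLp_invFT hα hsα) (memLp_const (1 : ℂ))
  have e : ∀ (α : ℝ → ℂ) η, (L.specE η t * W η t - L.specE η s * W η s - ∫ y in Icc s t, G η y) *
      invFT α η = W η t * (L.specE η t * invFT α η) - W η s * (L.specE η s * invFT α η) -
        ∫ y in Icc s t, G η y * invFT α η := by
    intro α η
    rw [integral_mul_const]
    ring
  -- The defect at each frequency pairs to zero with all transforms of test functions. The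
  -- exceptional null set may depend on s and t.
  have key := ae_eq_zero_of_integral_mul_invFT
    (K := fun η => L.specE η t * W η t - L.specE η s * W η s - ∫ y in Icc s t, G η y)
    (fun α hα hsα => by
      simp only [e]
      exact ((j α hα hsα t htd).sub (j α hα hsα s hsd)).sub (i1 α hα hsα).integral_prod_right)
    (fun α hα hsα => by
      have j1 : Integrable fun η => W η t * (L.specE η t * invFT α η) -
        W η s * (L.specE η s * invFT α η) := (j α hα hsα t htd).sub (j α hα hsα s hsd)
      have j2 : Integrable fun η => ∫ y in Icc s t, G η y * invFT α η :=
        (i1 α hα hsα).integral_prod_right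
      simp only [e]
      rw [integral_sub j1 j2,
        integral_sub (j α hα hsα t htd) (j α hα hsα s hsd), ← h.integral_shear_mul hα hsα htd,
        ← h.integral_shear_mul hα hsα hsd, h.integral_shear_eq hα hsα hs hst ht,
        ← integral_integral_swap (i1 α hα hsα), add_sub_cancel_left, sub_eq_zero]
      refine integral_congr_ae ?_
      filter_upwards [h.fourier_deriv s t hs ht] with y hy
      exact hy.integral_mul hα hsα)
  filter_upwards [key] with η hη
  linear_combination hη

end HarmExt
end

/-! ### From the weak to the integrated equation at one frequency -/

noncomputable section
namespace HarmExt

variable {a : Measure ℝ} {b : ℝ → ℝ} {ξ s T : ℝ} {φ χ ψ : ℝ → ℂ} {β : ℝ → ℝ}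

theorem IsBump.eq_zero (h : IsBump s T β) {x : ℝ} (hx : x ∉ Ioo s T) : β x = 0 :=
  image_eq_zero_of_notMem_tsupport fun h' => hx (h.support h')

theorem IsBump.ofReal_eq (h : IsBump s T β) (p u : ℝ) :
    (β u : ℂ) = β p + ∫ r in p..u, ((deriv β r : ℝ) : ℂ) := by
  rw [intervalIntegral.integral_ofReal, intervalIntegral.integral_deriv_eq_sub
    (fun x _ => (h.smooth.differentiable (by simp)) x)
    (h.isBump_deriv.continuous.intervalIntegrable _ _)]
  push_cast
  ring

theorem IsBump.continuous_ofReal (h : IsBump s T β) : Continuous fun x => (β x : ℂ) :=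
  Complex.continuous_ofReal.comp h.continuous

/-- The difference has zero primitive, so integration by parts gives zero against every bump. -/
theorem ae_eq_of_integral_eq (hsT : s < T) (hψ : IntegrableOn ψ (Icc s T))
    (hχ : IntegrableOn χ (Icc s T))
    (h : ∀ t ∈ Icc s T, ∫ r in s..t, ψ r = ∫ r in s..t, χ r) :
    ∀ᵐ r ∂(volume.restrict (Icc s T)), ψ r = χ r := by
  have hss : s ∈ Icc s T := ⟨le_rfl, hsT.le⟩
  have hTT : T ∈ Icc s T := ⟨hsT.le, le_rfl⟩
  have hi : IntegrableOn (fun r => ψ r - χ r) (Icc s T) := hψ.sub hχ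
  have h1 := isOpen_Ioo.ae_eq_zero_of_integral_contDiff_smul_eq_zero (U := Ioo s T) (μ := volume)
    (hi.mono_set Ioo_subset_Icc_self).locallyIntegrableOn ?_
  · rw [ae_restrict_congr_set Ioo_ae_eq_Icc.symm, ae_restrict_iff' measurableSet_Ioo]
    filter_upwards [h1] with x hx hx' using sub_eq_zero.1 (hx hx')
  intro β g1 g2 g3
  have hβ : IsBump s T β := ⟨g1, g2, g3⟩
  have k := (mul_eq_integral (s := s) (T := T) (f := fun u => (β u : ℂ)) (g := fun _ => 0)
    hβ.isBump_deriv.continuous_ofReal.integrableOn_Icc (fun u _ => hβ.ofReal_eq s u) hi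
    (fun t ht => by
      rw [intervalIntegral.integral_sub (intervalIntegrable_of_Icc hψ hss ht)
        (intervalIntegrable_of_Icc hχ hss ht), h t ht]
      simp)).2 T hTT
  simp only [mul_zero, zero_add] at k
  rw [intervalIntegral_eq_integral hsT.le fun x hx => by rw [hβ.eq_zero hx]; simp] at k
  simp only [Complex.real_smul]
  exact k.symm

/-- A function that satisfies the equation weakly, against a rich enough family of test functions,
satisfies it. -/
theorem exists_isSol_of_weak (hsT : s < T) (ha : a (Icc s T) < ⊤) (hχ : IntegrableOn χ (Icc s T))
    (hbχ : IntegrableOn (fun r => (b r : ℂ) * χ r) (Icc s T))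
    (hφ : ∀ t ∈ Icc s T, φ t = φ s + ∫ r in s..t, χ r) {β : ℕ → ℝ → ℝ}
    (hβ : ∀ n, IsBump s T (β n))
    (hdet : ∀ f : ℝ → ℂ, ContinuousOn f (Icc s T) → (∀ n, ∫ x, deriv (deriv (β n)) x • f x = 0) →
      ∃ c d, ∀ x ∈ Icc s T, f x = c + x * d)
    (hweak : ∀ n, ∫ x in Icc s T, ((deriv (deriv (β n)) x : ℝ) : ℂ) * φ x =
      (ξ : ℂ) ^ 2 * (∫ x in Icc s T, (β n x : ℂ) * φ x ∂a) -
        2 * Complex.I * ξ * ∫ x in Icc s T, (β n x : ℂ) * (b x * χ x)) :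
    ∃ ψ, IsSol a b ξ s T φ ψ := by
  have hss : s ∈ Icc s T := ⟨le_rfl, hsT.le⟩
  have hTT : T ∈ Icc s T := ⟨hsT.le, le_rfl⟩
  have hcφ := continuousOn_of_eq_integral hχ hφ
  have hiφ := integrableOn_of_continuousOn ha hcφ
  have haI : a (Ico s T) < ⊤ := (measure_mono Ico_subset_Icc_self).trans_lt ha
  have h1 : IntegrableOn (fun _ : ℝ => (1 : ℂ)) (Icc s T) := by simp
  -- M is the left-continuous distribution function of the right-hand side. The weak equation says
  -- that φ minus a primitive of M is annihilated by all second derivatives, hence affine with some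
  -- slope d.
  set M : ℝ → ℂ := fun t => (ξ : ℂ) ^ 2 * (∫ r in Ico s t, φ r ∂a) -
    2 * Complex.I * ξ * ∫ r in s..t, (b r : ℂ) * χ r with hM
  have hMs : M s = 0 := by simp [hM]
  have hMi : IntegrableOn M (Icc s T) := by
    have i1 := integrableOn_mul_integral_Ico haI h1 hiφ
    have i2 : ContinuousOn (fun t => ∫ r in s..t, (b r : ℂ) * χ r) (Icc s T) :=
      continuousOn_of_eq_integral hbχ fun t _ => by simp
    simp only [one_mul] at i1
    exact (i1.const_mul _).sub (i2.integrableOn_Icc.const_mul _)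
  have hIM : ∀ u ∈ Icc s T, (fun u => ∫ r in s..u, M r) u =
      (fun u => ∫ r in s..u, M r) s + ∫ r in s..u, M r := fun u _ => by simp
  have hcM : ContinuousOn (fun u => ∫ r in s..u, M r) (Icc s T) :=
    continuousOn_of_eq_integral hMi hIM
  obtain ⟨c, d, hcd⟩ := hdet (fun t => φ t - ∫ r in s..t, M r) (hcφ.sub hcM) (fun n => by
    have hb := hβ n
    have hb' := hb.isBump_deriv
    have hb'' := hb'.isBump_deriv
    have k1 := (mul_eq_integral (f := fun u => ((deriv (β n) u : ℝ) : ℂ))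
      hb''.continuous_ofReal.integrableOn_Icc (fun u _ => hb'.ofReal_eq s u) hMi hIM).2 T hTT
    have k2 := mul_sub_mul_eq (μ := a) (φ := fun u => (β n u : ℂ)) (F := M)
      (f := fun r => (ξ : ℂ) ^ 2 * φ r) (k := fun r => -(2 * Complex.I * ξ) * (b r * χ r)) hsT.le haI
      hb'.continuous_ofReal.integrableOn_Icc (fun u _ => hb.ofReal_eq s u) (hiφ.const_mul _)
      (hbχ.const_mul _) (by
        intro u hu
        rw [hMs, integral_const_mul, intervalIntegral.integral_const_mul]
        simp only [hM]
        ring)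
    have i1 : IntegrableOn (fun x => ((deriv (deriv (β n)) x : ℝ) : ℂ) * φ x) (Icc s T) :=
      (hb''.continuous_ofReal.continuousOn.mul hcφ).integrableOn_Icc
    have i2 : IntegrableOn (fun x => ((deriv (deriv (β n)) x : ℝ) : ℂ) * ∫ r in s..x, M r)
      (Icc s T) := (hb''.continuous_ofReal.continuousOn.mul hcM).integrableOn_Icc
    have i3 : IntegrableOn (fun x => ((deriv (β n) x : ℝ) : ℂ) * M x) (Icc s T) :=
      integrableOn_mul_of_continuousOn hb'.continuous_ofReal.continuousOn hMi
    have e0 : ∀ {h : ℝ → ℂ}, ∫ x in s..T, h x = ∫ x in Icc s T, h x := fun {h} => by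
      rw [intervalIntegral.integral_of_le hsT.le, integral_Icc_eq_integral_Ioc]
    have e1 : ∫ x in Ico s T, (β n x : ℂ) * φ x ∂a = ∫ x in Icc s T, (β n x : ℂ) * φ x ∂a :=
      (setIntegral_eq_of_subset_of_forall_sdiff_eq_zero measurableSet_Icc Ico_subset_Icc_self
        fun x hx => by
          rw [hb.eq_zero fun h => hx.2 (Ioo_subset_Ico_self h)]
          simp).symm
    have e3 : ∀ r, (β n r : ℂ) * ((ξ : ℂ) ^ 2 * φ r) = (ξ : ℂ) ^ 2 * (β n r * φ r) := fun r => by ring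
    have e4 : ∀ r, (β n r : ℂ) * (-(2 * Complex.I * ξ) * (b r * χ r)) =
      -(2 * Complex.I * ξ) * (β n r * (b r * χ r)) := fun r => by ring
    rw [hb'.eq_zero (x := s) (by simp), hb'.eq_zero (x := T) (by simp),
      intervalIntegral.integral_add (intervalIntegrable_of_Icc i2 hss hTT)
      (intervalIntegrable_of_Icc i3 hss hTT)] at k1
    rw [hb.eq_zero (x := s) (by simp), hb.eq_zero (x := T) (by simp)] at k2
    simp only [e3, e4, integral_const_mul, intervalIntegral.integral_const_mul, e1] at k2
    simp only [Complex.ofReal_zero, zero_mul, zero_add, sub_zero, e0] at k1 k2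
    rw [← setIntegral_eq_integral_of_forall_compl_eq_zero (s := Icc s T) fun x hx => by
      rw [hb''.eq_zero fun h => hx (Ioo_subset_Icc_self h), zero_smul]]
    simp only [Complex.real_smul, mul_sub]
    rw [integral_sub i1 i2, hweak n]
    linear_combination k1 - k2)
  have hψi : IntegrableOn (fun t => d + M t) (Icc s T) := (integrable_const d).add hMi
  have hφd : ∀ t ∈ Icc s T, φ t = φ s + ∫ r in s..t, (d + M r) := by
    intro t ht
    rw [intervalIntegral.integral_add (intervalIntegrable_of_Icc (integrable_const d) hss ht)
      (intervalIntegrable_of_Icc hMi hss ht)]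
    have q1 := hcd t ht
    have q2 := hcd s hss
    simp only [intervalIntegral.integral_same, sub_zero] at q2
    rw [intervalIntegral.integral_const, Complex.real_smul]
    push_cast
    linear_combination q1 - q2
  -- The good derivative d + M agrees almost everywhere with χ, so it may replace χ in the Lebesgue
  -- integral with b.
  have hae := ae_eq_of_integral_eq hsT hψi hχ fun t ht => by
    have q1 := hφ t ht
    rw [hφd t ht] at q1
    exact add_left_cancel q1
  refine ⟨fun t => d + M t, hψi, hbχ.congr ?_, hφd, fun t ht => ?_⟩
  · filter_upwards [hae] with r hr
    rw [hr]
  · have e : ∫ r in s..t, (b r : ℂ) * (d + M r) = ∫ r in s..t, (b r : ℂ) * χ r := by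
      rw [intervalIntegral.integral_of_le ht.1, intervalIntegral.integral_of_le ht.1]
      refine integral_congr_ae ?_
      filter_upwards [ae_restrict_of_ae_restrict_of_subset
        (Ioc_subset_Icc_self.trans (Icc_subset_Icc_right ht.2)) hae] with r hr
      rw [hr]
    rw [e, hMs]
    simp only [hM]
    ring

end HarmExt
end

/-! ### A good version of the transform, and its weak equation -/

noncomputable section
namespace HarmExt

/-- The absolutely continuous version of the Fourier transform of a harmonic function. -/
def OpL.specPhi (L : OpL) (W G : ℝ → ℝ → ℂ) (s η y : ℝ) : ℂ :=
  L.specE (-η) y * (L.specE η s * W η s + ∫ r in Ico s y, G η r)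

/-- The derivative of `OpL.specPhi`. -/
def OpL.specChi (L : OpL) (W G : ℝ → ℝ → ℂ) (s η y : ℝ) : ℂ :=
  L.specE (-η) y * G η y - Complex.I * ((2 * Real.pi * η : ℝ) : ℂ) * L.b y * L.specPhi W G s η y

variable {L : OpL} {w g W G : ℝ → ℝ → ℂ} {s t T : ℝ}

theorem OpL.specE_neg_mul (L : OpL) (η y : ℝ) : L.specE (-η) y * L.specE η y = 1 := by
  rw [OpL.specE, OpL.specE, ← Complex.exp_add, ← Complex.exp_zero]
  congr 1
  push_cast
  ring

theorem OpL.measurable_specE_neg (L : OpL) :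
    Measurable (Function.uncurry fun η y => L.specE (-η) y) :=
  L.measurable_specE.comp (f := fun q : ℝ × ℝ => (-q.1, q.2)) (by fun_prop)

theorem IsSpec.measurable_specPhi (h : IsSpec L w g W G) :
    Measurable (Function.uncurry (L.specPhi W G s)) := by
  have h1 : Measurable fun q : ℝ × ℝ => L.specE q.1 s :=
    (L.measurable_specE_left s).comp measurable_fst
  have h2 : Measurable fun q : ℝ × ℝ => W q.1 s :=
    h.measurable.comp (g := Function.uncurry W) (f := fun q : ℝ × ℝ => (q.1, s)) (by fun_prop)
  have h3 := (stronglyMeasurable_integral_Ico (μ := volume) (s := s)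
    h.measurable_deriv.stronglyMeasurable).measurable
  exact L.measurable_specE_neg.mul ((h1.mul h2).add h3)

/-- Undoing the phase in `IsSpec.specE_mul_eq`. The exceptional set depends on t, so statements for
all y at one frequency have to use `OpL.specPhi` and not W. -/
theorem IsSpec.specPhi_ae_eq (h : IsSpec L w g W G) (hs : 0 < s) (hst : s ≤ t)
    (ht : t ∈ openDom L.R) : ∀ᵐ η, L.specPhi W G s η t = W η t := by
  filter_upwards [h.specE_mul_eq hs hst ht] with η hη
  rw [OpL.specPhi, integral_Ico_eq_integral_Ioc, ← integral_Icc_eq_integral_Ioc, ← hη, ← mul_assoc,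
    L.specE_neg_mul, one_mul]

theorem OpL.measurable_ofReal_b (L : OpL) : Measurable fun y => (L.b y : ℂ) :=
  Complex.measurable_ofReal.comp L.b_measurable

theorem OpL.memLp_b (L : OpL) (hs : 0 ≤ s) (hT : T ∈ dom L.R) :
    MemLp (fun y => (L.b y : ℂ)) 2 (volume.restrict (Icc s T)) := by
  rw [memLp_two_iff_integrable_sq_norm L.measurable_ofReal_b.aestronglyMeasurable]
  simp only [Complex.norm_real, Real.norm_eq_abs, sq_abs]
  exact (L.b_sq_integrable T hT).mono_set (Icc_subset_Icc_left hs)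

/-- The product rule with the inverse phase. Integrability of b times the derivative uses b ∈ L²
twice: against G ∈ L², and as b² times a continuous function. -/
theorem OpL.specPhi_eq_integral {η : ℝ} (hs : 0 < s) (hsT : s ≤ T) (hT : T ∈ openDom L.R)
    (hG : MemLp (fun y => G η y) 2 (volume.restrict (Icc s T))) :
    IntegrableOn (L.specChi W G s η) (Icc s T) ∧
    IntegrableOn (fun y => (L.b y : ℂ) * L.specChi W G s η y) (Icc s T) ∧
    ∀ t ∈ Icc s T, L.specPhi W G s η t = L.specPhi W G s η s + ∫ r in s..t, L.specChi W G s η r := by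
  have hTd := openDom_subset_dom _ hT
  have hsub : Icc s T ⊆ Icc 0 T := Icc_subset_Icc_left hs.le
  have hIG : IntegrableOn (G η) (Icc s T) := hG.integrable (by norm_num)
  have hb : IntegrableOn (fun y => (L.b y : ℂ)) (Icc s T) :=
    ((L.coeff hTd).integrableOn.mono_set hsub).ofReal
  have hss : s ∈ Icc s T := ⟨le_rfl, hsT⟩
  set c : ℂ := Complex.I * ((2 * Real.pi * -η : ℝ) : ℂ) with hc
  have hE : ContinuousOn (L.specE (-η)) (Icc s T) :=
    (L.continuousOn_specE (-η)).mono (hsub.trans (Icc_subset_dom hTd))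
  have hi : IntegrableOn (fun r => c * L.b r * L.specE (-η) r) (Icc 0 T) := by
    simp only [mul_comm _ (L.specE _ _)]
    exact integrableOn_mul_of_continuousOn ((L.continuousOn_specE (-η)).mono (Icc_subset_dom hTd))
      ((L.coeff hTd).integrableOn.ofReal.const_mul _)
  have hE' : ∀ u ∈ Icc s T, L.specE (-η) u = L.specE (-η) s +
      ∫ r in s..u, c * L.b r * L.specE (-η) r := by
    intro u hu
    have h1 := exp_mul_B_eq L hTd c u (hsub hu)
    have h2 := exp_mul_B_eq L hTd c s (hsub hss)
    have h3 := intervalIntegral.integral_add_adjacent_intervals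
      (intervalIntegrable_of_Icc hi ⟨le_rfl, hTd.1⟩ (hsub hss))
      (intervalIntegrable_of_Icc hi (hsub hss) (hsub hu))
    simp only [OpL.specE] at h3 ⊢
    rw [h1, h2, ← h3]
    ring
  have hI : ∀ u ∈ Icc s T, L.specE η s * W η s + ∫ r in Ico s u, G η r =
      (L.specE η s * W η s + ∫ r in Ico s s, G η r) + ∫ r in s..u, G η r := by
    intro u hu
    rw [intervalIntegral.integral_of_le hu.1, integral_Ico_eq_integral_Ioc]
    simp
  obtain ⟨k1, k2⟩ := mul_eq_integral (f := L.specE (-η)) (hi.mono_set hsub) hE' hIG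
    (g := fun u => L.specE η s * W η s + ∫ r in Ico s u, G η r) hI
  have hcΦ : ContinuousOn (L.specPhi W G s η) (Icc s T) :=
    hE.mul (continuousOn_of_eq_integral hIG hI)
  have e : ∀ r, c * L.b r * L.specE (-η) r * (L.specE η s * W η s + ∫ r in Ico s r, G η r) +
      L.specE (-η) r * G η r = L.specChi W G s η r := by
    intro r
    simp only [OpL.specChi, OpL.specPhi, hc]
    push_cast
    ring
  simp only [e] at k1 k2
  refine ⟨k1, ?_, k2⟩
  have i1 : IntegrableOn (fun y => L.specE (-η) y * ((L.b y : ℂ) * G η y)) (Icc s T) := by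
    refine integrableOn_mul_of_continuousOn hE ?_
    exact (L.memLp_b hs.le hTd).integrable_mul hG
  have i2 : IntegrableOn (fun y => c * L.specPhi W G s η y * ((L.b y ^ 2 : ℝ) : ℂ)) (Icc s T) :=
    integrableOn_mul_of_continuousOn (continuousOn_const.mul hcΦ)
      ((L.b_sq_integrable T hTd).mono_set hsub).ofReal
  refine (i1.add i2).congr (Eventually.of_forall fun y => ?_)
  simp only [OpL.specChi, Pi.add_apply, hc]
  push_cast
  ring

variable {β : ℝ → ℝ} {α : ℝ → ℂ}

/-- The bound is uniform over every y, so it may also be integrated against a, whose atoms an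
almost-everywhere bound would miss. -/
theorem IsSpec.lintegral_specPhi_le (h : IsSpec L w g W G) (hs : 0 < s) (hT : T ∈ openDom L.R) :
    ∃ C : ENNReal, C < ⊤ ∧ ∀ y ∈ Icc s T, ∫⁻ η, ‖L.specPhi W G s η y‖ₑ ^ 2 ≤ C := by
  have hTd := openDom_subset_dom _ hT
  obtain ⟨C, hC, hle⟩ := h.exists_bound hTd
  refine ⟨C, hC, fun y hy => ?_⟩
  refine (lintegral_congr_ae ?_).trans_le (hle y ⟨hs.le.trans hy.1, hy.2⟩)
  filter_upwards [h.specPhi_ae_eq hs hy.1 (Icc_subset_openDom hs hTd hy)] with η hη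
  rw [hη]

theorem IsSpec.lintegral_specPhi_lt_top (h : IsSpec L w g W G) (hs : 0 < s) (hT : T ∈ openDom L.R)
    {μ : Measure ℝ} (hμ : μ (Icc s T) < ⊤) :
    ∫⁻ y in Icc s T, (∫⁻ η, ‖L.specPhi W G s η y‖ₑ ^ 2) ∂μ < ⊤ := by
  obtain ⟨C, hC, hle⟩ := h.lintegral_specPhi_le hs hT
  refine (setLIntegral_mono' measurableSet_Icc hle).trans_lt ?_
  rw [setLIntegral_const]
  exact ENNReal.mul_lt_top hC hμ

theorem IsSpec.lintegral_b_mul_specPhi_lt_top (h : IsSpec L w g W G) (hs : 0 < s)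
    (hT : T ∈ openDom L.R) :
    ∫⁻ y in Icc s T, ∫⁻ η, ‖(L.b y : ℂ) * L.specPhi W G s η y‖ₑ ^ 2 < ⊤ := by
  obtain ⟨C, hC, hle⟩ := h.lintegral_specPhi_le hs hT
  have hb := (memLp_two_iff_lintegral L.measurable_ofReal_b.aestronglyMeasurable).1
    (L.memLp_b hs.le (openDom_subset_dom _ hT))
  refine (setLIntegral_mono' measurableSet_Icc (g := fun y => ‖(L.b y : ℂ)‖ₑ ^ 2 * C)
    fun y hy => ?_).trans_lt ?_
  · simp only [enorm_mul, mul_pow]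
    rw [lintegral_const_mul' _ _ (by simp)]
    gcongr
    exact hle y hy
  · rw [lintegral_mul_const' _ _ hC.ne]
    exact ENNReal.mul_lt_top hb hC

theorem IsBump.memLp (hβ : IsBump s T β) {μ : Measure ℝ} (hμ : μ (Icc s T) < ⊤) :
    MemLp (fun y => (β y : ℂ)) 2 (μ.restrict (Icc s T)) := by
  have : IsFiniteMeasure (μ.restrict (Icc s T)) := ⟨by simpa using hμ⟩
  obtain ⟨C, hC⟩ := isCompact_Icc.exists_bound_of_continuousOn
    (hβ.continuous_ofReal.continuousOn (s := Icc s T))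
  exact MemLp.of_bound hβ.continuous_ofReal.aestronglyMeasurable C
    (by filter_upwards [ae_restrict_mem measurableSet_Icc] with y hy using hC y hy)

theorem IsBump.memLp_mul_b (hβ : IsBump s T β) (hs : 0 < s) (hT : T ∈ dom L.R) :
    MemLp (fun y => (β y : ℂ) * L.b y) 2 (volume.restrict (Icc s T)) := by
  obtain ⟨C, hC⟩ := isCompact_Icc.exists_bound_of_continuousOn
    (hβ.continuous_ofReal.continuousOn (s := Icc s T))
  refine (L.memLp_b hs.le hT).of_le_mul (c := C)
    (hβ.continuous_ofReal.aestronglyMeasurable.mul L.measurable_ofReal_b.aestronglyMeasurable) ?_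
  filter_upwards [ae_restrict_mem measurableSet_Icc] with y hy
  rw [norm_mul]
  gcongr
  exact hC y hy

/-- The weak equation in terms of the Fourier transforms, paired with test functions. -/
theorem IsSpec.weak_integral (h : IsSpec L w g W G) (hs : 0 < s) (hT : T ∈ openDom L.R)
    (hβ : IsBump s T β) (hα : ContDiff ℝ ∞ α) (hsα : HasCompactSupport α) :
    (∫ y in Icc s T, (∫ η, L.specPhi W G s η y * (β y * invFT (deriv (deriv α)) η)) ∂L.a) -
      2 * (∫ y in Icc s T, ∫ η, (L.specE (-η) y * G η y * ((β y * L.b y) * invFT (deriv α) η) +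
        L.b y * L.specPhi W G s η y * ((β y * L.b y) * invFT (deriv (deriv α)) η))) +
      ∫ y in Icc s T, ∫ η, L.specPhi W G s η y * (((deriv (deriv β) y : ℝ) : ℂ) * invFT α η) = 0 := by
  have hTd := openDom_subset_dom _ hT
  have hSo : Icc s T ⊆ openDom L.R := Icc_subset_openDom hs hTd
  have hSd : Icc s T ⊆ dom L.R := hSo.trans (openDom_subset_dom _)
  have hα' := (contDiff_infty_iff_deriv.1 hα).2
  have hα'' := (contDiff_infty_iff_deriv.1 hα').2
  have hsα' := hsα.deriv
  have hsα'' := hsα'.deriv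
  have key := h.weakEq _ (isTest_mul hα hsα hβ hSo)
  simp only [dx_mul, dy_mul α hβ, dy_mul α hβ.isBump_deriv] at key
  have hΦ : ∀ y ∈ Icc s T, ∀ᵐ η, L.specPhi W G s η y = W η y := fun y hy =>
    h.specPhi_ae_eq hs hy.1 (hSo hy)
  -- Parseval with the y-factor pulled out as a constant c. It holds at every y, as the integral
  -- against a requires.
  have hpair : ∀ {γ : ℝ → ℂ}, ContDiff ℝ ∞ γ → HasCompactSupport γ → ∀ y ∈ Icc s T, ∀ c : ℂ,
      ∫ x, w x y * (γ x * c) = ∫ η, L.specPhi W G s η y * (c * invFT γ η) := by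
    intro γ hγ hsγ y hy c
    simp only [← mul_assoc, integral_mul_const]
    rw [(h.fourier y (hSd hy)).integral_mul hγ hsγ, ← integral_mul_const]
    refine integral_congr_ae ?_
    filter_upwards [hΦ y hy] with η hη
    rw [hη]
    ring
  have hz : ∀ y, y ∉ Icc s T → β y = 0 := fun y hy =>
    hβ.eq_zero fun h' => hy (Ioo_subset_Icc_self h')
  have hz'' : ∀ y, y ∉ Icc s T → deriv (deriv β) y = 0 := fun y hy =>
    hβ.isBump_deriv.isBump_deriv.eq_zero fun h' => hy (Ioo_subset_Icc_self h')
  rw [setIntegral_openDom_eq hs hT (fun y hy => by simp [hz y hy]),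
    setIntegral_openDom_eq hs hT (fun y hy => by simp [hz y hy]),
    setIntegral_openDom_eq hs hT (fun y hy => by simp [hz'' y hy]),
    setIntegral_congr_fun measurableSet_Icc fun y hy => hpair hα'' hsα'' y hy (β y),
    setIntegral_congr_fun measurableSet_Icc fun y hy => hpair hα hsα y hy (deriv (deriv β) y : ℝ)] at key
  refine Eq.trans ?_ key
  congr 3
  refine integral_congr_ae ?_
  filter_upwards [h.fourier_deriv s T hs hT, ae_restrict_mem measurableSet_Icc] with y hgy hy
  have m1 : MemLp (fun x => g (x - L.B y) y) 2 volume :=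
    hgy.memLp_left.comp_measurePreserving (measurePreserving_sub_right volume (L.B y))
  have k1 : Integrable fun x => g (x - L.B y) y * (deriv α x * β y) := by
    simp only [← mul_assoc]
    exact (m1.integrable_mul (q := 2)
      (hα'.continuous.memLp_of_hasCompactSupport hsα')).mul_const _
  have k2 : Integrable fun x => (L.b y : ℂ) * w x y * (deriv (deriv α) x * β y) := by
    have := (((h.fourier y (hSd hy)).integrable_left hα'' hsα'').const_mul (L.b y : ℂ)).mul_const
      (β y : ℂ)
    refine this.congr (Eventually.of_forall fun x => ?_)
    ring
  have k4 := hgy.integral_translate_mul hα' hsα' (-L.B y)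
  simp only [← sub_eq_add_neg] at k4
  have hW := (h.fourier y (hSd hy)).memLp_right
  have j1 : Integrable fun η => L.specE (-η) y * G η y * ((β y * L.b y) * invFT (deriv α) η) := by
    have hm : MemLp (fun η => L.specE (-η) y * G η y) 2 volume :=
      hgy.memLp_right.of_le (((L.measurable_specE_neg).comp
        (measurable_id.prodMk measurable_const)).aestronglyMeasurable.mul hgy.memLp_right.1)
        (Eventually.of_forall fun η => by rw [norm_mul, L.norm_specE, one_mul])
    exact hm.integrable_mul ((memLp_invFT hα' hsα').const_mul _)
  have j2 : Integrable fun η => L.b y * L.specPhi W G s η y *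
      ((β y * L.b y) * invFT (deriv (deriv α)) η) := by
    have hm := (hW.const_mul (L.b y : ℂ)).integrable_mul
      ((memLp_invFT hα'' hsα'').const_mul (β y * L.b y : ℂ))
    refine hm.congr ?_
    filter_upwards [hΦ y hy] with η hη
    simp only [Pi.mul_apply, hη]
  rw [integral_add j1 j2, integral_add k1 k2, add_mul]
  congr 1
  · simp only [← mul_assoc, integral_mul_const] at k4 ⊢
    rw [k4, ← integral_mul_const, ← integral_mul_const]
    refine integral_congr_ae (Eventually.of_forall fun η => ?_)
    have e : L.specE (-η) y = Complex.exp (Complex.I * ((2 * Real.pi * η : ℝ) : ℂ) *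
        ((-L.B y : ℝ) : ℂ)) := by
      rw [OpL.specE, L.B_eq_Bdom (hSd hy)]
      congr 1
      push_cast
      ring
    simp only [e]
    ring
  · simp only [mul_assoc (L.b y : ℂ), integral_const_mul]
    congr 1
    rw [hpair hα'' hsα'' y hy (β y), ← integral_mul_const]
    refine integral_congr_ae (Eventually.of_forall fun η => ?_)
    ring

end HarmExt
end

/-! ### Almost every frequency solves the equation -/

noncomputable section
namespace HarmExt

variable {L : OpL} {w g W G : ℝ → ℝ → ℂ} {s t T : ℝ} {β : ℝ → ℝ}

/-- For almost every frequency, the Fourier transform satisfies the equation weakly. -/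
theorem IsSpec.ae_weak_form (h : IsSpec L w g W G) (hs : 0 < s)
    (hT : T ∈ openDom L.R) (hβ : IsBump s T β) :
    ∀ᵐ η, ∫ y in Icc s T, ((deriv (deriv β) y : ℝ) : ℂ) * L.specPhi W G s η y =
      ((2 * Real.pi * η : ℝ) : ℂ) ^ 2 * (∫ y in Icc s T, (β y : ℂ) * L.specPhi W G s η y ∂L.a) -
        2 * Complex.I * ((2 * Real.pi * η : ℝ) : ℂ) *
          ∫ y in Icc s T, (β y : ℂ) * (L.b y * L.specChi W G s η y) := by
  have hTd := openDom_subset_dom _ hT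
  have ha : L.a (Icc s T) < ⊤ :=
    (measure_mono (Icc_subset_Icc_left hs.le)).trans_lt (L.a_finite T hTd)
  have hvol : volume (Icc s T) < ⊤ := by simp
  have : IsFiniteMeasure (L.a.restrict (Icc s T)) := ⟨by simpa using ha⟩
  have hmG : Measurable (Function.uncurry fun η y => L.specE (-η) y * G η y) :=
    L.measurable_specE_neg.mul h.measurable_deriv
  have hmΦ : Measurable (Function.uncurry fun η y => (L.b y : ℂ) * L.specPhi W G s η y) :=
    (L.measurable_ofReal_b.comp measurable_snd).mul h.measurable_specPhi
  have hsqG : ∫⁻ y in Icc s T, ∫⁻ η, ‖L.specE (-η) y * G η y‖ₑ ^ 2 < ⊤ := by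
    have e : ∀ η y, ‖L.specE (-η) y * G η y‖ₑ = ‖G η y‖ₑ := fun η y => by
      rw [enorm_mul, ← ofReal_norm (L.specE _ _), L.norm_specE]
      simp
    simp only [e]
    exact h.sq_deriv s T hs hT
  have i1 : ∀ {A : ℝ → ℂ}, MemLp A 2 volume →
      Integrable (Function.uncurry fun y η => L.specPhi W G s η y * (β y * A η))
        ((L.a.restrict (Icc s T)).prod volume) := fun hA =>
    integrable_prod_of_sq h.measurable_specPhi (h.lintegral_specPhi_lt_top hs hT ha) (hβ.memLp ha) hA
  have i3 : ∀ {A : ℝ → ℂ}, MemLp A 2 volume → Integrable (Function.uncurry fun y η =>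
      L.specPhi W G s η y * (((deriv (deriv β) y : ℝ) : ℂ) * A η))
        ((volume.restrict (Icc s T)).prod volume) := fun hA =>
    integrable_prod_of_sq h.measurable_specPhi (h.lintegral_specPhi_lt_top hs hT hvol)
      (hβ.isBump_deriv.isBump_deriv.memLp hvol) hA
  have i2a : ∀ {A : ℝ → ℂ}, MemLp A 2 volume → Integrable (Function.uncurry fun y η =>
      L.specE (-η) y * G η y * ((β y * L.b y) * A η))
        ((volume.restrict (Icc s T)).prod volume) := fun hA =>
    integrable_prod_of_sq (X := fun η y => L.specE (-η) y * G η y) (c := fun y => β y * L.b y) hmG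
      hsqG (hβ.memLp_mul_b hs hTd) hA
  have i2b : ∀ {A : ℝ → ℂ}, MemLp A 2 volume → Integrable (Function.uncurry fun y η =>
      L.b y * L.specPhi W G s η y * ((β y * L.b y) * A η))
        ((volume.restrict (Icc s T)).prod volume) := fun hA =>
    integrable_prod_of_sq (X := fun η y => L.b y * L.specPhi W G s η y)
      (c := fun y => β y * L.b y) hmΦ (h.lintegral_b_mul_specPhi_lt_top hs hT)
      (hβ.memLp_mul_b hs hTd) hA
  have i2 : ∀ {A A' : ℝ → ℂ}, MemLp A 2 volume → MemLp A' 2 volume →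
      Integrable (Function.uncurry fun y η => L.specE (-η) y * G η y * ((β y * L.b y) * A η) +
        L.b y * L.specPhi W G s η y * ((β y * L.b y) * A' η))
        ((volume.restrict (Icc s T)).prod volume) := fun hA hA' => (i2a hA).add (i2b hA')
  -- K is the defect of the weak equation at frequency η. After Fubini, `IsSpec.weak_integral` says
  -- that K is annihilated by all transforms of test functions in x.
  set K : ℝ → ℂ := fun η =>
    -((2 * Real.pi * η : ℝ) : ℂ) ^ 2 * (∫ y in Icc s T, (β y : ℂ) * L.specPhi W G s η y ∂L.a) +
        2 * Complex.I * ((2 * Real.pi * η : ℝ) : ℂ) *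
          (∫ y in Icc s T, (β y : ℂ) * (L.b y * L.specChi W G s η y)) +
      ∫ y in Icc s T, ((deriv (deriv β) y : ℝ) : ℂ) * L.specPhi W G s η y with hK
  have e : ∀ (α : ℝ → ℂ), ContDiff ℝ ∞ α → HasCompactSupport α → ∀ η, K η * invFT α η =
      (∫ y in Icc s T, L.specPhi W G s η y * (β y * invFT (deriv (deriv α)) η) ∂L.a) -
      2 * (∫ y in Icc s T, (L.specE (-η) y * G η y * ((β y * L.b y) * invFT (deriv α) η) +
        L.b y * L.specPhi W G s η y * ((β y * L.b y) * invFT (deriv (deriv α)) η))) +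
      ∫ y in Icc s T, L.specPhi W G s η y * (((deriv (deriv β) y : ℝ) : ℂ) * invFT α η) := by
    intro α hα hsα η
    have hα' := (contDiff_infty_iff_deriv.1 hα).2
    simp only [invFT_deriv hα' hsα.deriv, invFT_deriv hα hsα]
    set k : ℂ := ((2 * Real.pi * η : ℝ) : ℂ) with hk
    have p1 : ∀ y, L.specPhi W G s η y * (β y * (-(Complex.I * k) * (-(Complex.I * k) * invFT α η))) =
        (-(k ^ 2) * invFT α η) * (β y * L.specPhi W G s η y) := fun y => by
      linear_combination (L.specPhi W G s η y * β y * k ^ 2 * invFT α η) * Complex.I_sq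
    -- The sheared derivative and the b² term combine into `OpL.specChi`, the derivative of the
    -- unsheared transform.
    have p2 : ∀ y, L.specE (-η) y * G η y * ((β y * L.b y) * (-(Complex.I * k) * invFT α η)) +
        L.b y * L.specPhi W G s η y *
          ((β y * L.b y) * (-(Complex.I * k) * (-(Complex.I * k) * invFT α η))) =
        (-(Complex.I * k) * invFT α η) * (β y * (L.b y * L.specChi W G s η y)) := fun y => by
      rw [OpL.specChi]
      ring
    have p3 : ∀ y, L.specPhi W G s η y * (((deriv (deriv β) y : ℝ) : ℂ) * invFT α η) =
        invFT α η * (((deriv (deriv β) y : ℝ) : ℂ) * L.specPhi W G s η y) := fun y => by ring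
    simp only [p1, p2, p3, integral_const_mul, hK]
    rw [← hk]
    ring
  have key := ae_eq_zero_of_integral_mul_invFT (K := K) (fun α hα hsα => by
      have hα' := (contDiff_infty_iff_deriv.1 hα).2
      have hα'' := (contDiff_infty_iff_deriv.1 hα').2
      simp only [e α hα hsα]
      exact ((i1 (memLp_invFT hα'' hsα.deriv.deriv)).integral_prod_right.sub
        ((i2 (memLp_invFT hα' hsα.deriv)
          (memLp_invFT hα'' hsα.deriv.deriv)).integral_prod_right.const_mul 2)).add
        (i3 (memLp_invFT hα hsα)).integral_prod_right)
    (fun α hα hsα => by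
      have hα' := (contDiff_infty_iff_deriv.1 hα).2
      have hα'' := (contDiff_infty_iff_deriv.1 hα').2
      have q1 := i1 (memLp_invFT hα'' hsα.deriv.deriv)
      have q2 := i2 (memLp_invFT hα' hsα.deriv) (memLp_invFT hα'' hsα.deriv.deriv)
      have q3 := i3 (memLp_invFT hα hsα)
      have hw := h.weak_integral hs hT hβ hα hsα
      rw [integral_integral_swap q1, integral_integral_swap q2, integral_integral_swap q3] at hw
      rw [← hw]
      simp only [e α hα hsα]
      exact integral_combination q1.integral_prod_right q2.integral_prod_right q3.integral_prod_right)
  filter_upwards [key] with η hη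
  simp only [hK] at hη
  linear_combination hη

/-- For almost every frequency, the Fourier transform of a harmonic function solves the equation. -/
theorem IsSpec.ae_exists_isSol (h : IsSpec L w g W G) (hs : 0 < s) (hsT : s < T)
    (hT : T ∈ openDom L.R) :
    ∀ᵐ η, ∃ ψ, IsSol L.a L.b (2 * Real.pi * η) s T (L.specPhi W G s η) ψ := by
  obtain ⟨β, hβ, hdet⟩ := exists_seq_isBump hsT
  have hTd := openDom_subset_dom _ hT
  have ha : L.a (Icc s T) < ⊤ :=
    (measure_mono (Icc_subset_Icc_left hs.le)).trans_lt (L.a_finite T hTd)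
  -- Each test function has its own null set of bad frequencies; countability of the family allows
  -- their union.
  filter_upwards [ae_all_iff.2 fun n => h.ae_weak_form hs hT (hβ n),
    h.ae_memLp_deriv hs hT] with η hη hG
  obtain ⟨k1, k2, k3⟩ := L.specPhi_eq_integral (W := W) hs hsT.le hT hG
  exact exists_isSol_of_weak hsT ha k1 k2 k3 hβ hdet hη

end HarmExt
end

/-! ### Convexity of the L² norm and uniqueness -/

noncomputable section
namespace HarmExt

theorem integral_norm_sq_eq {f : ℝ → ℂ} (hf : MemLp f 2 volume) :
    ∫ x, ‖f x‖ ^ 2 = (eLpNorm f 2 volume).toReal ^ 2 := by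
  have hm : AEStronglyMeasurable (fun x => ‖f x‖ ^ 2) volume := hf.1.norm.pow 2
  rw [← ENNReal.toReal_pow, ← lintegral_enorm_sq_eq, integral_eq_lintegral_of_nonneg_ae
    (Eventually.of_forall fun x => by positivity) hm]
  congr 1
  refine lintegral_congr fun x => ?_
  rw [ENNReal.ofReal_pow (norm_nonneg _), ofReal_norm]

variable {L : OpL} {w₁ w₂ : ℝ → ℝ → ℂ}

/-- The squared norm of the difference of two harmonic functions is a convex function of `y`. -/
theorem OpL.IsHarmonic.norm_sq_sub_mul_le (h₁ : L.IsHarmonic w₁) (h₂ : L.IsHarmonic w₂) {x y z : ℝ}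
    (hx : 0 < x) (hxy : x ≤ y) (hyz : y ≤ z) (hxz : x < z) (hz : z ∈ openDom L.R) :
    (z - x) * (eLpNorm (fun r => w₁ r y - w₂ r y) 2 volume).toReal ^ 2 ≤
      (z - y) * (eLpNorm (fun r => w₁ r x - w₂ r x) 2 volume).toReal ^ 2 +
      (y - x) * (eLpNorm (fun r => w₁ r z - w₂ r z) 2 volume).toReal ^ 2 := by
  obtain ⟨g₁, W₁, G₁, s₁⟩ := h₁.exists_isSpec
  obtain ⟨g₂, W₂, G₂, s₂⟩ := h₂.exists_isSpec
  have hzd := openDom_subset_dom _ hz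
  have hIo : Icc x z ⊆ openDom L.R := Icc_subset_openDom hx hzd
  have hF : ∀ u ∈ Icc x z, IsFourier (fun r => w₁ r u - w₂ r u) (fun η => W₁ η u - W₂ η u) :=
    fun u hu => (s₁.fourier u (openDom_subset_dom _ (hIo hu))).sub
      (s₂.fourier u (openDom_subset_dom _ (hIo hu)))
  have hi : ∀ u ∈ Icc x z, Integrable fun η => ‖W₁ η u - W₂ η u‖ ^ 2 := fun u hu =>
    (memLp_two_iff_integrable_sq_norm (hF u hu).memLp_right.1).1 (hF u hu).memLp_right
  have hx' : x ∈ Icc x z := ⟨le_rfl, hxz.le⟩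
  have hy' : y ∈ Icc x z := ⟨hxy, hyz⟩
  have hz' : z ∈ Icc x z := ⟨hxz.le, le_rfl⟩
  have hN : ∀ u ∈ Icc x z, (eLpNorm (fun r => w₁ r u - w₂ r u) 2 volume).toReal ^ 2 =
      ∫ η, ‖W₁ η u - W₂ η u‖ ^ 2 := fun u hu => by
    rw [integral_norm_sq_eq (hF u hu).memLp_right, (hF u hu).eLpNorm_eq]
  have hc : Coeff L.a L.b x z := (L.coeff hzd).mono hx.le le_rfl
  rw [hN x hx', hN y hy', hN z hz', ← integral_const_mul, ← integral_const_mul,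
    ← integral_const_mul, ← integral_add ((hi x hx').const_mul _) ((hi z hz').const_mul _)]
  refine integral_mono_ae ((hi y hy').const_mul _)
    (((hi x hx').const_mul _).add ((hi z hz').const_mul _)) ?_
  -- Only the values at x, y and z enter, so finitely many null sets are discarded before convexity
  -- is applied at the remaining frequencies.
  filter_upwards [s₁.ae_exists_isSol hx hxz hz, s₂.ae_exists_isSol hx hxz hz,
    s₁.specPhi_ae_eq hx le_rfl (hIo hx'), s₁.specPhi_ae_eq hx hxy (hIo hy'),
    s₁.specPhi_ae_eq hx hxz.le hz, s₂.specPhi_ae_eq hx le_rfl (hIo hx'),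
    s₂.specPhi_ae_eq hx hxy (hIo hy'), s₂.specPhi_ae_eq hx hxz.le hz]
    with η hs₁ hs₂ e1 e2 e3 e4 e5 e6
  obtain ⟨ψ₁, hs₁⟩ := hs₁
  obtain ⟨ψ₂, hs₂⟩ := hs₂
  have := (hs₁.add_const_mul hc.finite hs₂ (-1)).norm_sq_mul_le hc le_rfl hxy hyz le_rfl
  simp only [e1, e2, e3, e4, e5, e6, neg_one_mul, ← sub_eq_add_neg] at this
  exact this

/-- The squared norm of the difference satisfies the hypotheses of `eq_zero_of_norm_sq_mul_le`, just
as |φ|² did for the ordinary differential equation. -/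
theorem OpL.IsHarmonic.ae_eq (h₁ : L.IsHarmonic w₁) (h₂ : L.IsHarmonic w₂)
    (h0 : (fun x => w₁ x 0) =ᵐ[volume] fun x => w₂ x 0) :
    ∀ y ∈ dom L.R, (fun x => w₁ x y) =ᵐ[volume] fun x => w₂ x y := by
  set d : ℝ → ℝ → ℂ := fun x y => w₁ x y - w₂ x y with hd
  have hm : ∀ y ∈ dom L.R, MemLp (fun x => d x y) 2 volume := fun y hy =>
    (h₁.memLp y hy).sub (h₂.memLp y hy)
  have hcont : ContinuousOn (fun y => (eLpNorm (fun x => d x y) 2 volume).toReal) (dom L.R) := by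
    refine continuousOn_toReal_eLpNorm hm fun y₀ hy₀ => ?_
    have hsum := (h₁.continuous y₀ hy₀).add (h₂.continuous y₀ hy₀)
    rw [add_zero] at hsum
    refine tendsto_of_tendsto_of_tendsto_of_le_of_le' tendsto_const_nhds hsum
      (Eventually.of_forall fun _ => zero_le) ?_
    filter_upwards [self_mem_nhdsWithin] with y hy
    refine le_trans (le_of_eq ?_) (eLpNorm_sub_le ((h₁.memLp y hy).sub (h₁.memLp y₀ hy₀)).1
      ((h₂.memLp y hy).sub (h₂.memLp y₀ hy₀)).1 (by norm_num))
    congr 1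
    ext x
    simp only [hd, Pi.sub_apply]
    ring
  have hz : (0 : ℝ) ∈ dom L.R := ⟨le_rfl, by exact_mod_cast L.R_pos⟩
  have hN0 : (eLpNorm (fun x => d x 0) 2 volume).toReal = 0 := by
    rw [eLpNorm_congr_ae (g := fun _ => (0 : ℂ))]
    · simp
    · filter_upwards [h0] with x hx using sub_eq_zero.2 hx
  have htri : ∀ y ∈ dom L.R, eLpNorm (fun x => d x y) 2 volume ≤
      eLpNorm (fun x => w₁ x y) 2 volume + eLpNorm (fun x => w₂ x y) 2 volume := fun y hy =>
    eLpNorm_sub_le (h₁.memLp y hy).1 (h₂.memLp y hy).1 (by norm_num)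
  have key := eq_zero_of_norm_sq_mul_le L.R_pos
    (N := fun y => (eLpNorm (fun x => d x y) 2 volume).toReal ^ 2)
    (fun _ _ => by positivity) ?_ ?_ ?_
  · intro y hy
    have h1 := pow_eq_zero_iff (two_ne_zero) |>.1 (key y hy)
    rw [ENNReal.toReal_eq_zero_iff, or_iff_left (hm y hy).2.ne,
      eLpNorm_eq_zero_iff (hm y hy).1 (by norm_num)] at h1
    filter_upwards [h1] with x hx using sub_eq_zero.1 hx
  · intro y hy z hz' hyz
    rcases hy.1.eq_or_lt with rfl | hy0
    · simp [hN0]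
    have hzo : z ∈ openDom L.R := ⟨hy0.trans_le hyz, hz'.2⟩
    -- Convexity is available on (0, R) only, where the weak equation is tested. Letting the left
    -- endpoint tend to 0 uses L²-continuity and the common boundary value.
    have hcI : Tendsto (fun x => (eLpNorm (fun r => d r x) 2 volume).toReal) (𝓝[>] 0) (𝓝 0) := by
      have := (hcont 0 hz).tendsto
      simp only [hN0] at this
      refine this.mono_left (nhdsWithin_le_iff.2 ?_)
      filter_upwards [Ioo_mem_nhdsGT hy0] with x hx
      exact Icc_subset_dom hy ⟨hx.1.le, hx.2.le⟩
    have hid : Tendsto (fun x : ℝ => x) (𝓝[>] 0) (𝓝 0) := nhdsWithin_le_nhds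
    have l1 := (tendsto_const_nhds (x := z)).sub hid |>.mul_const
      ((eLpNorm (fun x => d x y) 2 volume).toReal ^ 2)
    have l2 := ((hcI.pow 2).const_mul (z - y)).add (((tendsto_const_nhds (x := y)).sub hid).mul_const
      ((eLpNorm (fun x => d x z) 2 volume).toReal ^ 2))
    have := le_of_tendsto_of_tendsto l1 l2 (by
      filter_upwards [Ioo_mem_nhdsGT hy0] with x hx
      exact h₁.norm_sq_sub_mul_le h₂ hx.1 hx.2.le hyz (hx.2.trans_le hyz) hzo)
    simpa using this
  · intro hR
    obtain ⟨C₁, hC₁⟩ := h₁.bounded hR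
    obtain ⟨C₂, hC₂⟩ := h₂.bounded hR
    refine ⟨(ENNReal.ofReal C₁ + ENNReal.ofReal C₂).toReal ^ 2, fun y hy => ?_⟩
    gcongr
    · simp
    · exact (htri y hy).trans (add_le_add (hC₁ y hy) (hC₂ y hy))
  · intro r hr
    have hr0 : 0 < r := by
      have := L.R_pos
      rw [hr] at this
      exact_mod_cast this
    have hsum := (h₁.vanishing r hr).add (h₂.vanishing r hr)
    rw [add_zero] at hsum
    have h1 : Tendsto (fun y => eLpNorm (fun x => d x y) 2 volume) (𝓝[<] r) (𝓝 0) := by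
      refine tendsto_of_tendsto_of_tendsto_of_le_of_le' tendsto_const_nhds hsum
        (Eventually.of_forall fun _ => zero_le) ?_
      filter_upwards [Ioo_mem_nhdsLT hr0] with y hy
      exact htri y ⟨hy.1.le, by rw [hr]; exact EReal.coe_lt_coe_iff.2 hy.2⟩
    have h2 := ((ENNReal.tendsto_toReal ENNReal.zero_ne_top).comp h1).pow 2
    simpa using h2

end HarmExt
end

/-! ### Assembly -/

noncomputable section
namespace HarmExt

variable {L : OpL} {φ ψ : ℝ → ℝ → ℂ}

/-- Frequency 0 is overridden: for finite R the constructed solution there vanishes at R, whereas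
φ_0 is 1 by convention. -/
theorem IsFamily.isPhi (h : IsFamily L φ ψ) (ξ : ℝ) :
    L.IsPhi ξ (if ξ = 0 then fun _ => 1 else φ ξ) := by
  refine ⟨fun h0 y _ => by simp [h0], fun h0 => ?_⟩
  rw [if_neg h0]
  refine ⟨isODESolution_of_isSol (h.isSol ξ), h.zero ξ, fun _ => ⟨1, h.norm_le ξ⟩, fun r hr => ?_⟩
  have hr0 : 0 < r := by
    have := L.R_pos
    rw [hr] at this
    exact_mod_cast this
  have h1 : Tendsto (fun y : ℝ => √(1 - y / r)) (𝓝[<] r) (𝓝 0) := by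
    have : ContinuousAt (fun y : ℝ => √(1 - y / r)) r := by fun_prop
    have h7 := this.tendsto.mono_left (nhdsWithin_le_nhds (s := Iio r))
    simpa [div_self hr0.ne'] using h7
  refine squeeze_zero_norm' ?_ h1
  filter_upwards [Ioo_mem_nhdsLT hr0] with y hy
  exact Real.le_sqrt_of_sq_le (h.norm_sq_le r hr ξ y
    ⟨hy.1.le, by rw [hr]; exact EReal.coe_lt_coe_iff.2 hy.2⟩)

theorem quasiMeasurePreserving_div_two_pi :
    Measure.QuasiMeasurePreserving (fun ξ : ℝ => ξ / (2 * Real.pi)) volume volume := by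
  refine ⟨by fun_prop, ?_⟩
  have h : (2 * Real.pi)⁻¹ ≠ 0 := by positivity
  simp only [div_eq_mul_inv]
  rw [Real.map_volume_mul_right h]
  exact Measure.smul_absolutelyContinuous

end HarmExt
end

theorem proposition1p1 (L : HarmExt.OpL) :
    ∃ φ : ℝ → ℝ → ℂ,
      (∀ ξ : ℝ, L.IsPhi ξ (φ ξ) ∧
        ∀ ψ : ℝ → ℂ, L.IsPhi ξ ψ → Set.EqOn ψ (φ ξ) (HarmExt.dom L.R)) ∧
      ∀ (f : ℝ → ℂ) (hf : MemLp f 2 (volume : Measure ℝ)),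
        ∃ u : ℝ → ℝ → ℂ,
          L.IsHarmonic u ∧
          (fun x => u x 0) =ᵐ[volume] f ∧
          (∀ w : ℝ → ℝ → ℂ, L.IsHarmonic w → (fun x => w x 0) =ᵐ[volume] f →
            ∀ y ∈ HarmExt.dom L.R, (fun x => w x y) =ᵐ[volume] (fun x => u x y)) ∧
          ∀ y ∈ HarmExt.dom L.R, ∃ hu : MemLp (fun x => u x y) 2 (volume : Measure ℝ),
            ∀ᵐ ξ : ℝ ∂volume,
              HarmExt.fourierL2 (hu.toLp (fun x => u x y)) ξ =
                HarmExt.fourierL2 (hf.toLp f) ξ * φ ξ y := by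
  obtain ⟨φ, ψ, h⟩ := L.exists_isFamily
  refine ⟨fun ξ => if ξ = 0 then fun _ => 1 else φ ξ,
    fun ξ => ⟨h.isPhi ξ, fun ψ hψ => hψ.eqOn (h.isPhi ξ)⟩, fun f hf => ?_⟩
  obtain ⟨u, hu, huF⟩ := h.exists_harmonic (F := (𝓕 (hf.toLp f) : Lp ℂ 2 (volume : Measure ℝ)))
    (Lp.stronglyMeasurable _).measurable (Lp.memLp _)
  have h0 : (0 : ℝ) ∈ HarmExt.dom L.R := ⟨le_rfl, by exact_mod_cast L.R_pos⟩
  have hu0 : (fun x => u x 0) =ᵐ[volume] f :=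
    (huF 0 h0).ae_eq_left ⟨hf, EventuallyEq.rfl⟩
      (Eventually.of_forall fun η => by simp [HarmExt.specU, h.zero])
  refine ⟨u, hu, hu0, fun w hw hw0 => hw.ae_eq hu (hw0.trans hu0.symm), fun y hy => ?_⟩
  obtain ⟨hm, hF⟩ := huF y hy
  refine ⟨hm, ?_⟩
  -- Rescaling the frequency by 2π preserves null sets, and ξ = 0, where the two families may
  -- differ, is itself null.
  filter_upwards [HarmExt.quasiMeasurePreserving_div_two_pi.ae hF, Measure.ae_ne volume 0] with ξ hξ hξ0
  simp only [HarmExt.fourierL2, ← hξ, HarmExt.specU, if_neg hξ0]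
  rw [mul_div_cancel₀ _ (by positivity)]
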